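/- Let $n\ge 2$ and write $\partial_{ij}=\partial_i-\partial_j$, $\partial_i=\partial/\partial x_i$, $\vec x,\vec z\in\mathbb R^n$; points at which an expression has a factor $(x_i-x_j)^{-1}$ or $(z_i-z_j)^{-1}$ are taken off the walls, i.e. with pairwise distinct coordinates. Let $$\Delta=\sum_{i=1}^n\partial_i^2,\qquad \tilde\Delta=\Delta-\sum_{1\le i<j\le n}\frac{4}{(x_i-x_j)^2},\qquad \tilde{\mathcal H}=\sum_{i=1}^n(\partial_i^2-x_i)-\sum_{1\le i<j\le n}\frac{4}{(x_i-x_j)^2}.$$ Call a non-zero differential operator $\mathcal D$ of order at most $n(n-1)/2$ a Chalykh--Veselov operator if it is a polynomial in the $\partial_{ij}$ whose coefficients are (complex) rational functions of the differences $x_i-x_j$ without poles off the walls, if $\mathcal D\Delta=\tilde\Delta\mathcal D$, and if the function $\prod_{i<j}(z_i-z_j)^{-1}\,\mathcal D[\exp(x_1z_1+\cdots+x_nz_n)]$ is symmetric under $\vec x\leftrightarrow\vec z$. Chalykh--Veselov operators exist. Let $\mathcal D_n$ be any one of them, let $\mathrm{Ai}$ be the Airy function, $\sigma(\vec x,\vec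 z)=\prod_{i=1}^n\mathrm{Ai}(x_i+z_i)$, and $\tilde\sigma=\mathcal D_n[\sigma]$, where $\mathcal D_n$ acts in $\vec x$. Then: 1. For every $\vec z\in\mathbb R^n$ the function $\tilde\sigma(\cdot,\vec z)$ is smooth off the walls and not identically zero there, and it satisfies $\tilde{\mathcal H}\tilde\sigma=\left(\sum_{i=1}^n z_i\right)\tilde\sigma$; so it is an eigenfunction of $\tilde{\mathcal H}$. 2. Neither $\tilde\sigma$ nor any multiple $c(\vec z)\tilde\sigma(\vec x,\vec z)$ by a complex-valued function $c$ that does not vanish identically off the walls is symmetric under $\vec x\leftrightarrow\vec z$, i.e. the identity $c(\vec z)\tilde\sigma(\vec x,\vec z)=c(\vec x)\tilde\sigma(\vec z,\vec x)$ fails for some $\vec x,\vec z$ off the walls. -/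

import Mathlib

noncomputable section

namespace AiryCM

/-- The Airy function `Ai(w) = (1 / 2πi) ∫ exp(t³/3 - w t) dt`, the contour being the vertical line
`t = 1 + i s`, `s ∈ ℝ` (on which the integral converges absolutely), oriented upwards. -/
def airyAi (w : ℂ) : ℂ :=
  (2 * (Real.pi : ℂ))⁻¹ *
    ∫ s : ℝ, Complex.exp ((1 + Complex.I * (s : ℂ)) ^ 3 / 3 - w * (1 + Complex.I * (s : ℂ)))

/-- Points of `ℝⁿ` with pairwise distinct coordinates: the complement of the walls `x_i = x_j`. -/
def Reg (n : ℕ) : Set (Fin n → ℝ) := {x | Function.Injective x}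

/-- The index pairs `(i, j)` with `i < j`. -/
def pairs (n : ℕ) : Finset (Fin n × Fin n) := Finset.univ.filter fun p => p.1 < p.2

/-- The partial derivative `∂_i`. -/
def pd {n : ℕ} (i : Fin n) (f : (Fin n → ℝ) → ℂ) : (Fin n → ℝ) → ℂ :=
  fun x => fderiv ℝ f x (Pi.single i 1)

/-- The operator `∂_{ij} = ∂_i - ∂_j`. -/
def pdDiff {n : ℕ} (p : Fin n × Fin n) (f : (Fin n → ℝ) → ℂ) : (Fin n → ℝ) → ℂ :=
  fun x => pd p.1 f x - pd p.2 f x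

/-- The Laplacian `Δ = ∑ ∂_i²`. -/
def lap {n : ℕ} (f : (Fin n → ℝ) → ℂ) : (Fin n → ℝ) → ℂ :=
  fun x => ∑ i, pd i (pd i f) x

/-- The potential `∑_{i<j} 4 / (x_i - x_j)²`. -/
def cmPotential {n : ℕ} (x : Fin n → ℝ) : ℂ :=
  ∑ p ∈ pairs n, 4 / ((x p.1 : ℂ) - (x p.2 : ℂ)) ^ 2

/-- The Calogero-Moser operator `Δ - ∑_{i<j} 4 / (x_i - x_j)²`. -/
def lapTilde {n : ℕ} (f : (Fin n → ℝ) → ℂ) : (Fin n → ℝ) → ℂ :=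
  fun x => lap f x - cmPotential x * f x

/-- The operator `∑ (∂_i² - x_i) - ∑_{i<j} 4 / (x_i - x_j)²`. -/
def hamTilde {n : ℕ} (f : (Fin n → ℝ) → ℂ) : (Fin n → ℝ) → ℂ :=
  fun x => (∑ i, (pd i (pd i f) x - (x i : ℂ) * f x)) - cmPotential x * f x

/-- The product `∏_{i<j} (x_i - x_j)`. -/
def vdm {n : ℕ} (x : Fin n → ℝ) : ℂ :=
  ∏ p ∈ pairs n, ((x p.1 : ℂ) - (x p.2 : ℂ))

/-- `c` is a rational function of the differences `x_i - x_j` without poles off the walls. -/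
def IsRationalInDiffs {n : ℕ} (c : (Fin n → ℝ) → ℂ) : Prop :=
  ∃ p q : MvPolynomial (Fin n × Fin n) ℂ, ∀ x ∈ Reg n,
    MvPolynomial.eval (fun k => (x k.1 : ℂ) - (x k.2 : ℂ)) q ≠ 0 ∧
    c x = MvPolynomial.eval (fun k => (x k.1 : ℂ) - (x k.2 : ℂ)) p /
      MvPolynomial.eval (fun k => (x k.1 : ℂ) - (x k.2 : ℂ)) q

/-- A polynomial in the operators `∂_{ij}` with functions as coefficients (on the left), written as
a finite sum of coefficients times words in the `∂_{ij}`. -/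
abbrev DiffPoly (n : ℕ) : Type := List (Fin n × Fin n) →₀ ((Fin n → ℝ) → ℂ)

/-- The action of the differential operator `∑_w c_w(x) ∂_{w_1} ⋯ ∂_{w_k}` on a function. -/
def DiffPoly.apply {n : ℕ} (D : DiffPoly n) (f : (Fin n → ℝ) → ℂ) : (Fin n → ℝ) → ℂ :=
  fun x => D.sum fun w c => c x * w.foldr pdDiff f x

/-- The plane wave `φ(x, z) = exp(x_1 z_1 + ⋯ + x_n z_n)`. -/
def planeWave {n : ℕ} (x z : Fin n → ℝ) : ℂ := Complex.exp (∑ i, (x i : ℂ) * (z i : ℂ))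

/-- Symmetry `F(x, z) = F(z, x)` wherever both sides are defined. -/
def IsSymm {n : ℕ} (F : (Fin n → ℝ) → (Fin n → ℝ) → ℂ) : Prop :=
  ∀ x ∈ Reg n, ∀ z ∈ Reg n, F x z = F z x

/-- `D` is a Chalykh-Veselov operator. The last two fields fix it up to a non-zero constant:
without them the zero operator, for instance, would qualify. -/
structure IsChalykhVeselov (n : ℕ) (D : DiffPoly n) : Prop where
  /-- The coefficients are rational in the differences `x_i - x_j`. -/
  rational : ∀ w, IsRationalInDiffs (D w)
  /-- `D Δ = (Δ - ∑_{i<j} 4 / (x_i - x_j)²) D`. -/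
  intertwines : ∀ f : (Fin n → ℝ) → ℂ, ContDiff ℝ (⊤ : ℕ∞) f → ∀ x ∈ Reg n,
    D.apply (lap f) x = lapTilde (D.apply f) x
  /-- `∏_{i<j} (z_i - z_j)⁻¹ D[φ]` is symmetric in `x` and `z`. -/
  symm : IsSymm fun x z : Fin n → ℝ => (vdm z)⁻¹ * D.apply (fun y => planeWave y z) x
  /-- The order of `D` is at most the number of pairs `i < j`. -/
  order_le : ∀ w ∈ D.support, w.length ≤ n * (n - 1) / 2
  /-- `D` is not the zero operator. -/
  ne_zero : ∃ f : (Fin n → ℝ) → ℂ, ContDiff ℝ (⊤ : ℕ∞) f ∧ ∃ x ∈ Reg n, D.apply f x ≠ 0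

/-- `σ(x, z) = ∏ Ai(x_i + z_i)`. -/
def airyProd {n : ℕ} (x z : Fin n → ℝ) : ℂ := ∏ i, airyAi ((x i : ℂ) + (z i : ℂ))

/-- `σ̃(x, z) = D[σ(·, z)](x)`. -/
def sigmaTilde {n : ℕ} (D : DiffPoly n) (x z : Fin n → ℝ) : ℂ :=
  D.apply (fun y => airyProd y z) x

end AiryCM

end

/-! Write `V` for the product of the `x_i - x_j` over `i < j`, and `N = n(n-1)/2` for its degree.

Existence. Conjugation by `V` turns `Δ - ∑ 4/(x_i - x_j)²` into `L = Δ - 2 ∑_{i<j} (x_i - x_j)⁻¹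
∂_{ij}`. The operator `L` preserves the space of functions `P(x, z) exp(∑ x_i z_i)`, `P` polynomial,
whose normal derivatives vanish on all walls (`IsQuot.qi_cmOp`). The top part in `x` of such a `P`
is divisible by `V`, so `P = 0` if its degree in `x` is below `N` (`QI.eq_zero_of_degLT`); since `L
- ∑ z_i²` lowers this degree, a `P` of degree at most `N` is an eigenfunction (`QI.cmOp_eq`). A
non-zero one arises from `V² exp(∑ x_i z_i)` by applying `L - ∑ z_i²` exactly `N` times
(`exists_leadState`). It is averaged over simultaneous permutations of `x` and `z` and then over the
exchange of `x` and `z`; the exchange respects the wall condition by bispectral duality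
(`QI.swapVars`). After centring the variables, `V⁻¹ P(x, ∂)` is a Chalykh-Veselov operator.

Eigenfunction. The Airy equation gives `Δσ = ∑ (x_i + z_i) σ`. An operator `D` built from the
`∂_{ij}` commutes with multiplication by `∑ x_i`, so the intertwining relation yields the claim
(`IsChalykhVeselov.hamTilde_sigmaTilde`).

Asymmetry. Fix `ζ` with distinct negative coordinates and let `x(s) = s² ζ²`. Since `Ai⁽ᵐ⁾(w) ~
(-√w)ᵐ Ai(w)`, applying `q(∂)` to `σ` along this curve is, to leading order, multiplication by the
top part of `q` at `sζ` (`tendsto_opAt_airyFun`). The leading part `e`, of degree `k`, of the symbol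
of `D` is independent of `x` (`IsChalykhVeselov.homogeneousComponent_symbol_eq`). As `σ` depends on
`x + z` only, `σ̃(x(s), z)` and `σ̃(z, x(s))` have the same asymptotics `e(ζ) sᵏ σ`; this forces any
symmetrizing factor `c` to be constant off the walls. If `σ̃` itself were symmetric, the difference
of the symbols at `x(s)` and at `z` would annihilate `σ`, and the next order of the asymptotics
would make the degree `k - 1` part of the symbol, at `ζ`, independent of the point. But the
intertwining relation says that twice its derivative along `ζ` is `e(ζ) ∑ 4/(x_i - x_j)²`, which is
not zero. -/

open MvPolynomial

noncomputable section

namespace AiryCM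

section

/-! ### Quasi-invariants and the gauged Calogero-Moser operator -/

section QuasiInvariants

variable {n : ℕ} {S : Type*} [CommRing S]

/-- The linear form `x_i - x_j`. -/
def varDiff (i j : Fin n) : MvPolynomial (Fin n) S := X i - X j

/-- The substitution `x_i := x_j`. -/
def identify (i j : Fin n) : MvPolynomial (Fin n) S →ₐ[S] MvPolynomial (Fin n) S :=
  rename (Function.update id i j)

/-- The operator `∂_i + ζ_i`, i.e. `∂_i` conjugated by `exp(∑ x_i ζ_i)`. -/
def nab (ζ : Fin n → S) (i : Fin n) : MvPolynomial (Fin n) S →ₗ[S] MvPolynomial (Fin n) S :=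
  (pderiv i : Derivation S _ _).toLinearMap + LinearMap.mulLeft S (C (ζ i))

lemma nab_apply (ζ : Fin n → S) (i : Fin n) (P : MvPolynomial (Fin n) S) :
    nab ζ i P = pderiv i P + C (ζ i) * P := rfl

lemma pderiv_comm (i j : Fin n) (P : MvPolynomial (Fin n) S) :
    pderiv i (pderiv j P) = pderiv j (pderiv i P) := by
  have h : ⁅(pderiv i : Derivation S (MvPolynomial (Fin n) S) (MvPolynomial (Fin n) S)),
      (pderiv j : Derivation S (MvPolynomial (Fin n) S) (MvPolynomial (Fin n) S))⁆ = 0 := by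
    classical
    refine derivation_ext fun k => ?_
    simp only [Derivation.commutator_apply, pderiv_X, Derivation.coe_zero, Pi.zero_apply,
      Pi.single_apply]
    split_ifs <;> simp
  have h2 := congrArg (fun D => D P) h
  simpa [Derivation.commutator_apply, sub_eq_zero] using h2

lemma nab_comm (ζ : Fin n → S) (i j : Fin n) (P : MvPolynomial (Fin n) S) :
    nab ζ i (nab ζ j P) = nab ζ j (nab ζ i P) := by
  simp only [nab_apply, map_add, pderiv_C_mul, pderiv_comm i j]
  ring

lemma nab_mul (ζ : Fin n → S) (i : Fin n) (f g : MvPolynomial (Fin n) S) :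
    nab ζ i (f * g) = pderiv i f * g + f * nab ζ i g := by
  simp only [nab_apply, pderiv_mul]
  ring

lemma nab_sub_mul (ζ : Fin n → S) (i j : Fin n) (f g : MvPolynomial (Fin n) S) :
    nab ζ i (f * g) - nab ζ j (f * g) =
      (pderiv i f - pderiv j f) * g + f * (nab ζ i g - nab ζ j g) := by
  rw [nab_mul, nab_mul]
  ring

lemma nab_sub_comm (ζ : Fin n → S) (a b i j : Fin n) (P : MvPolynomial (Fin n) S) :
    nab ζ a (nab ζ i P - nab ζ j P) - nab ζ b (nab ζ i P - nab ζ j P) =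
      nab ζ i (nab ζ a P - nab ζ b P) - nab ζ j (nab ζ a P - nab ζ b P) := by
  simp only [map_sub]
  rw [nab_comm ζ a i, nab_comm ζ a j, nab_comm ζ b i, nab_comm ζ b j]
  ring

lemma pderiv_varDiff (k i j : Fin n) :
    pderiv k (varDiff i j : MvPolynomial (Fin n) S) =
      (if i = k then 1 else 0) - (if j = k then 1 else 0) := by
  simp only [varDiff, map_sub, pderiv_X, Pi.single_apply]

lemma identify_varDiff (i j k l : Fin n) :
    identify i j (varDiff k l : MvPolynomial (Fin n) S) =
      varDiff (Function.update id i j k) (Function.update id i j l) := by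
  simp [identify, varDiff]

lemma identify_varDiff_self (i j : Fin n) :
    identify i j (varDiff i j : MvPolynomial (Fin n) S) = 0 := by
  rw [identify_varDiff]
  by_cases h : j = i <;> simp [varDiff, h]

lemma varDiff_ne_zero [Nontrivial S] {i j : Fin n} (h : i ≠ j) :
    (varDiff i j : MvPolynomial (Fin n) S) ≠ 0 :=
  fun h0 => h (X_injective (sub_eq_zero.1 h0))

lemma identify_varDiff_ne_zero [Nontrivial S] {i j k l : Fin n} (hkl : k ≠ l)
    (h1 : ¬(k = i ∧ l = j)) (h2 : ¬(k = j ∧ l = i)) :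
    identify i j (varDiff k l : MvPolynomial (Fin n) S) ≠ 0 := by
  rw [identify_varDiff]
  refine varDiff_ne_zero ?_
  simp only [Function.update_apply, id]
  grind

/-- The linear form `x_i - x_j` divides `f` iff `f` vanishes under the substitution `x_i := x_j`. -/
lemma varDiff_dvd_iff (i j : Fin n) (f : MvPolynomial (Fin n) S) :
    varDiff i j ∣ f ↔ identify i j f = 0 := by
  constructor
  · rintro ⟨g, rfl⟩
    rw [map_mul, identify_varDiff_self, zero_mul]
  · intro h
    -- Modulo `x_i - x_j` the substitution is the identity, so its kernel lies in the ideal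
    -- generated by this form.
    have key : (Ideal.Quotient.mkₐ S (Ideal.span {(varDiff i j : MvPolynomial (Fin n) S)})).comp
        (identify i j) = Ideal.Quotient.mkₐ S (Ideal.span {varDiff i j}) := by
      refine algHom_ext fun k => ?_
      simp only [AlgHom.comp_apply, identify, rename_X, Ideal.Quotient.mkₐ_eq_mk]
      rw [Ideal.Quotient.eq, Ideal.mem_span_singleton]
      by_cases hk : k = i
      · subst hk
        refine ⟨-1, ?_⟩
        simp [varDiff]
      · simp [hk]
    have h3 := congrArg (fun D => D f) key
    simp only [AlgHom.comp_apply, h, map_zero, Ideal.Quotient.mkₐ_eq_mk] at h3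
    rw [← Ideal.mem_span_singleton]
    exact Ideal.Quotient.eq_zero_iff_mem.1 h3.symm

/-- The substitution `x_i := x_j` takes values in a domain and kills `x_k - x_l` only if the two
pairs coincide up to order. -/
lemma varDiff_dvd_of_dvd_mul [IsDomain S] {i j k l : Fin n} (hkl : k ≠ l)
    (h1 : ¬(k = i ∧ l = j)) (h2 : ¬(k = j ∧ l = i)) {f : MvPolynomial (Fin n) S}
    (h : varDiff i j ∣ varDiff k l * f) : varDiff i j ∣ f := by
  rw [varDiff_dvd_iff, map_mul] at h
  rw [varDiff_dvd_iff]
  exact (mul_eq_zero.1 h).resolve_left (identify_varDiff_ne_zero hkl h1 h2)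

/-- `P exp(∑ x_i ζ_i)` has vanishing normal derivative on each of the walls `x_i = x_j`. -/
def QI (ζ : Fin n → S) (P : MvPolynomial (Fin n) S) : Prop :=
  ∀ i j, varDiff i j ∣ nab ζ i P - nab ζ j P

/-- The quotients of `(∂_i + ζ_i - ∂_j - ζ_j) P` by `x_i - x_j`. -/
structure IsQuot (ζ : Fin n → S) (P : MvPolynomial (Fin n) S)
    (Q : Fin n → Fin n → MvPolynomial (Fin n) S) : Prop where
  mul_eq : ∀ i j, varDiff i j * Q i j = nab ζ i P - nab ζ j P
  diag : ∀ i, Q i i = 0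

lemma QI.exists_isQuot {ζ : Fin n → S} {P : MvPolynomial (Fin n) S} (h : QI ζ P) :
    ∃ Q, IsQuot ζ P Q := by
  choose Q hQ using h
  -- For `i = j` the equation is `0 = 0` and leaves the quotient undetermined; the value zero allows
  -- sums over all pairs.
  refine ⟨fun i j => if i = j then 0 else Q i j, fun i j => ?_, fun i => by simp⟩
  by_cases hij : i = j
  · simp [hij]
  · simp [hij, hQ i j]

lemma IsQuot.symm [IsDomain S] {ζ : Fin n → S} {P : MvPolynomial (Fin n) S}
    {Q : Fin n → Fin n → MvPolynomial (Fin n) S} (h : IsQuot ζ P Q) (i j : Fin n) :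
    Q i j = Q j i := by
  by_cases hij : i = j
  · rw [hij]
  · refine mul_left_cancel₀ (varDiff_ne_zero (S := S) hij) ?_
    have h2 := h.mul_eq j i
    rw [h.mul_eq i j]
    simp only [varDiff] at h2 ⊢
    linear_combination h2

/-- The Calogero-Moser operator in the gauge in which it preserves quasi-invariants:
`∑ (∂_i + ζ_i)² - 2 ∑_{i<j} (x_i - x_j)⁻¹ (∂_i + ζ_i - ∂_j - ζ_j)`. -/
def cmOp (ζ : Fin n → S) (P : MvPolynomial (Fin n) S)
    (Q : Fin n → Fin n → MvPolynomial (Fin n) S) : MvPolynomial (Fin n) S :=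
  ∑ i, nab ζ i (nab ζ i P) - ∑ i, ∑ j, Q i j

/-- Bookkeeping for the restriction to the wall `x_a = x_b`: disjoint pairs contribute nothing, `(a,
k)` cancels against `(b, k)`, and only `(a, b)` and `(b, a)` remain. -/
lemma sum_sum_eq_of_cancel {M : Type*} [AddCommGroup M] {a b : Fin n} (hab : a ≠ b)
    (T : Fin n → Fin n → M) (hsymm : ∀ i j, T i j = T j i) (hdiag : ∀ i, T i i = 0)
    (hoff : ∀ i j, i ≠ a → i ≠ b → j ≠ a → j ≠ b → T i j = 0)
    (hcancel : ∀ k, k ≠ a → k ≠ b → T a k + T b k = 0) :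
    ∑ i, ∑ j, T i j = T a b + T a b := by
  have h1 : ∀ i, i ≠ a ∧ i ≠ b → ∑ j, T i j = 0 := by
    rintro i ⟨ha, hb⟩
    rw [Fintype.sum_eq_add a b hab (fun j hj => hoff i j ha hb hj.1 hj.2), hsymm i a, hsymm i b]
    exact hcancel i ha hb
  rw [Fintype.sum_eq_add a b hab h1, ← Finset.sum_add_distrib,
    Fintype.sum_eq_add a b hab (fun j hj => hcancel j hj.1 hj.2), hdiag, hdiag, hsymm b a]
  abel

/-- The operator `cmOp` preserves quasi-invariants. -/
lemma IsQuot.qi_cmOp [IsDomain S] {ζ : Fin n → S} {P : MvPolynomial (Fin n) S}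
    {Q : Fin n → Fin n → MvPolynomial (Fin n) S} (h : IsQuot ζ P Q) : QI ζ (cmOp ζ P Q) := by
  intro a b
  by_cases hab : a = b
  · subst hab; simp
  rw [varDiff_dvd_iff]
  set I : MvPolynomial (Fin n) S →ₐ[S] MvPolynomial (Fin n) S := identify a b with hI
  have hIy : I (varDiff a b) = 0 := identify_varDiff_self a b
  -- Two derivatives of `(x_a - x_b) Q_ab`, restricted to the wall, leave only the cross term
  -- because the factor is linear.
  have hD : ∀ i, I (nab ζ a (nab ζ i (nab ζ i P)) - nab ζ b (nab ζ i (nab ζ i P))) =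
      2 * (I (pderiv i (varDiff a b)) * I (nab ζ i (Q a b))) := by
    intro i
    rw [nab_comm ζ a i, nab_comm ζ b i, nab_comm ζ a i, nab_comm ζ b i, ← map_sub, ← map_sub,
      ← h.mul_eq a b, nab_mul, map_add, nab_mul, nab_mul]
    have h0 : pderiv i (pderiv i (varDiff a b : MvPolynomial (Fin n) S)) = 0 := by
      rw [pderiv_varDiff]; split_ifs <;> simp
    rw [h0]
    simp only [map_add, map_mul, hIy, map_zero]
    ring
  have hsum : ∑ i, I (pderiv i (varDiff a b)) * I (nab ζ i (Q a b)) =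
      I (nab ζ a (Q a b) - nab ζ b (Q a b)) := by
    rw [Fintype.sum_eq_add a b hab]
    · simp [pderiv_varDiff, hab, Ne.symm hab, sub_eq_add_neg]
    · rintro i ⟨h1, h2⟩
      simp [pderiv_varDiff, Ne.symm h1, Ne.symm h2]
  set T : Fin n → Fin n → MvPolynomial (Fin n) S := fun i j =>
    I (nab ζ a (Q i j) - nab ζ b (Q i j)) with hT
  have hTsum : ∑ i, ∑ j, T i j = T a b + T a b := by
    refine sum_sum_eq_of_cancel hab T (fun i j => by simp only [hT, h.symm i j])
      (fun i => by simp [hT, h.diag]) ?_ ?_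
    -- For a disjoint pair the differences in directions `ab` and `ij` commute and do not see each
    -- other's linear form, so `(x_i - x_j) T_ij` vanishes on the wall.
    · intro i j hia hib hja hjb
      by_cases hij : i = j
      · simp [hT, hij, h.diag]
      have e1 := nab_sub_mul ζ a b (varDiff i j) (Q i j)
      have e2 := nab_sub_mul ζ i j (varDiff a b) (Q a b)
      rw [h.mul_eq] at e1 e2
      have e3 := nab_sub_comm ζ a b i j P
      rw [e1, e2] at e3
      have e4 := congrArg I e3
      simp only [pderiv_varDiff, if_neg hia, if_neg hib, if_neg hja, if_neg hjb, if_neg (Ne.symm hia),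
        if_neg (Ne.symm hib), if_neg (Ne.symm hja), if_neg (Ne.symm hjb), sub_self, zero_mul,
        zero_add, map_mul, hIy] at e4
      refine (mul_eq_zero.1 e4).resolve_left ?_
      refine identify_varDiff_ne_zero hij ?_ ?_
      · rintro ⟨h1, -⟩; exact hia h1
      · rintro ⟨h1, -⟩; exact hib h1
    -- On the wall `x_a - x_k = x_b - x_k`, hence `Q_ak = Q_bk` there (`g4`); the two commutation
    -- identities then add up to the cancellation.
    · intro k hka hkb
      have e1 := nab_sub_mul ζ a b (varDiff a k) (Q a k)
      have e2 := nab_sub_mul ζ a k (varDiff a b) (Q a b)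
      have f1 := nab_sub_mul ζ a b (varDiff b k) (Q b k)
      have f2 := nab_sub_mul ζ b k (varDiff a b) (Q a b)
      rw [h.mul_eq] at e1 e2 f1 f2
      have e3 := nab_sub_comm ζ a b a k P
      have f3 := nab_sub_comm ζ a b b k P
      rw [e1, e2] at e3
      rw [f1, f2] at f3
      have e4 := congrArg I e3
      have f4 := congrArg I f3
      have g1 := congrArg I (h.mul_eq a k)
      have g2 := congrArg I (h.mul_eq b k)
      have g3 := congrArg I (h.mul_eq a b)
      have hu : I (varDiff a k) = I (varDiff b k) := by
        simp [hI, identify_varDiff, Function.update_apply, Ne.symm hab]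
      have hu0 : I (varDiff b k) ≠ 0 := by
        refine identify_varDiff_ne_zero (Ne.symm hkb) ?_ ?_
        · rintro ⟨h1, -⟩; exact hab h1.symm
        · rintro ⟨-, h1⟩; exact hka h1
      simp only [pderiv_varDiff, if_neg hka, if_neg hkb, if_neg hab, if_neg (Ne.symm hka),
        if_neg (Ne.symm hkb), if_neg (Ne.symm hab), if_true, map_mul, map_add, map_sub, hIy,
        zero_mul, add_zero, map_one, sub_zero, zero_sub, map_neg, hu] at e4 f4 g1 g2 g3
      have g4 : I (Q a k) - I (Q b k) = 0 := by
        refine (mul_eq_zero.1 (?_ : I (varDiff b k) * _ = 0)).resolve_left hu0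
        linear_combination g1 - g2 - g3
      refine (mul_eq_zero.1 (?_ : I (varDiff b k) * _ = 0)).resolve_left hu0
      simp only [hT, map_sub]
      linear_combination e4 + f4 - g4
  have hTs : ∑ i, ∑ j, T i j =
      I (nab ζ a (∑ i, ∑ j, Q i j) - nab ζ b (∑ i, ∑ j, Q i j)) := by
    simp only [hT, map_sum, ← Finset.sum_sub_distrib]
  have hDs : I (nab ζ a (∑ i, nab ζ i (nab ζ i P)) - nab ζ b (∑ i, nab ζ i (nab ζ i P))) =
      2 * T a b := by
    rw [map_sum, map_sum, ← Finset.sum_sub_distrib, map_sum]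
    simp only [hD]
    rw [← Finset.mul_sum, hsum]
  have : I (nab ζ a (cmOp ζ P Q) - nab ζ b (cmOp ζ P Q)) = 2 * T a b - ∑ i, ∑ j, T i j := by
    rw [hTs, ← hDs, ← map_sub]
    congr 1
    rw [cmOp, map_sub, map_sub]
    ring
  -- The second-order terms and the quotients both contribute `2 T_ab`: the coupling constant is
  -- exactly the one for which they cancel.
  rw [this, hTsum]
  ring

end QuasiInvariants

end

section

/-! ### Degrees and top homogeneous parts -/

section DegreeBound

variable {n : ℕ} {S : Type*} [CommRing S]

/-- The polynomials all of whose monomials have degree less than `d`. -/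
def degLT (n : ℕ) (S : Type*) [CommRing S] (d : ℕ) : Submodule S (MvPolynomial (Fin n) S) where
  carrier := {f | ∀ m, d ≤ m.degree → coeff m f = 0}
  zero_mem' := fun m _ => coeff_zero m
  add_mem' := fun hf hg m hm => by rw [coeff_add, hf m hm, hg m hm, add_zero]
  smul_mem' := fun c f hf m hm => by rw [coeff_smul, hf m hm, smul_zero]

lemma mem_degLT {d : ℕ} {f : MvPolynomial (Fin n) S} :
    f ∈ degLT n S d ↔ ∀ m, d ≤ m.degree → coeff m f = 0 := Iff.rfl

lemma degLT_mono {d e : ℕ} (h : d ≤ e) {f : MvPolynomial (Fin n) S} (hf : f ∈ degLT n S d) :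
    f ∈ degLT n S e := fun m hm => hf m (h.trans hm)

lemma mem_degLT_zero {f : MvPolynomial (Fin n) S} : f ∈ degLT n S 0 ↔ f = 0 :=
  ⟨fun h => by ext m; exact h m (Nat.zero_le _), fun h => h ▸ zero_mem _⟩

lemma totalDegree_lt_of_mem_degLT {d : ℕ} {f : MvPolynomial (Fin n) S} (hf : f ∈ degLT n S d)
    (h0 : f ≠ 0) : f.totalDegree < d := by
  obtain ⟨m, hm, hd⟩ : ∃ m ∈ f.support, f.totalDegree = m.degree := by
    rw [totalDegree_eq]
    obtain ⟨m, hm, h⟩ := Finset.exists_mem_eq_sup f.support (support_nonempty.2 h0)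
      fun m => Multiset.card (Finsupp.toMultiset m)
    exact ⟨m, hm, by rw [h, Finsupp.card_toMultiset, Finsupp.degree_eq_sum,
      Finsupp.sum_fintype _ _ (by simp)]; rfl⟩
  rw [hd]
  by_contra! hlt
  exact (mem_support_iff.1 hm) (hf m hlt)

lemma mem_degLT_of_totalDegree_lt {d : ℕ} {f : MvPolynomial (Fin n) S} (h : f.totalDegree < d) :
    f ∈ degLT n S d := by
  intro m hm
  by_contra hne
  have := le_totalDegree (mem_support_iff.2 hne)
  rw [Finsupp.degree_eq_sum] at hm
  rw [Finsupp.sum_fintype _ _ (by simp)] at this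
  omega

lemma mem_degLT_iff {d : ℕ} {f : MvPolynomial (Fin n) S} :
    f ∈ degLT n S d ↔ f = 0 ∨ f.totalDegree < d := by
  refine ⟨fun h => or_iff_not_imp_left.2 (totalDegree_lt_of_mem_degLT h), ?_⟩
  rintro (rfl | h)
  · exact zero_mem _
  · exact mem_degLT_of_totalDegree_lt h

lemma mem_degLT_succ_iff {d : ℕ} {f : MvPolynomial (Fin n) S} :
    f ∈ degLT n S (d + 1) ↔ f.totalDegree ≤ d := by
  rw [mem_degLT_iff]
  refine ⟨?_, fun h => Or.inr (Nat.lt_succ_of_le h)⟩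
  rintro (rfl | h)
  · simp
  · omega

lemma pderiv_mem_degLT {d : ℕ} {f : MvPolynomial (Fin n) S} (hf : f ∈ degLT n S (d + 1))
    (i : Fin n) : pderiv i f ∈ degLT n S d := by
  intro m hm
  rw [coeff_pderiv, hf _ (by simpa using hm), zero_mul]

lemma _root_.MvPolynomial.IsHomogeneous.mem_degLT {d : ℕ} {f : MvPolynomial (Fin n) S}
    (hf : f.IsHomogeneous d) : f ∈ degLT n S (d + 1) :=
  fun m hm => hf.coeff_eq_zero (by omega)

lemma mul_mem_degLT {d e : ℕ} {f g : MvPolynomial (Fin n) S} (hf : f ∈ degLT n S (d + 1))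
    (hg : g ∈ degLT n S e) : f * g ∈ degLT n S (d + e) := by
  rw [mem_degLT_succ_iff] at hf
  rw [mem_degLT_iff] at hg ⊢
  rcases hg with rfl | hg
  · simp
  · exact Or.inr ((totalDegree_mul f g).trans_lt (by omega))

lemma C_mul_mem_degLT {d : ℕ} {g : MvPolynomial (Fin n) S} (c : S)
    (hg : g ∈ degLT n S d) : C c * g ∈ degLT n S d := by
  rw [C_mul']
  exact Submodule.smul_mem _ _ hg

lemma sub_homogeneousComponent_mem_degLT {d : ℕ} {f : MvPolynomial (Fin n) S}
    (hf : f ∈ degLT n S (d + 1)) : f - homogeneousComponent d f ∈ degLT n S d := by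
  intro m hm
  rw [coeff_sub, coeff_homogeneousComponent]
  split_ifs with h
  · simp
  · rw [hf m (by omega)]; simp

lemma mem_degLT_of_mul [IsDomain S] {d e : ℕ} {f g : MvPolynomial (Fin n) S}
    (hf : f.IsHomogeneous e) (h0 : f ≠ 0) (h : f * g ∈ degLT n S (e + d)) : g ∈ degLT n S d := by
  rw [mem_degLT_iff] at h ⊢
  by_cases hg : g = 0
  · exact Or.inl hg
  · rcases h with h | h
    · exact absurd h (mul_ne_zero h0 hg)
    · rw [totalDegree_mul_of_isDomain h0 hg, hf.totalDegree h0] at h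
      exact Or.inr (by omega)

lemma isHomogeneous_varDiff (i j : Fin n) : (varDiff i j : MvPolynomial (Fin n) S).IsHomogeneous 1 :=
  (isHomogeneous_X S i).sub (isHomogeneous_X S j)

lemma homogeneousComponent_identify (i j : Fin n) (d : ℕ) (f : MvPolynomial (Fin n) S) :
    homogeneousComponent d (identify i j f) = identify i j (homogeneousComponent d f) :=
  (rename_homogeneousComponent d f).symm

lemma varDiff_dvd_homogeneousComponent {i j : Fin n} {f : MvPolynomial (Fin n) S}
    (h : varDiff i j ∣ f) (d : ℕ) : varDiff i j ∣ homogeneousComponent d f := by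
  rw [varDiff_dvd_iff] at h ⊢
  rw [← homogeneousComponent_identify, h, map_zero]

/-- The top homogeneous part of a quasi-invariant is divisible by `x_i - x_j` if `ζ_i ≠ ζ_j`. -/
lemma QI.varDiff_dvd_top [IsDomain S] {ζ : Fin n → S} {P : MvPolynomial (Fin n) S} (h : QI ζ P)
    {d : ℕ} (hd : P ∈ degLT n S (d + 1)) {i j : Fin n} (hij : ζ i ≠ ζ j) :
    varDiff i j ∣ homogeneousComponent d P := by
  have h1 := varDiff_dvd_homogeneousComponent (h i j) d
  -- Derivatives drop below degree `d`, so in this degree only `(ζ_i - ζ_j)` times the top part is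
  -- left.
  have h2 : ∀ k, homogeneousComponent d (pderiv k P) = 0 := fun k => by
    ext m
    rw [coeff_homogeneousComponent]
    split_ifs with hm
    · exact pderiv_mem_degLT hd k m hm.ge
    · simp
  simp only [nab_apply, map_sub, map_add, h2, homogeneousComponent_C_mul, zero_add] at h1
  rw [← sub_mul, ← C_sub] at h1
  rw [varDiff_dvd_iff] at h1 ⊢
  rw [map_mul, identify, rename_C] at h1
  exact (mul_eq_zero.1 h1).resolve_left (by simpa [sub_eq_zero] using hij)

end DegreeBound

/-! ### The Vandermonde product and the lower bound for the degree -/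

section Vandermonde

variable {n : ℕ} {S : Type*} [CommRing S]

/-- The polynomial `∏_{i<j} (x_i - x_j)`. -/
def vand (n : ℕ) (S : Type*) [CommRing S] : MvPolynomial (Fin n) S :=
  ∏ p ∈ pairs n, varDiff p.1 p.2

lemma mem_pairs {p : Fin n × Fin n} : p ∈ pairs n ↔ p.1 < p.2 := by
  simp [pairs]

lemma sum_sum_eq_pairs {M : Type*} [AddCommMonoid M] (h : Fin n → Fin n → M)
    (hs : ∀ i j, h i j = h j i) (hd : ∀ i, h i i = 0) :
    ∑ i, ∑ j, h i j = ∑ p ∈ pairs n, h p.1 p.2 + ∑ p ∈ pairs n, h p.1 p.2 := by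
  rw [← Finset.sum_product' (s := Finset.univ) (t := Finset.univ) (f := h), Finset.univ_product_univ,
    ← Finset.sum_filter_add_sum_filter_not Finset.univ (fun p : Fin n × Fin n => p.1 < p.2)]
  congr 1
  rw [← Finset.sum_filter_add_sum_filter_not _ (fun p : Fin n × Fin n => p.2 < p.1)]
  have h0 : ∑ p ∈ ((Finset.univ.filter fun p : Fin n × Fin n => ¬ p.1 < p.2).filter
      fun p => ¬ p.2 < p.1), h p.1 p.2 = 0 := by
    refine Finset.sum_eq_zero fun p hp => ?_
    simp only [Finset.mem_filter, Finset.mem_univ, true_and, not_lt] at hp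
    rw [le_antisymm hp.2 hp.1, hd]
  rw [h0, add_zero]
  refine Finset.sum_bij' (fun p _ => p.swap) (fun p _ => p.swap) ?_ ?_ ?_ ?_ ?_
  · intro p hp
    simp only [Finset.mem_filter, Finset.mem_univ, true_and] at hp
    simpa [mem_pairs] using hp.2
  · intro p hp
    simp only [mem_pairs] at hp
    simpa using ⟨hp.le, hp⟩
  · simp
  · simp
  · intro p _
    exact hs _ _

lemma varDiff_dvd_swap {i j : Fin n} {f : MvPolynomial (Fin n) S} (h : varDiff i j ∣ f) :
    varDiff j i ∣ f := by
  have : (varDiff i j : MvPolynomial (Fin n) S) = -varDiff j i := by simp [varDiff]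
  rwa [this, neg_dvd] at h

/-- The forms `x_i - x_j` with `i < j` are pairwise coprime primes: the substitution that kills one
of them kills none of the others. -/
lemma prod_varDiff_dvd [IsDomain S] {f : MvPolynomial (Fin n) S} (s : Finset (Fin n × Fin n))
    (hs : s ⊆ pairs n) (h : ∀ p ∈ s, varDiff p.1 p.2 ∣ f) : ∏ p ∈ s, varDiff p.1 p.2 ∣ f := by
  classical
  induction s using Finset.induction_on with
  | empty => simp
  | insert p s hp ih =>
    obtain ⟨g, hg⟩ := ih (fun q hq => hs (Finset.mem_insert_of_mem hq))
      fun q hq => h q (Finset.mem_insert_of_mem hq)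
    have h1 := h p (Finset.mem_insert_self _ _)
    have hpp := mem_pairs.1 (hs (Finset.mem_insert_self p s))
    rw [Finset.prod_insert hp, hg, mul_comm]
    refine mul_dvd_mul_left _ ?_
    rw [hg, varDiff_dvd_iff, map_mul, map_prod] at h1
    rw [varDiff_dvd_iff]
    refine (mul_eq_zero.1 h1).resolve_left (Finset.prod_ne_zero_iff.2 fun q hq => ?_)
    have hqq := mem_pairs.1 (hs (Finset.mem_insert_of_mem hq))
    refine identify_varDiff_ne_zero hqq.ne ?_ ?_
    · rintro ⟨h2, h3⟩
      exact hp (by rwa [← Prod.ext h2 h3])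
    · rintro ⟨h2, h3⟩
      rw [h2, h3] at hqq
      exact absurd hqq hpp.not_gt

lemma vand_dvd [IsDomain S] {f : MvPolynomial (Fin n) S} (h : ∀ i j, i ≠ j → varDiff i j ∣ f) :
    vand n S ∣ f :=
  prod_varDiff_dvd _ (Finset.Subset.refl _) fun _ hp => h _ _ (mem_pairs.1 hp).ne

lemma vand_ne_zero [IsDomain S] : vand n S ≠ 0 :=
  Finset.prod_ne_zero_iff.2 fun _ hp => varDiff_ne_zero (mem_pairs.1 hp).ne

lemma isHomogeneous_vand : (vand n S).IsHomogeneous (pairs n).card := by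
  have := IsHomogeneous.prod (pairs n) (fun p => (varDiff p.1 p.2 : MvPolynomial (Fin n) S))
    (fun _ => 1) fun p _ => isHomogeneous_varDiff p.1 p.2
  simpa [vand] using this

lemma varDiff_dvd_vand {i j : Fin n} (h : i ≠ j) : varDiff i j ∣ vand n S := by
  have key : ∀ p ∈ pairs n, (varDiff p.1 p.2 : MvPolynomial (Fin n) S) ∣ vand n S := fun p hp => by
    rw [vand]
    exact Finset.dvd_prod_of_mem _ hp
  rcases lt_or_gt_of_ne h with h | h
  · exact key (i, j) (mem_pairs.2 h)
  · exact varDiff_dvd_swap (key (j, i) (mem_pairs.2 h))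

/-- A quasi-invariant of degree less than the number of pairs `i < j` vanishes. -/
lemma QI.eq_zero_of_degLT [IsDomain S] {ζ : Fin n → S} (hζ : Function.Injective ζ)
    {P : MvPolynomial (Fin n) S} (h : QI ζ P) {d : ℕ} (hd : d ≤ (pairs n).card)
    (hP : P ∈ degLT n S d) : P = 0 := by
  induction d with
  | zero => exact mem_degLT_zero.1 hP
  | succ d ih =>
    refine ih (by omega) ?_
    have h1 : vand n S ∣ homogeneousComponent d P :=
      vand_dvd fun i j hij => h.varDiff_dvd_top hP (hζ.ne hij)
    have h2 : homogeneousComponent d P = 0 := by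
      by_contra h0
      obtain ⟨g, hg⟩ := h1
      have hg0 : g ≠ 0 := by rintro rfl; exact h0 (by rw [hg, mul_zero])
      have h3 := (homogeneousComponent_isHomogeneous d P).totalDegree h0
      rw [hg, totalDegree_mul_of_isDomain vand_ne_zero hg0,
        isHomogeneous_vand.totalDegree vand_ne_zero] at h3
      omega
    have h3 := sub_homogeneousComponent_mem_degLT hP
    rwa [h2, sub_zero] at h3

/-- The cofactors `(x_i - x_j)⁻¹ ∏_{k<l} (x_k - x_l)`. -/
lemma exists_vand_cofactor (n : ℕ) (S : Type*) [CommRing S] :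
    ∃ W : Fin n → Fin n → MvPolynomial (Fin n) S,
      (∀ i j, i ≠ j → varDiff i j * W i j = vand n S) ∧ ∀ i, W i i = 0 := by
  choose! W hW using fun (i j : Fin n) (h : i ≠ j) => varDiff_dvd_vand (S := S) h
  refine ⟨fun i j => if i = j then 0 else W i j, fun i j h => ?_, by simp⟩
  simp [h, ← hW i j h]

lemma pderiv_prod {ι : Type*} [DecidableEq ι] (k : Fin n) (s : Finset ι)
    (f : ι → MvPolynomial (Fin n) S) :
    pderiv k (∏ i ∈ s, f i) = ∑ i ∈ s, pderiv k (f i) * ∏ j ∈ s.erase i, f j := by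
  induction s using Finset.induction_on with
  | empty => simp
  | insert p s hp ih =>
    rw [Finset.prod_insert hp, pderiv_mul, ih, Finset.sum_insert hp, Finset.erase_insert hp,
      Finset.mul_sum]
    congr 1
    refine Finset.sum_congr rfl fun q hq => ?_
    have hpq : p ≠ q := fun h => hp (h ▸ hq)
    rw [Finset.erase_insert_of_ne hpq, Finset.prod_insert fun h => hp (Finset.mem_of_mem_erase h)]
    ring

/-- The logarithmic derivative of the Vandermonde product. The factor 2 arises from passing to sums
over ordered pairs and is kept because `S` may have characteristic 2. -/
lemma two_mul_pderiv_vand [IsDomain S] {W : Fin n → Fin n → MvPolynomial (Fin n) S}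
    (hW : ∀ i j, i ≠ j → varDiff i j * W i j = vand n S) (hd : ∀ i, W i i = 0) (k : Fin n) :
    2 * pderiv k (vand n S) = 2 * ∑ j, W k j := by
  classical
  have hanti : ∀ i j, W i j = - W j i := by
    intro i j
    by_cases h : i = j
    · simp [h, hd]
    · refine mul_left_cancel₀ (varDiff_ne_zero (S := S) h) ?_
      have := hW j i (Ne.symm h)
      rw [hW i j h, ← this]
      simp only [varDiff]
      ring
  have h1 : pderiv k (vand n S) = ∑ p ∈ pairs n,
      ((if p.1 = k then 1 else 0) - (if p.2 = k then 1 else 0)) * W p.1 p.2 := by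
    rw [vand, pderiv_prod]
    refine Finset.sum_congr rfl fun p hp => ?_
    rw [← pderiv_varDiff]
    congr 1
    refine mul_left_cancel₀ (varDiff_ne_zero (S := S) (mem_pairs.1 hp).ne) ?_
    rw [hW _ _ (mem_pairs.1 hp).ne, vand]
    exact Finset.mul_prod_erase _ (fun p : Fin n × Fin n => (varDiff p.1 p.2 : MvPolynomial _ S)) hp
  have h2 := sum_sum_eq_pairs
    (fun i j => ((if i = k then 1 else 0) - (if j = k then 1 else 0)) * W i j)
    (fun i j => by rw [hanti i j]; ring) (fun i => by simp)
  rw [← h1, ← two_mul] at h2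
  rw [← h2]
  simp only [sub_mul, Finset.sum_sub_distrib, ite_mul, one_mul, zero_mul]
  rw [Finset.sum_comm]
  simp only [Finset.sum_ite_eq', Finset.mem_univ, if_true]
  rw [Finset.sum_congr rfl fun i _ => hanti i k, Finset.sum_neg_distrib]
  ring

end Vandermonde

end

section

/-! ### Polynomials in `x` and `z`, and the exchange of the variables -/

section Swap

variable {n : ℕ}

/-- Polynomials in `x` with coefficients polynomials in `z`. -/
abbrev BiPoly (n : ℕ) : Type := MvPolynomial (Fin n) (MvPolynomial (Fin n) ℂ)

/-- The exchange of the variables `x` and `z`. -/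
def swapVars (n : ℕ) : BiPoly n →+* BiPoly n := eval₂Hom (map C) fun i => C (X i)

lemma swapVars_C (s : MvPolynomial (Fin n) ℂ) : swapVars n (C s) = map C s := by
  simp [swapVars]

lemma swapVars_X (i : Fin n) : swapVars n (X i) = C (X i) := by
  simp [swapVars]

lemma swapVars_C_X (i : Fin n) : swapVars n (C (X i)) = X i := by
  simp [swapVars]

lemma swapVars_swapVars (P : BiPoly n) : swapVars n (swapVars n P) = P := by
  have : (swapVars n).comp (swapVars n) = RingHom.id _ := by
    refine ringHom_ext' (ringHom_ext' ?_ fun i => ?_) fun i => ?_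
    · ext c
      simp [swapVars]
    · simp [swapVars]
    · simp [swapVars]
  exact congrArg (fun f => f P) this

lemma swapVars_monomial (m b : Fin n →₀ ℕ) (c : ℂ) :
    swapVars n (monomial m (monomial b c)) = monomial b (monomial m c) := by
  have h1 : swapVars n (monomial m (1 : MvPolynomial (Fin n) ℂ)) = C (monomial m 1) := by
    rw [monomial_eq, monomial_eq, C_1, one_mul, C_1, one_mul, Finsupp.prod, Finsupp.prod]
    simp only [map_prod, map_pow, swapVars_X]
  have h2 : (monomial m (monomial b c) : BiPoly n) = C (monomial b c) * monomial m 1 := by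
    rw [C_mul_monomial, mul_one]
  rw [h2, map_mul, h1, swapVars_C, map_monomial, mul_comm, C_mul_monomial, mul_comm, C_mul_monomial,
    mul_one]

lemma biPoly_induction {p : BiPoly n → Prop} (hadd : ∀ P Q, p P → p Q → p (P + Q))
    (hmon : ∀ m b c, p (monomial m (monomial b c))) (P : BiPoly n) : p P := by
  induction P using MvPolynomial.induction_on' with
  | add P Q hP hQ => exact hadd P Q hP hQ
  | monomial m s =>
    induction s using MvPolynomial.induction_on' with
    | add s t hs ht => rw [map_add]; exact hadd _ _ hs ht
    | monomial b c => exact hmon m b c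

lemma coeff_coeff_swapVars (m b : Fin n →₀ ℕ) (P : BiPoly n) :
    coeff b (coeff m (swapVars n P)) = coeff m (coeff b P) := by
  classical
  induction P using biPoly_induction with
  | hadd P Q hP hQ => simp [hP, hQ]
  | hmon m' b' c =>
    rw [swapVars_monomial]
    simp only [coeff_monomial]
    split_ifs <;> simp_all

lemma mem_degLT_iff_coeff {d : ℕ} {P : BiPoly n} : P ∈ degLT n _ d ↔
    ∀ m b : Fin n →₀ ℕ, d ≤ m.degree → coeff b (coeff m P) = 0 := by
  rw [mem_degLT]
  refine ⟨fun h m b hm => by rw [h m hm, coeff_zero], fun h m hm => ?_⟩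
  ext b
  rw [h m b hm, coeff_zero]

/-- Membership of `swapVars n P` in `degLT n _ d` bounds the degree of `P` in `z`, which a
derivative in `x` cannot raise. -/
lemma swapVars_pderiv_mem_degLT {d : ℕ} {P : BiPoly n} (h : swapVars n P ∈ degLT n _ d)
    (i : Fin n) : swapVars n (pderiv i P) ∈ degLT n _ d := by
  rw [mem_degLT_iff_coeff] at h ⊢
  intro m b hm
  have h1 := h m (b + Finsupp.single i 1) hm
  rw [coeff_coeff_swapVars] at h1 ⊢
  have h2 : ((b i : MvPolynomial (Fin n) ℂ) + 1) = C ((b i : ℂ) + 1) := by simp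
  rw [coeff_pderiv, h2, mul_comm, coeff_C_mul, h1, mul_zero]

lemma swapVars_nab_mem_degLT {d : ℕ} {P : BiPoly n} (h : swapVars n P ∈ degLT n _ d)
    (i : Fin n) : swapVars n (nab X i P) ∈ degLT n _ (d + 1) := by
  rw [nab_apply, map_add, map_mul, swapVars_C_X, add_comm d 1]
  exact add_mem (degLT_mono (Nat.le_add_left _ _) (swapVars_pderiv_mem_degLT h i))
    (mul_mem_degLT (isHomogeneous_X _ i).mem_degLT h)

lemma swapVars_varDiff (i j : Fin n) : swapVars n (varDiff i j) = C (varDiff i j) := by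
  simp [varDiff, swapVars_X]

end Swap

/-! ### Construction of a quasi-invariant of lowest degree -/

section Leading

variable {n : ℕ}

/-- After the exchange `x_i - x_j` is a scalar from a domain, so division by it leaves the
`z`-degree unchanged. -/
lemma swapVars_mem_degLT_of_mul {d : ℕ} {i j : Fin n} (hij : i ≠ j) {Q : BiPoly n}
    (h : swapVars n (varDiff i j * Q) ∈ degLT n _ d) : swapVars n Q ∈ degLT n _ d := by
  intro m hm
  have h1 := h m hm
  rw [map_mul, swapVars_varDiff, coeff_C_mul] at h1
  exact (mul_eq_zero.1 h1).resolve_left (varDiff_ne_zero hij)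

/-- The only part of `cmOp` that does not lower the degree in `x` is multiplication by `∑ ζ_i²`; it
cancels here. -/
lemma cmOp_sub_eq (ζ : Fin n → MvPolynomial (Fin n) ℂ) (P : BiPoly n)
    (Q : Fin n → Fin n → BiPoly n) : cmOp ζ P Q - C (∑ i, ζ i ^ 2) * P =
      ∑ i, (pderiv i (pderiv i P) + C (2 * ζ i) * pderiv i P) - ∑ i, ∑ j, Q i j := by
  have : ∑ i, nab ζ i (nab ζ i P) = ∑ i, (pderiv i (pderiv i P) + C (2 * ζ i) * pderiv i P) +
      C (∑ i, ζ i ^ 2) * P := by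
    rw [map_sum, Finset.sum_mul, ← Finset.sum_add_distrib]
    refine Finset.sum_congr rfl fun i _ => ?_
    simp only [nab_apply, map_add, pderiv_C_mul, C_mul, C_pow]
    have : (C (2 : MvPolynomial (Fin n) ℂ) : BiPoly n) = 2 := map_ofNat _ 2
    rw [this]
    ring
  rw [cmOp, this]
  ring

/-- Multiplication of a quasi-invariant by a constant. -/
lemma QI.C_mul {S : Type*} [CommRing S] {ζ : Fin n → S} {P : MvPolynomial (Fin n) S} (h : QI ζ P)
    (c : S) : QI ζ (C c * P) := by
  intro i j
  rw [C_mul', map_smul, map_smul, ← smul_sub, ← C_mul']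
  exact Dvd.dvd.mul_left (h i j) _

lemma QI.sub {S : Type*} [CommRing S] {ζ : Fin n → S} {P P' : MvPolynomial (Fin n) S}
    (h : QI ζ P) (h' : QI ζ P') : QI ζ (P - P') := by
  intro i j
  have : nab ζ i (P - P') - nab ζ j (P - P') =
      (nab ζ i P - nab ζ j P) - (nab ζ i P' - nab ζ j P') := by simp only [map_sub]; ring
  rw [this]
  exact dvd_sub (h i j) (h' i j)

lemma QI.sum {S ι : Type*} [CommRing S] {ζ : Fin n → S} (s : Finset ι)
    {P : ι → MvPolynomial (Fin n) S} (h : ∀ k ∈ s, QI ζ (P k)) : QI ζ (∑ k ∈ s, P k) := by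
  intro i j
  rw [map_sum, map_sum, ← Finset.sum_sub_distrib]
  exact Finset.dvd_sum fun k hk => h k hk i j

/-- The state after `k` applications of the Calogero-Moser operator to `∏_{i<j} (x_i - x_j)²`:
a quasi-invariant whose leading part in `x` is `g ∏_{i<j} (x_i - x_j)`. -/
structure LeadState (n k : ℕ) (P g : BiPoly n) (c : ℂ) : Prop where
  qi : QI X P
  hom : g.IsHomogeneous ((pairs n).card - k)
  rem_mem : P - vand n _ * g ∈ degLT n _ (2 * (pairs n).card - k)
  swap_mem : swapVars n P ∈ degLT n _ (k + 1)
  eval_eq : eval X g = C c * vand n ℂ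
  ne_zero : c ≠ 0

lemma eval_X_vand (n : ℕ) : eval X (vand n (MvPolynomial (Fin n) ℂ)) = vand n ℂ := by
  simp [vand, varDiff]

lemma swapVars_vand (n : ℕ) : swapVars n (vand n _) = C (vand n ℂ) := by
  simp only [vand, map_prod, swapVars_varDiff]

/-- The squared Vandermonde product contains each `x_i - x_j` twice, and a first-order operator
removes at most one of the factors. -/
lemma leadState_zero (n : ℕ) : LeadState n 0 (vand n _ * vand n _) (vand n _) 1 where
  qi := by
    intro i j
    by_cases hij : i = j
    · simp [hij]
    · rw [nab_sub_mul]
      exact dvd_add (Dvd.dvd.mul_left (varDiff_dvd_vand hij) _)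
        (Dvd.dvd.mul_right (varDiff_dvd_vand hij) _)
  hom := isHomogeneous_vand
  rem_mem := by simp
  swap_mem := by
    rw [map_mul, swapVars_vand, ← C_mul]
    exact (isHomogeneous_C _ _).mem_degLT
  eval_eq := by rw [eval_X_vand, C_1, one_mul]
  ne_zero := one_ne_zero

/-- To leading order `cmOp - ∑ z_i²` acts on `V g` as `2 ∑ z_i ∂_i` on `g` alone: the terms in which
the derivative hits the Vandermonde product cancel against the leading part of the quotients. By
Euler's identity this multiplies `g` at `x = z` by twice its degree, so the constant stays non-zero.
One step costs one degree in `x` and at most one more in `z`. -/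
lemma LeadState.succ {k : ℕ} (hk : k < (pairs n).card) {P g : BiPoly n} {c : ℂ}
    (h : LeadState n k P g c) : ∃ P' g' c', LeadState n (k + 1) P' g' c' := by
  obtain ⟨Q, hQ⟩ := h.qi.exists_isQuot
  obtain ⟨W, hW, hWd⟩ := exists_vand_cofactor n (MvPolynomial (Fin n) ℂ)
  -- The degree of `g` in `x` is `m + 1`, positive because `k` is below the number of pairs.
  obtain ⟨m, hm⟩ : ∃ m, (pairs n).card = k + (m + 1) := ⟨(pairs n).card - k - 1, by omega⟩
  have hgh : g.IsHomogeneous (m + 1) := by have := h.hom; rwa [hm, Nat.add_sub_cancel_left] at this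
  have hV : (vand n (MvPolynomial (Fin n) ℂ)).IsHomogeneous (k + (m + 1)) := hm ▸ isHomogeneous_vand
  have hr : P - vand n _ * g ∈ degLT n _ (k + 2 * m + 2) := by
    have := h.rem_mem
    rwa [hm, show 2 * (k + (m + 1)) - k = k + 2 * m + 2 by omega] at this
  have hP : P ∈ degLT n _ (k + 2 * m + 3) := by
    have := add_mem (degLT_mono (Nat.le_succ _) hr)
      (degLT_mono (by omega) (hV.mul hgh).mem_degLT : vand n _ * g ∈ degLT n _ (k + 2 * m + 3))
    rwa [sub_add_cancel] at this
  have hWanti : ∀ i j, W i j = - W j i := by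
    intro i j
    by_cases hij : i = j
    · simp [hij, hWd]
    · refine mul_left_cancel₀ (varDiff_ne_zero (S := MvPolynomial (Fin n) ℂ) hij) ?_
      have := hW j i (Ne.symm hij)
      rw [hW i j hij, ← this]
      simp only [varDiff]
      ring
  refine ⟨cmOp X P Q - C (∑ i, X i ^ 2) * P, ∑ i, C (2 * X i) * pderiv i g,
    2 * (m + 1) * c, hQ.qi_cmOp.sub (h.qi.C_mul _), ?_, ?_, ?_, ?_, ?_⟩
  · rw [hm, show k + (m + 1) - (k + 1) = m by omega]
    exact IsHomogeneous.sum _ _ _ fun i _ => (hgh.pderiv (i := i)).C_mul _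
  · rw [hm, show 2 * (k + (m + 1)) - (k + 1) = k + 2 * m + 1 by omega, cmOp_sub_eq]
    -- The leading part of `Q_ij` is `(z_i - z_j) g V / (x_i - x_j)`.
    have hQr : ∀ i j, Q i j - C (X i - X j) * (W i j * g) ∈ degLT n _ (k + 2 * m + 1) := by
      intro i j
      by_cases hij : i = j
      · simp [hij, hQ.diag, hWd]
      refine mem_degLT_of_mul (isHomogeneous_varDiff i j) (varDiff_ne_zero hij) ?_
      have e : varDiff i j * (Q i j - C (X i - X j) * (W i j * g)) =
          pderiv i P - pderiv j P + C (X i - X j) * (P - vand n _ * g) := by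
        rw [mul_sub, hQ.mul_eq, ← hW i j hij]
        simp only [nab_apply, C_sub]
        ring
      rw [e, show 1 + (k + 2 * m + 1) = k + 2 * m + 2 by omega]
      exact add_mem (sub_mem (pderiv_mem_degLT hP i) (pderiv_mem_degLT hP j))
        (C_mul_mem_degLT _ hr)
    -- The cancellation: `2 ∑ z_i ∂_i V` equals the sum of `(z_i - z_j) V / (x_i - x_j)` over
    -- ordered pairs.
    have hvd : ∑ i, C (2 * X i) * pderiv i (vand n (MvPolynomial (Fin n) ℂ)) =
        ∑ i, ∑ j, C (X i - X j) * W i j := by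
      have h1 : ∑ i, ∑ j, C (X i - X j : MvPolynomial (Fin n) ℂ) * W i j =
          ∑ i, ∑ j, C (X i) * W i j + ∑ i, ∑ j, C (X i) * W i j := by
        simp only [C_sub, sub_mul, Finset.sum_sub_distrib]
        rw [sub_eq_add_neg]
        congr 1
        rw [Finset.sum_comm, ← Finset.sum_neg_distrib]
        refine Finset.sum_congr rfl fun i _ => ?_
        rw [← Finset.sum_neg_distrib]
        refine Finset.sum_congr rfl fun j _ => ?_
        rw [hWanti j i]
        ring
      rw [h1, ← two_mul, Finset.mul_sum]
      refine Finset.sum_congr rfl fun i _ => ?_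
      have h2 := two_mul_pderiv_vand hW hWd i
      have h3 : (C (2 : MvPolynomial (Fin n) ℂ) : BiPoly n) = 2 := map_ofNat _ 2
      rw [C_mul, h3, ← Finset.mul_sum]
      linear_combination C (X i) * h2
    have key : ∑ i, (pderiv i (pderiv i P) + C (2 * X i) * pderiv i P) - ∑ i, ∑ j, Q i j -
        vand n _ * ∑ i, C (2 * X i) * pderiv i g =
        ∑ i, pderiv i (pderiv i P) + ∑ i, C (2 * X i) * pderiv i (P - vand n _ * g) -
        ∑ i, ∑ j, (Q i j - C (X i - X j) * (W i j * g)) := by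
      have e1 : ∑ i, C (2 * X i) * pderiv i (P - vand n _ * g) = ∑ i, C (2 * X i) * pderiv i P -
          (∑ i, C (2 * X i) * pderiv i (vand n (MvPolynomial (Fin n) ℂ))) * g -
          vand n _ * ∑ i, C (2 * X i) * pderiv i g := by
        rw [Finset.sum_mul, Finset.mul_sum, ← Finset.sum_sub_distrib, ← Finset.sum_sub_distrib]
        refine Finset.sum_congr rfl fun i _ => ?_
        rw [map_sub, pderiv_mul]
        ring
      have e2 : ∑ i, ∑ j, (Q i j - C (X i - X j) * (W i j * g)) = ∑ i, ∑ j, Q i j -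
          (∑ i, ∑ j, C (X i - X j) * W i j) * g := by
        simp only [Finset.sum_sub_distrib, Finset.sum_mul, mul_assoc]
      rw [e1, e2, hvd, Finset.sum_add_distrib]
      ring
    rw [key]
    refine sub_mem (add_mem (sum_mem fun i _ => ?_) (sum_mem fun i _ => ?_))
      (sum_mem fun i _ => sum_mem fun j _ => hQr i j)
    · exact pderiv_mem_degLT (pderiv_mem_degLT hP i) i
    · exact C_mul_mem_degLT _ (pderiv_mem_degLT hr i)
  · rw [cmOp_sub_eq, map_sub, map_sum, map_sum]
    have hd := fun i => swapVars_pderiv_mem_degLT h.swap_mem i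
    refine sub_mem (sum_mem fun i _ => ?_) (sum_mem fun i _ => ?_)
    · rw [map_add, map_mul, swapVars_C]
      refine add_mem (degLT_mono (Nat.le_succ _) (swapVars_pderiv_mem_degLT (hd i) i)) ?_
      rw [map_mul, map_X, map_ofNat, show k + 1 + 1 = 1 + (k + 1) by omega]
      refine mul_mem_degLT ?_ (hd i)
      have h3 : (C (2 : MvPolynomial (Fin n) ℂ) : BiPoly n) = 2 := map_ofNat _ 2
      rw [← h3]
      exact ((isHomogeneous_X _ i).C_mul _).mem_degLT
    · rw [map_sum]
      refine sum_mem fun j _ => ?_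
      by_cases hij : i = j
      · simp [hij, hQ.diag]
      refine swapVars_mem_degLT_of_mul hij ?_
      rw [hQ.mul_eq, map_sub]
      exact sub_mem (swapVars_nab_mem_degLT h.swap_mem i) (swapVars_nab_mem_degLT h.swap_mem j)
  -- Euler's identity for `g`, homogeneous of degree `m + 1`, evaluated at `x = z`.
  · have h1 := congrArg (eval (X : Fin n → MvPolynomial (Fin n) ℂ)) hgh.sum_X_mul_pderiv
    simp only [map_sum, map_mul, eval_X, eval_C, map_nsmul, h.eval_eq] at h1 ⊢
    simp only [mul_assoc, ← Finset.mul_sum] at h1 ⊢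
    rw [h1, nsmul_eq_mul]
    simp only [map_add, map_natCast, map_ofNat, map_one, Nat.cast_add, Nat.cast_one]
  · have : ((m : ℂ) + 1) ≠ 0 := by exact_mod_cast Nat.succ_ne_zero m
    exact mul_ne_zero (mul_ne_zero two_ne_zero this) h.ne_zero

/-- There is a quasi-invariant of degree the number `N` of pairs in `x` and in `z`, with leading
part a non-zero multiple of `∏ (x_i - x_j) (z_i - z_j)`. -/
lemma exists_leadState (n : ℕ) : ∃ P g c, LeadState n (pairs n).card P g c := by
  have : ∀ k ≤ (pairs n).card, ∃ P g c, LeadState n k P g c := by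
    intro k
    induction k with
    | zero => exact fun _ => ⟨_, _, _, leadState_zero n⟩
    | succ k ih =>
      intro hk
      obtain ⟨P, g, c, h⟩ := ih (by omega)
      exact h.succ (by omega)
  exact this _ le_rfl

end Leading

end

section

variable {n : ℕ}

/-! ### Simultaneous permutations of `x` and `z` -/

section Perm

/-- The simultaneous permutation of the variables `x` and `z`. -/
def permVars (s : Equiv.Perm (Fin n)) : BiPoly n →+* BiPoly n :=
  (rename s : BiPoly n →ₐ[MvPolynomial (Fin n) ℂ] BiPoly n).toRingHom.comp
    (map (rename s : MvPolynomial (Fin n) ℂ →ₐ[ℂ] MvPolynomial (Fin n) ℂ).toRingHom)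

lemma permVars_apply (s : Equiv.Perm (Fin n)) (P : BiPoly n) : permVars s P =
    rename s (map (rename s : MvPolynomial (Fin n) ℂ →ₐ[ℂ] MvPolynomial (Fin n) ℂ).toRingHom P) :=
  rfl

lemma permVars_X (s : Equiv.Perm (Fin n)) (i : Fin n) : permVars s (X i) = X (s i) := by
  simp [permVars_apply]

lemma permVars_C_X (s : Equiv.Perm (Fin n)) (i : Fin n) : permVars s (C (X i)) = C (X (s i)) := by
  simp [permVars_apply]

lemma permVars_C_C (s : Equiv.Perm (Fin n)) (c : ℂ) : permVars s (C (C c)) = C (C c) := by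
  simp [permVars_apply]

lemma biPoly_hom_ext {A : Type*} [Semiring A] {f g : BiPoly n →+* A}
    (hc : ∀ c, f (C (C c)) = g (C (C c))) (hz : ∀ i, f (C (X i)) = g (C (X i)))
    (hx : ∀ i, f (X i) = g (X i)) (P : BiPoly n) : f P = g P := by
  have : f = g := ringHom_ext' (ringHom_ext' (RingHom.ext hc) hz) hx
  rw [this]

lemma swapVars_C_C (c : ℂ) : swapVars n (C (C c)) = C (C c) := by
  simp [swapVars_C]

lemma swapVars_permVars (s : Equiv.Perm (Fin n)) (P : BiPoly n) :
    swapVars n (permVars s P) = permVars s (swapVars n P) := by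
  refine biPoly_hom_ext (f := (swapVars n).comp (permVars s))
    (g := (permVars s).comp (swapVars n)) (fun c => ?_) (fun i => ?_) (fun i => ?_) P
  · simp [permVars_C_C, swapVars_C_C]
  · simp [permVars_C_X, swapVars_C_X, permVars_X]
  · simp [permVars_C_X, swapVars_X, permVars_X]

lemma nab_permVars (s : Equiv.Perm (Fin n)) (i : Fin n) (P : BiPoly n) :
    nab X (s i) (permVars s P) = permVars s (nab X i P) := by
  rw [nab_apply, nab_apply, map_add, map_mul, permVars_C_X, permVars_apply, permVars_apply,
    pderiv_rename s.injective, pderiv_map]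

lemma permVars_varDiff (s : Equiv.Perm (Fin n)) (i j : Fin n) :
    permVars s (varDiff i j) = varDiff (s i) (s j) := by
  simp [varDiff, permVars_X]

lemma QI.permVars {P : BiPoly n} (h : QI X P) (s : Equiv.Perm (Fin n)) : QI X (permVars s P) := by
  intro i j
  have h1 := map_dvd (AiryCM.permVars s) (h (s.symm i) (s.symm j))
  rw [permVars_varDiff, map_sub, ← nab_permVars, ← nab_permVars] at h1
  simpa using h1

lemma map_mem_degLT {S T : Type*} [CommRing S] [CommRing T] (f : S →+* T) {d : ℕ}
    {P : MvPolynomial (Fin n) S} (h : P ∈ degLT n S d) : map f P ∈ degLT n T d := by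
  intro m hm
  rw [coeff_map, h m hm, map_zero]

lemma rename_mem_degLT {S : Type*} [CommRing S] (f : Fin n → Fin n) {d : ℕ}
    {P : MvPolynomial (Fin n) S} (h : P ∈ degLT n S d) : rename f P ∈ degLT n S d := by
  rw [mem_degLT_iff] at h ⊢
  rcases h with rfl | h
  · simp
  · exact Or.inr ((totalDegree_rename_le f P).trans_lt h)

lemma permVars_mem_degLT (s : Equiv.Perm (Fin n)) {d : ℕ} {P : BiPoly n} (h : P ∈ degLT n _ d) :
    permVars s P ∈ degLT n _ d :=
  rename_mem_degLT s (map_mem_degLT _ h)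

end Perm

/-! ### Bispectral duality -/

section Duality

/-- The operator `∂/∂z_a + x_a`. -/
def dualNab (a : Fin n) (P : BiPoly n) : BiPoly n := swapVars n (nab X a (swapVars n P))

lemma dualNab_add (a : Fin n) (P Q : BiPoly n) : dualNab a (P + Q) = dualNab a P + dualNab a Q := by
  simp [dualNab]

lemma dualNab_map_mul (a : Fin n) (s : MvPolynomial (Fin n) ℂ) (Q : BiPoly n) :
    dualNab a (map C s * Q) = map C s * dualNab a Q := by
  rw [dualNab, map_mul, ← swapVars_C, swapVars_swapVars, C_mul', map_smul, ← C_mul', map_mul]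
  rfl

lemma dualNab_mul_X (a j : Fin n) (Q : BiPoly n) : dualNab a (Q * X j) = dualNab a Q * X j := by
  have := dualNab_map_mul a (X j) Q
  rwa [map_X, mul_comm, mul_comm (X j)] at this

lemma dualNab_varDiff_mul (a i j : Fin n) (Q : BiPoly n) :
    dualNab a (varDiff i j * Q) = varDiff i j * dualNab a Q := by
  have := dualNab_map_mul a (varDiff i j) Q
  simpa [varDiff] using this

lemma dualNab_C (a : Fin n) (s : MvPolynomial (Fin n) ℂ) :
    dualNab a (C s) = C (pderiv a s) + X a * C s := by
  rw [dualNab, swapVars_C, nab_apply, pderiv_map, map_add, map_mul, ← swapVars_C, ← swapVars_C,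
    swapVars_swapVars, swapVars_swapVars, swapVars_C_X]

/-- Both operators are conjugates by `exp(∑ x_i z_i)` of partial derivatives, one in `x` and one in
`z`, and so commute. -/
lemma nab_dualNab (k a : Fin n) (P : BiPoly n) :
    nab X k (dualNab a P) = dualNab a (nab X k P) := by
  classical
  induction P using MvPolynomial.induction_on with
  | C s =>
    have h1 : nab X k (C s : BiPoly n) = C (X k * s) := by simp [nab_apply]
    rw [h1, dualNab_C, dualNab_C, map_add, nab_apply, nab_apply, pderiv_C, pderiv_mul, pderiv_C,
      pderiv_X, pderiv_mul, pderiv_X]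
    simp only [Pi.single_apply]
    by_cases h : k = a
    · subst h; simp; ring
    · simp [h, Ne.symm h]; ring
  | add P Q hP hQ => simp only [dualNab_add, map_add, hP, hQ]
  | mul_X P j hP =>
    rw [dualNab_mul_X, mul_comm, nab_mul, mul_comm P, nab_mul, dualNab_add, hP, pderiv_X]
    by_cases h : k = j
    · subst h
      simp only [Pi.single_eq_same, one_mul]
      rw [mul_comm (X k) (nab X k P), dualNab_mul_X, mul_comm]
    · simp only [Pi.single_apply, Ne.symm h, if_false, zero_mul]
      rw [mul_comm (X j) (nab X k P), dualNab_mul_X, mul_comm]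
      simp [dualNab]

lemma identify_rename_swap {S : Type*} [CommRing S] (a b : Fin n) (F : MvPolynomial (Fin n) S) :
    identify a b (rename (Equiv.swap a b) F) = identify a b F := by
  rw [identify, rename_rename]
  congr 2
  funext k
  simp only [Function.comp, Function.update_apply, Equiv.swap_apply_def, id]
  grind

lemma rename_swap_varDiff {S : Type*} [CommRing S] (a b : Fin n) :
    rename (Equiv.swap a b) (varDiff a b : MvPolynomial (Fin n) S) = -varDiff a b := by
  simp [varDiff]

lemma varDiff_dvd_of_antisymm {a b : Fin n} {F : BiPoly n}
    (h : rename (Equiv.swap a b) F = -F) : varDiff a b ∣ F := by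
  rw [varDiff_dvd_iff]
  have h1 := identify_rename_swap a b F
  rw [h, map_neg] at h1
  have h2 : (2 : BiPoly n) * identify a b F = 0 := by linear_combination -h1
  exact (mul_eq_zero.1 h2).resolve_left two_ne_zero

/-- An antisymmetric polynomial whose normal derivative vanishes on the wall is divisible by
`(x_a - x_b)³`. -/
lemma varDiff_pow_three_dvd {a b : Fin n} (hab : a ≠ b) {F : BiPoly n}
    (h : rename (Equiv.swap a b) F = -F) (hd : varDiff a b ∣ pderiv a F - pderiv b F) :
    varDiff a b ^ 3 ∣ F := by
  have hv : (varDiff a b : BiPoly n) ≠ 0 := varDiff_ne_zero hab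
  -- In `F = (x_a - x_b) H` the factor `H` is symmetric. The normal derivative of `F` on the wall is
  -- `2H`, so `H` vanishes there too, and the quotient of `H` is antisymmetric, which gives the
  -- third factor.
  obtain ⟨H, rfl⟩ := varDiff_dvd_of_antisymm h
  rw [map_mul, rename_swap_varDiff] at h
  have hH : rename (Equiv.swap a b) H = H := mul_left_cancel₀ hv (by linear_combination -h)
  have e : pderiv a (varDiff a b * H) - pderiv b (varDiff a b * H) =
      2 * H + varDiff a b * (pderiv a H - pderiv b H) := by
    rw [pderiv_mul, pderiv_mul, pderiv_varDiff, pderiv_varDiff]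
    simp only [hab, Ne.symm hab, if_true, if_false]
    ring
  rw [e, dvd_add_left (Dvd.intro _ rfl), varDiff_dvd_iff, map_mul] at hd
  have h2 : identify a b (2 : BiPoly n) ≠ 0 := by
    rw [map_ofNat]; exact two_ne_zero
  obtain ⟨K, rfl⟩ := (varDiff_dvd_iff a b H).2 ((mul_eq_zero.1 hd).resolve_left h2)
  rw [map_mul, rename_swap_varDiff] at hH
  have hK : rename (Equiv.swap a b) K = -K := by
    refine mul_left_cancel₀ hv ?_
    linear_combination -hH
  obtain ⟨L, rfl⟩ := varDiff_dvd_of_antisymm hK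
  exact ⟨L, by ring⟩

attribute [local instance] MvPolynomial.gradedAlgebra in
lemma varDiff_pow_dvd_homogeneousComponent {S : Type*} [CommRing S] {a b : Fin n} (k : ℕ)
    {F : MvPolynomial (Fin n) S} (h : varDiff a b ^ k ∣ F) (d : ℕ) :
    varDiff a b ^ k ∣ homogeneousComponent d F := by
  rw [← Ideal.mem_span_singleton] at h ⊢
  refine homogeneousComponent_mem_of_mem (Ideal.homogeneous_span _ _ ?_) h d
  rintro x rfl
  exact ⟨_, (isHomogeneous_varDiff a b).pow k⟩

/-- Bispectral duality: a quasi-invariant of the lowest possible degree which is invariant under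
simultaneous permutations of `x` and `z` is also a quasi-invariant in `z`. -/
lemma QI.swapVars {P : BiPoly n} (h : QI X P) (hd : P ∈ degLT n _ ((pairs n).card + 1))
    (hs : ∀ s, AiryCM.permVars s P = P) : QI X (swapVars n P) := by
  intro a b
  by_cases hab : a = b
  · simp [hab]
  set ρ : MvPolynomial (Fin n) ℂ →+* MvPolynomial (Fin n) ℂ :=
    (identify a b : MvPolynomial (Fin n) ℂ →ₐ[ℂ] MvPolynomial (Fin n) ℂ).toRingHom with hρ
  have hρX : ∀ k, ρ (X k) = X (Function.update id a b k) := fun k => by simp [hρ, identify]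
  -- `G` is the derivative normal to the wall `z_a = z_b`, and `ρ` restricts to this wall, where `G`
  -- has to vanish.
  set G : BiPoly n := dualNab a P - dualNab b P with hG
  have hmap : map ρ G = AiryCM.swapVars n
      (identify a b (nab X a (AiryCM.swapVars n P) - nab X b (AiryCM.swapVars n P))) := by
    rw [hG, dualNab, dualNab, ← map_sub]
    refine biPoly_hom_ext (f := (map ρ).comp (AiryCM.swapVars n))
      (g := (AiryCM.swapVars n).comp (identify a b : BiPoly n →ₐ[_] BiPoly n).toRingHom)
      (fun c => ?_) (fun i => ?_) (fun i => ?_) _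
    · simp [swapVars_C_C, identify, hρ]
    · simp [swapVars_C_X, identify]
    · simp [swapVars_X, identify, hρX]
  suffices hzero : map ρ G = 0 by
    rw [hzero] at hmap
    have h1 := congrArg (AiryCM.swapVars n) hmap
    rw [swapVars_swapVars, map_zero] at h1
    exact (varDiff_dvd_iff a b _).2 h1.symm
  -- Operators in `z` commute with those in `x`, so `G` is a quasi-invariant in `x`; this survives
  -- setting `z_a = z_b`.
  have hqi : QI (fun k => ρ (X k)) (map ρ G) := by
    have hn : ∀ k, nab (fun k => ρ (X k)) k (map ρ G) = map ρ (nab X k G) := fun k => by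
      simp [nab_apply, pderiv_map]
    intro k l
    obtain ⟨Q, hQ⟩ := h k l
    have e : nab X k G - nab X l G = varDiff k l * (dualNab a Q - dualNab b Q) := by
      have h1 : ∀ c, nab X k (dualNab c P) - nab X l (dualNab c P) = varDiff k l * dualNab c Q := by
        intro c
        rw [nab_dualNab, nab_dualNab, ← dualNab_varDiff_mul, ← hQ]
        simp [dualNab]
      rw [hG, map_sub, map_sub, mul_sub, ← h1 a, ← h1 b]
      ring
    rw [hn, hn, ← map_sub, e, map_mul]
    exact ⟨map ρ (dualNab a Q - dualNab b Q), by simp [varDiff]⟩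
  have hdeg : map ρ G ∈ degLT n _ ((pairs n).card + 2) := by
    have h1 : ∀ c, dualNab c P ∈ degLT n _ ((pairs n).card + 2) := fun c =>
      swapVars_nab_mem_degLT (by rwa [swapVars_swapVars]) c
    exact map_mem_degLT ρ (Submodule.sub_mem _ (h1 a) (h1 b))
  -- The transposition of `a` and `b` in both sets of variables fixes `P` and negates `G`; on `z_a =
  -- z_b` its action on `z` is invisible.
  have hanti : rename (Equiv.swap a b) (map ρ G) = -map ρ G := by
    have hnab : ∀ c, AiryCM.permVars (Equiv.swap a b) (dualNab c P) =
        dualNab (Equiv.swap a b c) P := fun c => by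
      rw [dualNab, ← swapVars_permVars, ← nab_permVars, ← swapVars_permVars, hs, dualNab]
    have h1 : AiryCM.permVars (Equiv.swap a b) G = -G := by
      rw [hG, map_sub, hnab, hnab, Equiv.swap_apply_left, Equiv.swap_apply_right, neg_sub]
    have h2 := congrArg (map ρ) h1
    rw [map_neg, permVars_apply, map_rename, map_map] at h2
    have h3 : ρ.comp (rename (Equiv.swap a b) :
        MvPolynomial (Fin n) ℂ →ₐ[ℂ] MvPolynomial (Fin n) ℂ).toRingHom = ρ :=
      RingHom.ext fun F => identify_rename_swap a b F
    rwa [h3] at h2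
  -- As the spectral parameters of `a` and `b` now agree, the quasi-invariance condition on `x_a =
  -- x_b` concerns the bare normal derivative.
  have hcube : varDiff a b ^ 3 ∣ map ρ G := by
    refine varDiff_pow_three_dvd hab hanti ?_
    have h1 := hqi a b
    simp only [nab_apply, hρX, Function.update_self, Function.update_of_ne (Ne.symm hab), id] at h1
    simpa using h1
  -- The top part contains `(x_a - x_b)³` and all other `x_i - x_j`, whose parameters remain
  -- distinct. It is thus divisible by a product of degree `N + 2`, whereas the degree is at most `N
  -- + 1`.
  have main : ∀ d ≤ (pairs n).card + 2, map ρ G ∈ degLT n _ d → map ρ G = 0 := by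
    intro d
    induction d with
    | zero => exact fun _ => mem_degLT_zero.1
    | succ d ih =>
      intro hdN hd1
      refine ih (by omega) ?_
      obtain ⟨K, hK⟩ := varDiff_pow_dvd_homogeneousComponent 3 hcube d
      have h1 : vand n (MvPolynomial (Fin n) ℂ) ∣ varDiff a b * K := by
        refine vand_dvd fun i j hij => ?_
        by_cases hc1 : a = i ∧ b = j
        · rw [← hc1.1, ← hc1.2]; exact Dvd.intro _ rfl
        by_cases hc2 : a = j ∧ b = i
        · rw [← hc2.1, ← hc2.2]; exact varDiff_dvd_swap (Dvd.intro _ rfl)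
        have hζ : ρ (X i) ≠ ρ (X j) := by
          rw [hρX, hρX]
          intro hX
          have := X_injective (R := ℂ) hX
          simp only [Function.update_apply, id] at this
          grind
        have h2 := hqi.varDiff_dvd_top hd1 hζ
        rw [hK, show varDiff a b ^ 3 * K = varDiff a b * (varDiff a b * (varDiff a b * K)) by ring]
          at h2
        exact varDiff_dvd_of_dvd_mul hab hc1 hc2 (varDiff_dvd_of_dvd_mul hab hc1 hc2 h2)
      have h2 : homogeneousComponent d (map ρ G) = 0 := by
        by_contra h0
        obtain ⟨L, hL⟩ := h1
        have h3 := (homogeneousComponent_isHomogeneous d (map ρ G)).totalDegree h0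
        have h4 : homogeneousComponent d (map ρ G) = varDiff a b ^ 2 * (vand n _ * L) := by
          rw [hK, ← hL]; ring
        have hL0 : L ≠ 0 := by rintro rfl; exact h0 (by rw [h4, mul_zero, mul_zero])
        have hv0 : (varDiff a b : BiPoly n) ^ 2 ≠ 0 := pow_ne_zero _ (varDiff_ne_zero hab)
        rw [h4, totalDegree_mul_of_isDomain hv0 (mul_ne_zero vand_ne_zero hL0),
          totalDegree_mul_of_isDomain vand_ne_zero hL0, isHomogeneous_vand.totalDegree vand_ne_zero,
          ((isHomogeneous_varDiff a b).pow 2).totalDegree hv0] at h3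
        omega
      have h3 := sub_homogeneousComponent_mem_degLT hd1
      rwa [h2, sub_zero] at h3
  exact main _ le_rfl hdeg

end Duality

end

section

variable {n : ℕ}

/-! ### Restriction to the diagonal and the symmetric quasi-invariant -/

lemma biPoly_degree_induction {p : BiPoly n → Prop} {d e : ℕ} (h0 : p 0)
    (hadd : ∀ P Q, p P → p Q → p (P + Q))
    (hmon : ∀ (m b : Fin n →₀ ℕ) (c : ℂ), m.degree < d → b.degree < e →
      p (monomial m (monomial b c)))
    {P : BiPoly n} (hP : P ∈ degLT n _ d) (hP' : swapVars n P ∈ degLT n _ e) : p P := by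
  rw [P.as_sum]
  refine Finset.sum_induction _ p hadd h0 fun m _ => ?_
  rw [(coeff m P).as_sum, map_sum]
  refine Finset.sum_induction _ p hadd h0 fun b hb => ?_
  have hb0 : coeff b (coeff m P) ≠ 0 := mem_support_iff.1 hb
  refine hmon m b _ ?_ ?_
  · by_contra! h
    exact hb0 (by rw [hP m h, coeff_zero])
  · by_contra! h
    have := hP' b h
    rw [← coeff_coeff_swapVars, this, coeff_zero] at hb0
    exact hb0 rfl

lemma biPoly_hom_monomial {A : Type*} [CommSemiring A] (f : BiPoly n →+* A) (m b : Fin n →₀ ℕ)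
    (c : ℂ) : f (monomial m (monomial b c)) =
      f (C (C c)) * (∏ i, f (C (X i)) ^ b i) * ∏ i, f (X i) ^ m i := by
  rw [monomial_eq, monomial_eq, Finsupp.prod_fintype _ _ (by simp),
    Finsupp.prod_fintype _ _ (by simp)]
  simp only [map_mul, map_prod, map_pow]

section Diagonal

/-- The restriction of a polynomial in `x` and `z` to the line `x = z = ξ T`. -/
def diagLine (ξ : Fin n → ℝ) : BiPoly n →+* Polynomial ℂ :=
  eval₂Hom (eval₂Hom Polynomial.C fun i => Polynomial.C (ξ i : ℂ) * Polynomial.X)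
    fun i => Polynomial.C (ξ i : ℂ) * Polynomial.X

lemma diagLine_X (ξ : Fin n → ℝ) (i : Fin n) :
    diagLine ξ (X i) = Polynomial.C (ξ i : ℂ) * Polynomial.X := by simp [diagLine]

lemma diagLine_C_X (ξ : Fin n → ℝ) (i : Fin n) :
    diagLine ξ (C (X i)) = Polynomial.C (ξ i : ℂ) * Polynomial.X := by simp [diagLine]

lemma diagLine_C_C (ξ : Fin n → ℝ) (c : ℂ) : diagLine ξ (C (C c)) = Polynomial.C c := by
  simp [diagLine]

lemma diagLine_swapVars (ξ : Fin n → ℝ) (P : BiPoly n) :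
    diagLine ξ (swapVars n P) = diagLine ξ P :=
  biPoly_hom_ext (f := (diagLine ξ).comp (swapVars n)) (g := diagLine ξ)
    (fun c => by simp [swapVars_C_C]) (fun i => by simp [swapVars_C_X, diagLine_X, diagLine_C_X])
    (fun i => by simp [swapVars_X, diagLine_X, diagLine_C_X]) P

lemma diagLine_permVars (ξ : Fin n → ℝ) (s : Equiv.Perm (Fin n)) (P : BiPoly n) :
    diagLine ξ (permVars s P) = diagLine (ξ ∘ s) P :=
  biPoly_hom_ext (f := (diagLine ξ).comp (permVars s)) (g := diagLine (ξ ∘ s))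
    (fun c => by simp [permVars_C_C, diagLine_C_C])
    (fun i => by simp [permVars_C_X, diagLine_C_X])
    (fun i => by simp [permVars_X, diagLine_X]) P

lemma diagLine_coeff_eq_zero (ξ : Fin n → ℝ) {d e : ℕ} {P : BiPoly n} (hP : P ∈ degLT n _ d)
    (hP' : swapVars n P ∈ degLT n _ (e + 1)) : (diagLine ξ P).coeff (d + e) = 0 := by
  refine biPoly_degree_induction (p := fun P => (diagLine ξ P).coeff (d + e) = 0) (by simp)
    (fun P Q h1 h2 => by simp [h1, h2]) (fun m b c hm hb => ?_) hP hP'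
  rw [biPoly_hom_monomial]
  simp only [diagLine_C_X, diagLine_X, diagLine_C_C, mul_pow, Finset.prod_mul_distrib,
    Finset.prod_pow_eq_pow_sum, ← Polynomial.C_pow, ← map_prod]
  rw [← Finsupp.degree_eq_sum, ← Finsupp.degree_eq_sum, mul_assoc, Polynomial.coeff_C_mul,
    show ∀ u v : ℂ, Polynomial.C u * Polynomial.X ^ b.degree *
      (Polynomial.C v * Polynomial.X ^ m.degree) =
      Polynomial.C (u * v) * Polynomial.X ^ (b.degree + m.degree) from
      fun u v => by rw [Polynomial.C_mul]; ring, Polynomial.coeff_C_mul_X_pow,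
    if_neg (by omega), mul_zero]

lemma diagLine_vand (ξ : Fin n → ℝ) : diagLine ξ (vand n _) =
    Polynomial.C (vdm ξ) * Polynomial.X ^ (pairs n).card := by
  rw [vand, map_prod, vdm, map_prod, ← Finset.prod_const, ← Finset.prod_mul_distrib]
  refine Finset.prod_congr rfl fun p _ => ?_
  simp only [varDiff, map_sub, diagLine_X]
  ring

lemma diagLine_C_vand (ξ : Fin n → ℝ) : diagLine ξ (C (vand n ℂ)) =
    Polynomial.C (vdm ξ) * Polynomial.X ^ (pairs n).card := by
  rw [← swapVars_vand, diagLine_swapVars, diagLine_vand]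

/-- After the last step `g` is constant in `x`, hence equal to `c` times the Vandermonde product in
`z`. The remainder has degree below `N` in `x` and at most `N` in `z`, so it does not reach
`T^(2N)`. -/
lemma LeadState.diagLine_coeff {P g : BiPoly n} {c : ℂ} (h : LeadState n (pairs n).card P g c)
    (ξ : Fin n → ℝ) :
    (diagLine ξ P).coeff ((pairs n).card + (pairs n).card) = c * vdm ξ ^ 2 := by
  have hg : g = C (C c * vand n ℂ) := by
    have h1 := h.hom
    rw [Nat.sub_self, ← totalDegree_zero_iff_isHomogeneous, totalDegree_eq_zero_iff_eq_C] at h1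
    have h2 := h.eval_eq
    rw [h1, eval_C] at h2
    rw [h1, h2]
  have hr := h.rem_mem
  rw [two_mul, Nat.add_sub_cancel] at hr
  have hr' : swapVars n (P - vand n _ * g) ∈ degLT n _ ((pairs n).card + 1) := by
    rw [map_sub, hg, map_mul, swapVars_vand, C_mul, map_mul, swapVars_C_C, swapVars_C]
    refine sub_mem h.swap_mem (C_mul_mem_degLT _ (C_mul_mem_degLT _ ?_))
    exact (isHomogeneous_vand.map C).mem_degLT
  have h1 := diagLine_coeff_eq_zero ξ hr hr'
  rw [map_sub, Polynomial.coeff_sub, sub_eq_zero] at h1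
  rw [h1, hg, C_mul, map_mul, map_mul, diagLine_vand, diagLine_C_vand, diagLine_C_C,
    show Polynomial.C (vdm ξ) * Polynomial.X ^ (pairs n).card * (Polynomial.C c *
      (Polynomial.C (vdm ξ) * Polynomial.X ^ (pairs n).card)) = Polynomial.C (c * vdm ξ ^ 2) *
      Polynomial.X ^ ((pairs n).card + (pairs n).card) by
      simp only [Polynomial.C_mul, Polynomial.C_pow]; ring, Polynomial.coeff_C_mul_X_pow,
    if_pos rfl]

lemma vdm_eq_ofReal (ξ : Fin n → ℝ) : vdm ξ = ((∏ p ∈ pairs n, (ξ p.1 - ξ p.2) : ℝ) : ℂ) := by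
  simp [vdm]

lemma prod_pairs_ne_zero {ξ : Fin n → ℝ} (h : ξ ∈ Reg n) :
    ∏ p ∈ pairs n, (ξ p.1 - ξ p.2) ≠ 0 :=
  Finset.prod_ne_zero_iff.2 fun _ hp => sub_ne_zero.2 fun he => (mem_pairs.1 hp).ne (h he)

lemma vdm_ne_zero {ξ : Fin n → ℝ} (h : ξ ∈ Reg n) : vdm ξ ≠ 0 := by
  rw [vdm_eq_ofReal]
  exact_mod_cast prod_pairs_ne_zero h

end Diagonal

/-- Averaging over permutations prepares for duality, which then permits adding the exchanged
polynomial. Nothing cancels: on the diagonal through a real point off the walls, the coefficients of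
`T^(2N)` are positive multiples of the same non-zero constant. -/
lemma exists_symmetric_qi (n : ℕ) : ∃ P : BiPoly n, QI X P ∧ swapVars n P = P ∧
    P ∈ degLT n _ ((pairs n).card + 1) ∧ ∀ ξ ∈ Reg n, diagLine ξ P ≠ 0 := by
  obtain ⟨P₀, g, c, h⟩ := exists_leadState n
  set N := (pairs n).card with hN
  have hP₀ : P₀ ∈ degLT n _ (N + 1) := by
    have h1 := h.rem_mem
    rw [two_mul, Nat.add_sub_cancel] at h1
    have h2 := isHomogeneous_vand.mul h.hom
    rw [Nat.sub_self] at h2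
    have := add_mem (degLT_mono (Nat.le_succ _) h1) h2.mem_degLT
    rwa [sub_add_cancel] at this
  set P₁ : BiPoly n := ∑ s : Equiv.Perm (Fin n), permVars s P₀ with hP₁
  have hqi : QI X P₁ := QI.sum _ fun s _ => h.qi.permVars s
  have hdeg : P₁ ∈ degLT n _ (N + 1) := sum_mem fun s _ => permVars_mem_degLT s hP₀
  have hswap : swapVars n P₁ ∈ degLT n _ (N + 1) := by
    rw [hP₁, map_sum]
    refine sum_mem fun s _ => ?_
    rw [swapVars_permVars]
    exact permVars_mem_degLT s h.swap_mem
  have hinv : ∀ s, permVars s P₁ = P₁ := by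
    intro s
    rw [hP₁, map_sum]
    refine Fintype.sum_equiv (Equiv.mulLeft s) _ _ fun t => ?_
    rw [Equiv.coe_mulLeft]
    exact biPoly_hom_ext (f := (permVars s).comp (permVars t)) (g := permVars (s * t))
      (fun c => by simp [permVars_C_C]) (fun i => by simp [permVars_C_X])
      (fun i => by simp [permVars_X]) P₀
  refine ⟨P₁ + swapVars n P₁, ?_, ?_, add_mem hdeg hswap, fun ξ hξ h0 => ?_⟩
  · have := QI.sum (ζ := X) Finset.univ (P := fun k : Bool => if k then P₁ else swapVars n P₁)
      (by rintro (_ | _) - <;> simp [hqi, hqi.swapVars hdeg hinv])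
    simpa using this
  · rw [map_add, swapVars_swapVars, add_comm]
  · have h1 : (diagLine ξ P₁).coeff (N + N) =
        c * ((∑ s : Equiv.Perm (Fin n), (∏ p ∈ pairs n, ((ξ ∘ s) p.1 - (ξ ∘ s) p.2)) ^ 2 : ℝ) : ℂ) := by
      rw [hP₁, map_sum, Polynomial.finsetSum_coeff, Complex.ofReal_sum, Finset.mul_sum]
      refine Finset.sum_congr rfl fun s _ => ?_
      rw [diagLine_permVars, h.diagLine_coeff, vdm_eq_ofReal, Complex.ofReal_pow]
    have h2 : (0 : ℝ) < ∑ s : Equiv.Perm (Fin n),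
        (∏ p ∈ pairs n, ((ξ ∘ s) p.1 - (ξ ∘ s) p.2)) ^ 2 := by
      refine Finset.sum_pos (fun s _ => ?_) Finset.univ_nonempty
      exact sq_pos_of_ne_zero (prod_pairs_ne_zero (Function.Injective.comp hξ s.injective))
    rw [map_add, diagLine_swapVars, ← two_mul] at h0
    have h3 : diagLine ξ P₁ = 0 := (mul_eq_zero.1 h0).resolve_left two_ne_zero
    rw [h3, Polynomial.coeff_zero] at h1
    exact mul_ne_zero h.ne_zero (Complex.ofReal_ne_zero.2 h2.ne') h1.symm

/-! ### Centring: passage to polynomials in differences of variables -/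

section Center

/-- The linear form `x_i - (x_1 + ⋯ + x_n) / n`. -/
def centered (S : Type*) [CommRing S] [Algebra ℂ S] (i : Fin n) : MvPolynomial (Fin n) S :=
  C (algebraMap ℂ S (n : ℂ)⁻¹) * ∑ j, (X i - X j)

/-- The substitution `x_i ↦ x_i - (x_1 + ⋯ + x_n) / n`, `z_i ↦ z_i - (z_1 + ⋯ + z_n) / n`. -/
def centerVars (n : ℕ) : BiPoly n →+* BiPoly n :=
  eval₂Hom (eval₂Hom (C.comp C) fun i => C (centered ℂ i)) fun i => centered _ i

lemma centerVars_X (i : Fin n) : centerVars n (X i) = centered _ i := by simp [centerVars]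

lemma centerVars_C_X (i : Fin n) : centerVars n (C (X i)) = C (centered _ i) := by
  simp [centerVars]

lemma centerVars_C_C (c : ℂ) : centerVars n (C (C c)) = C (C c) := by simp [centerVars]

lemma C_inv_natCast_mul (S : Type*) [CommRing S] [Algebra ℂ S] (i : Fin n) :
    C (algebraMap ℂ S (n : ℂ)⁻¹) * (n : MvPolynomial (Fin n) S) = 1 := by
  have hn0 : (n : ℂ) ≠ 0 := by
    rintro h
    rw [Nat.cast_eq_zero] at h
    subst h
    exact i.elim0
  rw [← map_natCast (C : S →+* MvPolynomial (Fin n) S), ← map_natCast (algebraMap ℂ S), ← C_mul,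
    ← map_mul, inv_mul_cancel₀ hn0, map_one, C_1]

lemma pderiv_centered (S : Type*) [CommRing S] [Algebra ℂ S] (i j k : Fin n) :
    pderiv i (centered S k) - pderiv j (centered S k) =
      (if k = i then 1 else 0) - (if k = j then 1 else 0) := by
  have hp : ∀ l, pderiv l (centered S k) = C (algebraMap ℂ S (n : ℂ)⁻¹) *
      ((n : MvPolynomial (Fin n) S) * (if k = l then 1 else 0) - 1) := by
    intro l
    rw [centered, pderiv_C_mul, map_sum]
    congr 1
    simp only [map_sub, pderiv_X, Pi.single_apply, Finset.sum_sub_distrib, Finset.sum_const,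
      Finset.card_univ, Fintype.card_fin, nsmul_eq_mul, Finset.sum_ite_eq', Finset.mem_univ,
      if_true]
  rw [hp, hp]
  linear_combination ((if k = i then (1 : MvPolynomial (Fin n) S) else 0) -
    (if k = j then 1 else 0)) * C_inv_natCast_mul S i

lemma centered_sub (S : Type*) [CommRing S] [Algebra ℂ S] (i j : Fin n) :
    centered S i - centered S j = varDiff i j := by
  simp only [centered, Finset.sum_sub_distrib, Finset.sum_const, Finset.card_univ,
    Fintype.card_fin, nsmul_eq_mul, varDiff]
  linear_combination (X i - X j) * C_inv_natCast_mul S i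

/-- Centring subtracts the mean, which is annihilated by `∂_i - ∂_j` and drops out of `z_i - z_j`.
-/
lemma nab_centerVars (i j : Fin n) (P : BiPoly n) :
    nab X i (centerVars n P) - nab X j (centerVars n P) =
      centerVars n (nab X i P - nab X j P) := by
  have h1 : pderiv i (centerVars n P) - pderiv j (centerVars n P) =
      centerVars n (pderiv i P - pderiv j P) := by
    induction P using MvPolynomial.induction_on with
    | C s =>
      have : centerVars n (C s) = C (eval₂ C (fun i => centered ℂ i) s) := by
        simp only [centerVars, coe_eval₂Hom, eval₂_C]
        induction s using MvPolynomial.induction_on with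
        | C a => simp
        | add p q hp hq => simp [hp, hq]
        | mul_X p i hp => simp [hp]
      rw [this]
      simp
    | add P Q hP hQ =>
      simp only [map_add]
      rw [add_sub_add_comm, hP, hQ, ← map_add, add_sub_add_comm]
    | mul_X P k hP =>
      have h2 := pderiv_centered (MvPolynomial (Fin n) ℂ) i j k
      simp only [map_mul, centerVars_X, pderiv_mul, map_add, map_sub, pderiv_X, Pi.single_apply,
        apply_ite (centerVars n), map_one, map_zero] at hP ⊢
      linear_combination centered _ k * hP + centerVars n P * h2
  have h2 := congrArg (C : MvPolynomial (Fin n) ℂ →+* BiPoly n) (centered_sub ℂ i j)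
  simp only [nab_apply, map_add, map_sub, map_mul, centerVars_C_X] at h1 h2 ⊢
  rw [varDiff, C_sub] at h2
  linear_combination h1 - centerVars n P * h2

lemma isHomogeneous_centered (S : Type*) [CommRing S] [Algebra ℂ S] (i : Fin n) :
    (centered S i).IsHomogeneous 1 :=
  (IsHomogeneous.sum _ _ _ fun j _ => isHomogeneous_varDiff i j).C_mul _

lemma QI.centerVars {P : BiPoly n} (h : QI X P) : QI X (centerVars n P) := by
  intro i j
  have h1 := map_dvd (AiryCM.centerVars n) (h i j)
  rw [nab_centerVars]
  rwa [varDiff, map_sub, centerVars_X, centerVars_X, centered_sub] at h1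

lemma isHomogeneous_prod_pow {σ S : Type*} [CommSemiring S] (f : Fin n → MvPolynomial σ S)
    (hf : ∀ i, (f i).IsHomogeneous 1) (m : Fin n →₀ ℕ) :
    (∏ i, f i ^ m i).IsHomogeneous m.degree := by
  rw [Finsupp.degree_eq_sum]
  refine IsHomogeneous.prod _ _ _ fun i _ => ?_
  simpa using (hf i).pow (m i)

lemma centerVars_mem_degLT {d : ℕ} {P : BiPoly n} (h : P ∈ degLT n _ d) :
    centerVars n P ∈ degLT n _ d := by
  refine biPoly_degree_induction (p := fun P => centerVars n P ∈ degLT n _ d)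
    (e := (swapVars n P).totalDegree + 1) (by simp)
    (fun P Q h1 h2 => by rw [map_add]; exact add_mem h1 h2) (fun m b c hm _ => ?_) h
    (mem_degLT_succ_iff.2 le_rfl)
  rw [biPoly_hom_monomial]
  simp only [centerVars_C_X, centerVars_X, centerVars_C_C]
  simp only [← map_pow, ← map_prod, ← map_mul]
  refine C_mul_mem_degLT _ (degLT_mono hm ?_)
  exact (isHomogeneous_prod_pow _ (fun i => isHomogeneous_centered _ i) m).mem_degLT

/-- A quasi-invariant of the lowest possible degree is an eigenfunction. -/
lemma QI.cmOp_eq {P : BiPoly n} (h : QI X P) (hd : P ∈ degLT n _ ((pairs n).card + 1))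
    {Q : Fin n → Fin n → BiPoly n} (hQ : IsQuot X P Q) :
    cmOp X P Q = C (∑ i, X i ^ 2) * P := by
  rw [← sub_eq_zero]
  refine (hQ.qi_cmOp.sub (h.C_mul _)).eq_zero_of_degLT (X_injective (R := ℂ)) le_rfl ?_
  -- It remains to see that every term has degree below `N` in `x`: either a derivative or the
  -- division by `x_i - x_j` lowers the degree.
  rw [cmOp_sub_eq]
  have hQd : ∀ i j, Q i j ∈ degLT n _ (pairs n).card := by
    intro i j
    by_cases hij : i = j
    · simp [hij, hQ.diag]
    refine mem_degLT_of_mul (isHomogeneous_varDiff i j) (varDiff_ne_zero hij) ?_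
    rw [hQ.mul_eq, add_comm]
    simp only [nab_apply]
    exact sub_mem
      (add_mem (degLT_mono (Nat.le_succ _) (pderiv_mem_degLT hd i)) (C_mul_mem_degLT _ hd))
      (add_mem (degLT_mono (Nat.le_succ _) (pderiv_mem_degLT hd j)) (C_mul_mem_degLT _ hd))
  refine sub_mem (sum_mem fun i _ => add_mem ?_ ?_) (sum_mem fun i _ => sum_mem fun j _ => hQd i j)
  · exact pderiv_mem_degLT (degLT_mono (Nat.le_succ _) (pderiv_mem_degLT hd i)) i
  · exact C_mul_mem_degLT _ (pderiv_mem_degLT hd i)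

end Center

end

section

variable {n : ℕ}

/-! ### Constant-coefficient operators on smooth functions -/

section SmoothFunctions

/-- The space of smooth complex functions on `ℝⁿ`. -/
def smoothFun (n : ℕ) : Submodule ℂ ((Fin n → ℝ) → ℂ) where
  carrier := {f | ContDiff ℝ (⊤ : ℕ∞) f}
  zero_mem' := by
    simp only [Set.mem_ofPred_eq]
    exact contDiff_const
  add_mem' := fun hf hg => by
    simp only [Set.mem_ofPred_eq] at hf hg ⊢
    exact hf.add hg
  smul_mem' := fun c f hf => by
    simp only [Set.mem_ofPred_eq] at hf ⊢
    exact contDiff_const.smul hf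

lemma contDiff_pd {f : (Fin n → ℝ) → ℂ} (hf : ContDiff ℝ (⊤ : ℕ∞) f) (i : Fin n) :
    ContDiff ℝ (⊤ : ℕ∞) (pd i f) := by
  have h : ContDiff ℝ (⊤ : ℕ∞) (fderiv ℝ f) := hf.fderiv_right (by simp)
  exact h.clm_apply contDiff_const

lemma differentiable_of_contDiff {f : (Fin n → ℝ) → ℂ} (hf : ContDiff ℝ (⊤ : ℕ∞) f) :
    Differentiable ℝ f := hf.differentiable (by simp)

lemma pd_pd_comm {f : (Fin n → ℝ) → ℂ} (hf : ContDiff ℝ (⊤ : ℕ∞) f) (i j : Fin n) :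
    pd i (pd j f) = pd j (pd i f) := by
  have hd : Differentiable ℝ (fderiv ℝ f) :=
    (hf.fderiv_right (m := (⊤ : ℕ∞)) (by simp)).differentiable (by simp)
  have key : ∀ k l x, pd k (pd l f) x = fderiv ℝ (fderiv ℝ f) x (Pi.single k 1) (Pi.single l 1) := by
    intro k l x
    have h := ((hd x).hasFDerivAt.clm_apply
      (hasFDerivAt_const (Pi.single l 1 : Fin n → ℝ) x)).fderiv
    change fderiv ℝ (fun y => fderiv ℝ f y (Pi.single l 1)) x _ = _
    rw [h]
    simp
  funext x
  rw [key, key]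
  have hs : IsSymmSndFDerivAt ℝ f x := hf.contDiffAt.isSymmSndFDerivAt (by simp; exact WithTop.coe_le_coe.2 (le_top : (2 : ℕ∞) ≤ ⊤))
  exact hs _ _

/-- The partial derivative as an endomorphism of the space of smooth functions. -/
def pdEnd (i : Fin n) : Module.End ℂ (smoothFun n) where
  toFun f := ⟨pd i f, contDiff_pd f.2 i⟩
  map_add' f g := by
    ext x
    have hf := differentiable_of_contDiff f.2 x
    have hg := differentiable_of_contDiff g.2 x
    change fderiv ℝ ((f : (Fin n → ℝ) → ℂ) + (g : (Fin n → ℝ) → ℂ)) x _ = _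
    rw [fderiv_add hf hg]
    rfl
  map_smul' c f := by
    ext x
    have hf := differentiable_of_contDiff f.2 x
    change fderiv ℝ (c • (f : (Fin n → ℝ) → ℂ)) x _ = _
    rw [fderiv_const_smul hf]
    rfl

lemma pdEnd_comm (a b : Module.End ℂ (smoothFun n)) (ha : a ∈ Set.range (pdEnd (n := n)))
    (hb : b ∈ Set.range (pdEnd (n := n))) : a * b = b * a := by
  obtain ⟨i, rfl⟩ := ha
  obtain ⟨j, rfl⟩ := hb
  ext f x
  exact congrFun (pd_pd_comm f.2 i j) x

/-- The action of polynomials in the partial derivatives on smooth functions. -/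
def opEnd (n : ℕ) : MvPolynomial (Fin n) ℂ →ₐ[ℂ] Module.End ℂ (smoothFun n) :=
  -- `aeval` needs a commutative target, so it first lands in the subalgebra generated by the
  -- commuting partial derivatives.
  haveI := Algebra.isMulCommutative_adjoin ℂ (s := Set.range (pdEnd (n := n)))
    fun a ha b hb => pdEnd_comm a b ha hb
  letI : CommSemiring (Algebra.adjoin ℂ (Set.range (pdEnd (n := n)))) :=
    { (inferInstance : Semiring (Algebra.adjoin ℂ (Set.range (pdEnd (n := n))))) with
      mul_comm := fun a b => mul_comm' a b }
  (Algebra.adjoin ℂ (Set.range (pdEnd (n := n)))).val.comp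
    (aeval fun i => ⟨pdEnd i, Algebra.subset_adjoin (Set.mem_range_self i)⟩)

lemma opEnd_X (i : Fin n) : opEnd n (X i) = pdEnd i := by
  simp [opEnd]

lemma opEnd_add_apply (p q : MvPolynomial (Fin n) ℂ) (f : smoothFun n) (x : Fin n → ℝ) :
    (opEnd n (p + q) f : (Fin n → ℝ) → ℂ) x =
      (opEnd n p f : (Fin n → ℝ) → ℂ) x + (opEnd n q f : (Fin n → ℝ) → ℂ) x := by
  rw [map_add]; rfl

lemma opEnd_C_mul_apply (c : ℂ) (q : MvPolynomial (Fin n) ℂ) (f : smoothFun n) (x : Fin n → ℝ) :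
    (opEnd n (C c * q) f : (Fin n → ℝ) → ℂ) x = c * (opEnd n q f : (Fin n → ℝ) → ℂ) x := by
  rw [C_mul', map_smul]; rfl

/-- The functional `q ↦ q(∂) f (x)`. -/
def opAt (f : smoothFun n) (x : Fin n → ℝ) : MvPolynomial (Fin n) ℂ →ₗ[ℂ] ℂ where
  toFun q := (opEnd n q f : (Fin n → ℝ) → ℂ) x
  map_add' p q := opEnd_add_apply p q f x
  map_smul' c q := by rw [← C_mul', opEnd_C_mul_apply]; rfl

lemma opAt_apply (f : smoothFun n) (x : Fin n → ℝ) (q : MvPolynomial (Fin n) ℂ) :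
    opAt f x q = (opEnd n q f : (Fin n → ℝ) → ℂ) x := rfl

lemma opAt_C_mul (f : smoothFun n) (x : Fin n → ℝ) (c : ℂ) (q : MvPolynomial (Fin n) ℂ) :
    opAt f x (C c * q) = c * opAt f x q := opEnd_C_mul_apply c q f x

lemma opAt_one (f : smoothFun n) (x : Fin n → ℝ) : opAt f x 1 = (f : (Fin n → ℝ) → ℂ) x := by
  rw [opAt_apply, map_one]; rfl

lemma contDiff_opAt (f : smoothFun n) (q : MvPolynomial (Fin n) ℂ) :
    ContDiff ℝ (⊤ : ℕ∞) fun x => opAt f x q := (opEnd n q f).2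

lemma pd_opAt (i : Fin n) (q : MvPolynomial (Fin n) ℂ) (f : smoothFun n) (x : Fin n → ℝ) :
    pd i (fun y => opAt f y q) x = opAt f x (X i * q) := by
  rw [opAt_apply, map_mul, opEnd_X]; rfl

lemma opAt_mul (p q : MvPolynomial (Fin n) ℂ) (f : smoothFun n) (x : Fin n → ℝ) :
    opAt f x (p * q) = opAt (opEnd n q f) x p := by
  rw [opAt_apply, map_mul]; rfl

lemma pd_add {f g : (Fin n → ℝ) → ℂ} {x : Fin n → ℝ} (hf : DifferentiableAt ℝ f x)
    (hg : DifferentiableAt ℝ g x) (i : Fin n) :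
    pd i (fun y => f y + g y) x = pd i f x + pd i g x := by
  rw [pd, fderiv_fun_add hf hg]; rfl

lemma pd_mul {f g : (Fin n → ℝ) → ℂ} {x : Fin n → ℝ} (hf : DifferentiableAt ℝ f x)
    (hg : DifferentiableAt ℝ g x) (i : Fin n) :
    pd i (fun y => f y * g y) x = pd i f x * g x + f x * pd i g x := by
  rw [pd, fderiv_fun_mul hf hg, pd, pd]
  simp only [add_apply, smul_apply, smul_eq_mul]
  ring

lemma pd_const (c : ℂ) (i : Fin n) (x : Fin n → ℝ) : pd i (fun _ => c) x = 0 := by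
  simp [pd]

lemma contDiff_coord (j : Fin n) : ContDiff ℝ (⊤ : ℕ∞) fun x : Fin n → ℝ => (x j : ℂ) :=
  Complex.ofRealCLM.contDiff.comp (contDiff_apply ℝ ℝ j)

lemma pd_coord (i j : Fin n) (x : Fin n → ℝ) :
    pd i (fun y : Fin n → ℝ => (y j : ℂ)) x = if i = j then 1 else 0 := by
  have h : HasFDerivAt (fun y : Fin n → ℝ => (y j : ℂ))
      (Complex.ofRealCLM.comp (ContinuousLinearMap.proj (R := ℝ) (φ := fun _ => ℝ) j)) x :=
    (Complex.ofRealCLM.comp (ContinuousLinearMap.proj (R := ℝ) (φ := fun _ => ℝ) j)).hasFDerivAt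
  rw [pd, h.fderiv]
  by_cases hij : i = j
  · subst hij; simp
  · simp [hij]

end SmoothFunctions

/-! ### Symbols of differential operators -/

section Symbols

/-- The symbol `∏ (X_i - X_j)` of a word in the operators `∂_i - ∂_j`. -/
def wordPoly (w : List (Fin n × Fin n)) : MvPolynomial (Fin n) ℂ :=
  (w.map fun p => varDiff p.1 p.2).prod

lemma foldr_pdDiff (w : List (Fin n × Fin n)) (f : smoothFun n) (x : Fin n → ℝ) :
    w.foldr pdDiff f x = opAt f x (wordPoly w) := by
  induction w generalizing x with
  | nil => simp [wordPoly, opAt_one]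
  | cons p w ih =>
    have h : w.foldr pdDiff f = fun y => opAt f y (wordPoly w) := funext ih
    rw [List.foldr_cons, h, pdDiff, pd_opAt, pd_opAt, ← map_sub, ← sub_mul]
    simp [wordPoly, varDiff]

/-- The symbol at the point `x` of a differential operator. -/
def DiffPoly.symbol (D : DiffPoly n) (x : Fin n → ℝ) : MvPolynomial (Fin n) ℂ :=
  ∑ w ∈ D.support, C (D w x) * wordPoly w

lemma DiffPoly.apply_eq (D : DiffPoly n) (f : smoothFun n) (x : Fin n → ℝ) :
    D.apply f x = opAt f x (D.symbol x) := by
  rw [DiffPoly.apply, Finsupp.sum, DiffPoly.symbol, map_sum]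
  refine Finset.sum_congr rfl fun w _ => ?_
  rw [opAt_C_mul, foldr_pdDiff]

lemma lap_eq (f : smoothFun n) : lap (f : (Fin n → ℝ) → ℂ) = opEnd n (∑ i, X i ^ 2) f := by
  funext x
  rw [← opAt_apply, map_sum, lap]
  refine Finset.sum_congr rfl fun i _ => ?_
  rw [pow_two, ← pd_opAt]
  congr 1
  funext y
  rw [← mul_one (X i), ← pd_opAt]
  congr 1
  funext u
  exact (opAt_one f u).symm

/-- The plane wave as a smooth function of `x`. -/
lemma contDiff_planeWave (z : Fin n → ℝ) : ContDiff ℝ (⊤ : ℕ∞) fun x => planeWave x z := by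
  refine ContDiff.cexp (ContDiff.sum fun i _ => ?_)
  exact (contDiff_coord i).mul contDiff_const

lemma pd_planeWave (i : Fin n) (x z : Fin n → ℝ) :
    pd i (fun y => planeWave y z) x = z i * planeWave x z := by
  have h : HasFDerivAt (fun y : Fin n → ℝ => ∑ j, (y j : ℂ) * (z j : ℂ))
      (∑ j, (z j : ℂ) • (Complex.ofRealCLM.comp
        (ContinuousLinearMap.proj (R := ℝ) (φ := fun _ => ℝ) j))) x := by
    refine HasFDerivAt.fun_sum fun j _ => ?_
    exact ((Complex.ofRealCLM.comp
      (ContinuousLinearMap.proj (R := ℝ) (φ := fun _ => ℝ) j)).hasFDerivAt).mul_const _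
  have h2 := h.cexp
  rw [pd]
  unfold planeWave
  rw [h2.fderiv]
  simp [Pi.single_apply, mul_comm, apply_ite Complex.ofReal]

/-- The plane wave with spectral parameter `z` as an element of `smoothFun`. -/
def waveFun (z : Fin n → ℝ) : smoothFun n := ⟨fun x => planeWave x z, contDiff_planeWave z⟩

lemma opAt_waveFun (z x : Fin n → ℝ) (q : MvPolynomial (Fin n) ℂ) :
    opAt (waveFun z) x q = eval (fun i => (z i : ℂ)) q * planeWave x z := by
  induction q using MvPolynomial.induction_on generalizing x with
  | C c => rw [← mul_one (C c), opAt_C_mul, opAt_one]; simp [waveFun]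
  | add p q hp hq => rw [map_add, hp, hq, map_add, add_mul]
  | mul_X p i hp =>
    rw [mul_comm p, ← pd_opAt]
    simp only [hp]
    rw [pd_mul (differentiableAt_const _) (differentiable_of_contDiff (contDiff_planeWave z) x),
      pd_const, pd_planeWave, map_mul, eval_X]
    ring

lemma planeWave_ne_zero (x z : Fin n → ℝ) : planeWave x z ≠ 0 := Complex.exp_ne_zero _

lemma DiffPoly.apply_planeWave (D : DiffPoly n) (x z : Fin n → ℝ) :
    D.apply (fun y => planeWave y z) x =
      eval (fun i => (z i : ℂ)) (D.symbol x) * planeWave x z := by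
  rw [← opAt_waveFun, ← DiffPoly.apply_eq]; rfl

/-- The specialization of a polynomial in `x` and `z` at a point `x`. -/
def evalLeft (x : Fin n → ℝ) : BiPoly n →+* MvPolynomial (Fin n) ℂ := eval fun i => C (x i : ℂ)

lemma contDiff_opAt_evalLeft (f : smoothFun n) (P : BiPoly n) :
    ContDiff ℝ (⊤ : ℕ∞) fun x => opAt f x (evalLeft x P) := by
  induction P using MvPolynomial.induction_on with
  | C s => simpa [evalLeft] using contDiff_opAt f s
  | add P Q hP hQ => simpa only [map_add] using hP.add hQ
  | mul_X P j hP =>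
    simp only [map_mul, evalLeft, eval_X] at hP ⊢
    simp only [mul_comm _ (C _), opAt_C_mul]
    exact (contDiff_coord j).mul hP

/-- By Leibniz' rule `∂_i` differentiates the coefficients of `P(x, ∂)` and multiplies the symbol by
`z_i`, which is the action of `nab X i`. This transfers the algebra of quasi-invariants from
exponentials to arbitrary smooth functions. -/
lemma pd_opAt_evalLeft (i : Fin n) (f : smoothFun n) (P : BiPoly n) (x : Fin n → ℝ) :
    pd i (fun y => opAt f y (evalLeft y P)) x = opAt f x (evalLeft x (nab X i P)) := by
  induction P using MvPolynomial.induction_on with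
  | C s =>
    simp only [evalLeft, eval_C, nab_apply, pderiv_C, zero_add, map_mul]
    exact pd_opAt i s f x
  | add P Q hP hQ =>
    simp only [map_add]
    rw [pd_add (differentiable_of_contDiff (contDiff_opAt_evalLeft f P) x)
      (differentiable_of_contDiff (contDiff_opAt_evalLeft f Q) x), hP, hQ]
  | mul_X P j hP =>
    have h1 : (fun y => opAt f y (evalLeft y (P * X j))) =
        fun y : Fin n → ℝ => (y j : ℂ) * opAt f y (evalLeft y P) := by
      funext y
      simp only [map_mul, evalLeft, eval_X]
      rw [mul_comm _ (C _), opAt_C_mul]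
    rw [h1, pd_mul (differentiable_of_contDiff (contDiff_coord j) x)
      (differentiable_of_contDiff (contDiff_opAt_evalLeft f P) x), hP, pd_coord, mul_comm P, nab_mul,
      map_add, map_add, pderiv_X, map_mul (evalLeft x), map_mul (evalLeft x)]
    have h2 : evalLeft x (X j) = C (x j : ℂ) := by simp [evalLeft]
    have h3 : evalLeft x ((Pi.single i 1 : Fin n → BiPoly n) j) = C (if i = j then (1 : ℂ) else 0) := by
      by_cases h : i = j
      · subst h; simp
      · simp [h, Ne.symm h]
    rw [h2, opAt_C_mul, h3, opAt_C_mul]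

end Symbols

end

section

variable {n : ℕ}

/-! ### Calculus off the walls and conjugation by the Vandermonde product -/

section WallCalculus

lemma isOpen_Reg (n : ℕ) : IsOpen (Reg n) := by
  have : Reg n = ⋂ p : Fin n × Fin n, {x : Fin n → ℝ | p.1 ≠ p.2 → x p.1 ≠ x p.2} := by
    ext x
    simp only [Reg, Set.mem_iInter, Prod.forall]
    constructor
    · intro h i j hij
      exact fun he => hij (h he)
    · intro h i j hij
      by_contra hne
      exact h i j hne hij
  rw [this]
  refine isOpen_iInter_of_finite fun p => ?_
  by_cases hp : p.1 = p.2
  · simp [hp]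
  · simpa [hp] using isOpen_ne_fun (continuous_apply p.1) (continuous_apply p.2)

lemma contDiff_eval (q : MvPolynomial (Fin n) ℂ) :
    ContDiff ℝ (⊤ : ℕ∞) fun x : Fin n → ℝ => eval (fun i => (x i : ℂ)) q := by
  induction q using MvPolynomial.induction_on with
  | C c => simpa using contDiff_const
  | add p q hp hq => simpa using hp.add hq
  | mul_X p i hp => simpa using hp.mul (contDiff_coord i)

lemma pd_eval (i : Fin n) (q : MvPolynomial (Fin n) ℂ) (x : Fin n → ℝ) :
    pd i (fun y : Fin n → ℝ => eval (fun i => (y i : ℂ)) q) x =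
      eval (fun i => (x i : ℂ)) (pderiv i q) := by
  have hd := fun p : MvPolynomial (Fin n) ℂ => differentiable_of_contDiff (contDiff_eval p) x
  induction q using MvPolynomial.induction_on with
  | C c => simp [pd_const]
  | add p q hp hq => simp only [map_add]; rw [pd_add (hd p) (hd q), hp, hq]
  | mul_X p j hp =>
    simp only [map_mul, eval_X]
    rw [pd_mul (hd p) (differentiable_of_contDiff (contDiff_coord j) x), hp, pd_coord, pderiv_mul,
      map_add, map_mul, map_mul, pderiv_X, eval_X]
    by_cases h : i = j
    · subst h; simp
    · simp [h, Ne.symm h]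

lemma eval_vand (x : Fin n → ℝ) : eval (fun i => (x i : ℂ)) (vand n ℂ) = vdm x := by
  simp [vand, vdm, varDiff]

/-- The inverse differences `(x_i - x_j)⁻¹`, which vanish for `i = j`. -/
def invDiff (i j : Fin n) (x : Fin n → ℝ) : ℂ := ((x i : ℂ) - (x j : ℂ))⁻¹

lemma invDiff_self (i : Fin n) (x : Fin n → ℝ) : invDiff i i x = 0 := by simp [invDiff]

lemma sub_ne_zero_of_mem_Reg {x : Fin n → ℝ} (hx : x ∈ Reg n) {i j : Fin n} (h : i ≠ j) :
    (x i : ℂ) - (x j : ℂ) ≠ 0 := by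
  rw [sub_ne_zero]
  exact_mod_cast fun he => h (hx he)

lemma contDiff_vdm : ContDiff ℝ (⊤ : ℕ∞) (vdm (n := n)) := by
  have := contDiff_eval (vand n ℂ)
  simpa only [eval_vand] using this

lemma pd_vdm (i : Fin n) {x : Fin n → ℝ} (hx : x ∈ Reg n) :
    pd i vdm x = (∑ j, invDiff i j x) * vdm x := by
  obtain ⟨W, hW, hWd⟩ := exists_vand_cofactor n ℂ
  have h1 := pd_eval i (vand n ℂ) x
  simp only [eval_vand] at h1
  have h2 := congrArg (eval fun i => (x i : ℂ)) (two_mul_pderiv_vand hW hWd i)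
  simp only [map_mul, map_ofNat, map_sum] at h2
  have h3 : ∀ j, eval (fun i => (x i : ℂ)) (W i j) = invDiff i j x * vdm x := by
    intro j
    by_cases hij : i = j
    · subst hij; simp [hWd, invDiff_self]
    · have h4 := congrArg (eval fun i => (x i : ℂ)) (hW i j hij)
      rw [eval_vand, map_mul] at h4
      simp only [varDiff, map_sub, eval_X] at h4
      rw [← h4, invDiff, inv_mul_cancel_left₀ (sub_ne_zero_of_mem_Reg hx hij)]
  rw [Finset.sum_congr rfl fun j _ => h3 j, ← Finset.sum_mul] at h2
  exact h1.trans (mul_left_cancel₀ two_ne_zero h2)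

lemma pd_inv {f : (Fin n → ℝ) → ℂ} {x : Fin n → ℝ} (hf : DifferentiableAt ℝ f x) (h0 : f x ≠ 0)
    (i : Fin n) : pd i (fun y => (f y)⁻¹) x = -pd i f x * (f x)⁻¹ ^ 2 := by
  have h : fderiv ℝ (fun y => (f y)⁻¹) x = _ :=
    ((hasFDerivAt_inv' (𝕜 := ℝ) h0).comp x hf.hasFDerivAt).fderiv
  rw [pd, h, pd]
  simp only [ContinuousLinearMap.comp_apply, neg_apply, ContinuousLinearMap.mulLeftRight_apply]
  ring

lemma pd_congr {f g : (Fin n → ℝ) → ℂ} {x : Fin n → ℝ} (hx : x ∈ Reg n)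
    (h : ∀ y ∈ Reg n, f y = g y) (i : Fin n) : pd i f x = pd i g x := by
  have : f =ᶠ[nhds x] g := Filter.eventuallyEq_of_mem ((isOpen_Reg n).mem_nhds hx) h
  rw [pd, pd, this.fderiv_eq]

lemma differentiableAt_inv_vdm {x : Fin n → ℝ} (hx : x ∈ Reg n) :
    DifferentiableAt ℝ (fun y => (vdm y)⁻¹) x :=
  (differentiable_of_contDiff contDiff_vdm x).inv (vdm_ne_zero hx)

lemma pd_inv_vdm (i : Fin n) {x : Fin n → ℝ} (hx : x ∈ Reg n) :
    pd i (fun y => (vdm y)⁻¹) x = -(∑ j, invDiff i j x) * (vdm x)⁻¹ := by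
  rw [pd_inv (differentiable_of_contDiff contDiff_vdm x) (vdm_ne_zero hx), pd_vdm i hx]
  field_simp [vdm_ne_zero hx]

lemma differentiableAt_invDiff (i j : Fin n) {x : Fin n → ℝ} (hx : x ∈ Reg n) :
    DifferentiableAt ℝ (invDiff i j) x := by
  by_cases hij : i = j
  · subst hij
    have : invDiff i i = fun _ : Fin n → ℝ => (0 : ℂ) := funext (invDiff_self i)
    rw [this]
    exact differentiableAt_const _
  · exact ((differentiable_of_contDiff (contDiff_coord i) x).sub
      (differentiable_of_contDiff (contDiff_coord j) x)).inv (sub_ne_zero_of_mem_Reg hx hij)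

lemma pd_invDiff (i j : Fin n) {x : Fin n → ℝ} (hx : x ∈ Reg n) :
    pd i (invDiff i j) x = -invDiff i j x ^ 2 := by
  by_cases hij : i = j
  · subst hij
    have : invDiff i i = fun _ : Fin n → ℝ => (0 : ℂ) := funext (invDiff_self i)
    rw [this, pd_const]
    simp
  · have hd := fun k : Fin n => differentiable_of_contDiff (contDiff_coord k) x
    have h1 := pd_inv ((hd i).sub (hd j)) (sub_ne_zero_of_mem_Reg hx hij) i
    have h2 : pd i (fun y : Fin n → ℝ => (y i : ℂ) - (y j : ℂ)) x = 1 := by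
      rw [pd, fderiv_fun_sub (hd i) (hd j)]
      change pd i (fun y : Fin n → ℝ => (y i : ℂ)) x - pd i (fun y : Fin n → ℝ => (y j : ℂ)) x = 1
      rw [pd_coord, pd_coord, if_pos rfl, if_neg hij, sub_zero]
    change pd i (fun y : Fin n → ℝ => (invDiff i j y)) x = _
    unfold invDiff
    simp only [Pi.sub_apply] at h1
    change pd i (fun y : Fin n → ℝ => ((y i : ℂ) - (y j : ℂ))⁻¹) x =
      -pd i (fun y : Fin n → ℝ => (y i : ℂ) - (y j : ℂ)) x * _ at h1
    rw [h1, h2]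
    ring

/-- The products with three distinct indices cancel in cyclic triples, since `1/((x-y)(x-z)) +
1/((y-z)(y-x)) + 1/((z-x)(z-y)) = 0`. -/
lemma sum_sq_sum_invDiff (x : Fin n → ℝ) (hx : x ∈ Reg n) :
    ∑ i, (∑ j, invDiff i j x) ^ 2 = ∑ i, ∑ j, invDiff i j x ^ 2 := by
  set r : Fin n → Fin n → ℂ := fun i j => invDiff i j x with hr
  have hrd : ∀ i, r i i = 0 := fun i => invDiff_self i x
  have hmul : ∀ i j, i ≠ j → r i j * ((x i : ℂ) - x j) = 1 := fun i j h =>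
    inv_mul_cancel₀ (sub_ne_zero_of_mem_Reg hx h)
  have hanti : ∀ i j, r i j = - r j i := fun i j => by
    simp only [hr, invDiff]
    rw [← inv_neg, neg_sub]
  -- The indicator terms on the right account for coinciding indices; summation over all triples
  -- yields three times the claim.
  have hcyc : ∀ i j k, r i j * r i k + r j k * r j i + r k i * r k j =
      (if j = k then r i j ^ 2 else 0) + (if k = i then r j k ^ 2 else 0) +
        (if i = j then r k i ^ 2 else 0) := by
    intro i j k
    by_cases hij : i = j
    · subst hij
      by_cases hik : i = k
      · subst hik; simp [hrd]
      · simp [hrd, hik, Ne.symm hik, pow_two]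
    · by_cases hjk : j = k
      · subst hjk
        simp [hrd, hij, Ne.symm hij, pow_two]
      · by_cases hki : k = i
        · subst hki
          simp [hrd, hij, hjk, pow_two]
        · simp only [hij, hjk, hki, if_false, add_zero]
          have h1 := hmul i j hij
          have h2 := hmul j k hjk
          have h3 := hmul k i hki
          rw [hanti i k, hanti j i, hanti k j]
          linear_combination (r j k * r k i) * h1 + (r i j * r k i) * h2 + (r i j * r j k) * h3
  have hsq : ∑ i, (∑ j, r i j) ^ 2 = ∑ i, ∑ j, ∑ k, r i j * r i k := by
    refine Finset.sum_congr rfl fun i _ => ?_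
    rw [pow_two, Finset.sum_mul_sum]
  have hrot : ∀ g : Fin n → Fin n → Fin n → ℂ,
      ∑ i, ∑ j, ∑ k, g j k i = ∑ i, ∑ j, ∑ k, g i j k := by
    intro g
    rw [Finset.sum_comm]
    refine Finset.sum_congr rfl fun j _ => ?_
    rw [Finset.sum_comm]
  have hdiag : ∑ i, ∑ j, ∑ k, (if j = k then r i j ^ 2 else 0) = ∑ i, ∑ j, r i j ^ 2 := by
    simp
  have h3 : 3 * ∑ i, ∑ j, ∑ k, r i j * r i k = 3 * ∑ i, ∑ j, r i j ^ 2 := by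
    have e := Finset.sum_congr rfl fun i (_ : i ∈ Finset.univ) =>
      Finset.sum_congr rfl fun j (_ : j ∈ Finset.univ) =>
        Finset.sum_congr rfl fun k (_ : k ∈ Finset.univ) => hcyc i j k
    simp only [Finset.sum_add_distrib] at e
    have a1 := hrot fun i j k => r i j * r i k
    have a2 := hrot fun i j k => r j k * r j i
    have b1 := hrot fun i j k => if j = k then r i j ^ 2 else 0
    have b2 := hrot fun i j k => if k = i then r j k ^ 2 else 0
    rw [hdiag] at e b1
    linear_combination e - 2 * a1 - a2 + 2 * b1 + b2
  rw [hsq]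
  exact mul_left_cancel₀ three_ne_zero h3

lemma cmPotential_eq (x : Fin n → ℝ) : cmPotential x = 2 * ∑ i, ∑ j, invDiff i j x ^ 2 := by
  rw [sum_sum_eq_pairs (fun i j => invDiff i j x ^ 2)
    (fun i j => by rw [invDiff, invDiff, ← neg_sub, inv_neg, neg_sq])
    (fun i => by rw [invDiff_self]; ring), cmPotential, ← Finset.sum_add_distrib, Finset.mul_sum]
  refine Finset.sum_congr rfl fun p _ => ?_
  rw [invDiff, inv_pow, div_eq_mul_inv]
  ring

/-- Conjugation of the Calogero-Moser operator by `∏_{i<j} (x_i - x_j)`. -/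
lemma lapTilde_inv_vdm_mul {F : (Fin n → ℝ) → ℂ} (hF : ContDiff ℝ (⊤ : ℕ∞) F) {x : Fin n → ℝ}
    (hx : x ∈ Reg n) : lapTilde (fun y => (vdm y)⁻¹ * F y) x =
      (vdm x)⁻¹ * (lap F x - ∑ i, ∑ j, invDiff i j x * (pd i F x - pd j F x)) := by
  have hFd := differentiable_of_contDiff hF
  have h1 : ∀ i, ∀ y ∈ Reg n, pd i (fun y => (vdm y)⁻¹ * F y) y =
      (vdm y)⁻¹ * (pd i F y + -(∑ j, invDiff i j y) * F y) := by
    intro i y hy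
    rw [pd_mul (differentiableAt_inv_vdm hy) (hFd y), pd_inv_vdm i hy]
    ring
  have hsd : ∀ i, DifferentiableAt ℝ (fun y => -∑ j, invDiff i j y) x := fun i =>
    (DifferentiableAt.fun_sum fun j _ => differentiableAt_invDiff i j hx).neg
  have h2 : ∀ i, pd i (fun y => -∑ j, invDiff i j y) x = ∑ j, invDiff i j x ^ 2 := by
    intro i
    have hs : HasFDerivAt (fun y => -∑ j, invDiff i j y) (-∑ j, fderiv ℝ (invDiff i j) x) x :=
      (HasFDerivAt.fun_sum fun j _ => (differentiableAt_invDiff i j hx).hasFDerivAt).neg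
    rw [pd, hs.fderiv]
    simp only [neg_apply, sum_apply]
    rw [← Finset.sum_neg_distrib]
    refine Finset.sum_congr rfl fun j _ => ?_
    have := pd_invDiff i j hx
    rw [pd] at this
    rw [this, neg_neg]
  have h3 : ∀ i, pd i (pd i fun y => (vdm y)⁻¹ * F y) x = (vdm x)⁻¹ *
      (pd i (pd i F) x - 2 * (∑ j, invDiff i j x) * pd i F x +
        ((∑ j, invDiff i j x) ^ 2 + ∑ j, invDiff i j x ^ 2) * F x) := by
    intro i
    have hp := differentiable_of_contDiff (contDiff_pd hF i) x
    rw [pd_congr hx (h1 i), pd_mul (differentiableAt_inv_vdm hx) (hp.fun_add ((hsd i).fun_mul (hFd x))),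
      pd_inv_vdm i hx, pd_add hp ((hsd i).fun_mul (hFd x)), pd_mul (hsd i) (hFd x), h2]
    ring
  have h4 : ∑ i, ∑ j, invDiff i j x * (pd i F x - pd j F x) =
      ∑ i, 2 * (∑ j, invDiff i j x) * pd i F x := by
    have e1 : ∑ i, ∑ j, invDiff i j x * pd j F x = -∑ i, ∑ j, invDiff i j x * pd i F x := by
      rw [Finset.sum_comm, ← Finset.sum_neg_distrib]
      refine Finset.sum_congr rfl fun i _ => ?_
      rw [← Finset.sum_neg_distrib]
      refine Finset.sum_congr rfl fun j _ => ?_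
      rw [invDiff, invDiff, ← neg_sub, inv_neg]
      ring
    simp only [mul_sub, Finset.sum_sub_distrib]
    rw [e1, sub_neg_eq_add, ← Finset.sum_add_distrib]
    refine Finset.sum_congr rfl fun i _ => ?_
    rw [← Finset.sum_mul]
    ring
  -- The zeroth-order terms add up to `2 ∑ (x_i - x_j)⁻²` over ordered pairs, which is the
  -- potential.
  rw [lapTilde, lap, Finset.sum_congr rfl fun i _ => h3 i, ← Finset.mul_sum, h4, cmPotential_eq,
    Finset.sum_add_distrib, Finset.sum_sub_distrib, ← Finset.sum_mul, Finset.sum_add_distrib,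
    sum_sq_sum_invDiff x hx, lap]
  ring

end WallCalculus

end

section

variable {n : ℕ}

/-! ### Existence of Chalykh-Veselov operators -/

section Existence

lemma card_pairs (n : ℕ) : (pairs n).card = n * (n - 1) / 2 := by
  have h := sum_sum_eq_pairs (n := n) (fun i j => if i = j then 0 else 1)
    (fun i j => by simp only [eq_comm]) (by simp)
  have h1 : ∑ p ∈ pairs n, (if p.1 = p.2 then 0 else 1) = (pairs n).card := by
    rw [Finset.card_eq_sum_ones]
    exact Finset.sum_congr rfl fun p hp => if_neg (mem_pairs.1 hp).ne
  have h2 : ∀ i : Fin n, ∑ j : Fin n, (if i = j then 0 else 1) = n - 1 := by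
    intro i
    rw [← Finset.sum_erase Finset.univ (a := i) (by simp),
      Finset.sum_congr rfl fun j hj => if_neg (Finset.ne_of_mem_erase hj).symm]
    simp
  rw [h1, Finset.sum_congr rfl fun i _ => h2 i] at h
  simp only [Finset.sum_const, Finset.card_univ, Fintype.card_fin, smul_eq_mul] at h
  omega

/-- The expression of a polynomial in `x` and `z` through the differences `x_i - x_j` (in the
coefficients) and `z_i - z_j`, by the substitution `x_i ↦ n⁻¹ ∑_j (x_i - x_j)`. -/
def inDiffs (n : ℕ) :
    BiPoly n →+* MvPolynomial (Fin n × Fin n) (MvPolynomial (Fin n × Fin n) ℂ) :=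
  eval₂Hom (eval₂Hom (C.comp C) fun i => C (C (n : ℂ)⁻¹) * ∑ j, X (i, j))
    fun i => C (C (n : ℂ)⁻¹ * ∑ j, X (i, j))

lemma inDiffs_X (i : Fin n) : inDiffs n (X i) = C (C (n : ℂ)⁻¹ * ∑ j, X (i, j)) := by
  simp [inDiffs]

lemma inDiffs_C_X (i : Fin n) : inDiffs n (C (X i)) = C (C (n : ℂ)⁻¹) * ∑ j, X (i, j) := by
  simp [inDiffs]

lemma inDiffs_C_C (c : ℂ) : inDiffs n (C (C c)) = C (C c) := by simp [inDiffs]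

lemma totalDegree_inDiffs_le {d : ℕ} {P : BiPoly n} (h : swapVars n P ∈ degLT n _ (d + 1)) :
    (inDiffs n P).totalDegree ≤ d := by
  refine biPoly_degree_induction (p := fun P => (inDiffs n P).totalDegree ≤ d)
    (d := P.totalDegree + 1) (by simp)
    (fun P Q h1 h2 => by rw [map_add]; exact (totalDegree_add _ _).trans (max_le h1 h2))
    (fun m b c _ hb => ?_) (mem_degLT_succ_iff.2 le_rfl) h
  rw [biPoly_hom_monomial]
  simp only [inDiffs_X, inDiffs_C_X, inDiffs_C_C]
  simp only [← map_pow, ← map_prod]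
  have h1 : (∏ i, (C (C (n : ℂ)⁻¹) * ∑ j, X (i, j) :
      MvPolynomial (Fin n × Fin n) (MvPolynomial (Fin n × Fin n) ℂ)) ^ b i).IsHomogeneous
      b.degree :=
    isHomogeneous_prod_pow _ (fun i =>
      (IsHomogeneous.sum _ _ _ fun j _ => isHomogeneous_X _ _).C_mul _) b
  rw [mul_comm, ← mul_assoc, ← C_mul]
  exact ((h1.C_mul _).totalDegree_le).trans (by omega)

/-- A word with prescribed numbers of letters. -/
def wordOf (m : Fin n × Fin n →₀ ℕ) : List (Fin n × Fin n) := (Finsupp.toMultiset m).toList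

lemma wordPoly_wordOf (m : Fin n × Fin n →₀ ℕ) :
    wordPoly (wordOf m) = m.prod fun p k => (varDiff p.1 p.2) ^ k := by
  rw [wordPoly, wordOf, ← Multiset.prod_coe, ← Multiset.map_coe, Multiset.coe_toList,
    Finsupp.toMultiset_map, Finsupp.prod_toMultiset, Finsupp.prod_mapDomain_index (by simp)
    (by intros; exact pow_add _ _ _)]

lemma length_wordOf (m : Fin n × Fin n →₀ ℕ) : (wordOf m).length = m.degree := by
  rw [wordOf, Multiset.length_toList, Finsupp.card_toMultiset]
  rfl

/-- The differences of the coordinates of a point. -/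
def diffs (x : Fin n → ℝ) : Fin n × Fin n → ℂ := fun k => (x k.1 : ℂ) - (x k.2 : ℂ)

/-- The differential operator `∏_{i<j} (x_i - x_j)⁻¹ P(x, ∂)`, for a polynomial `P` in the
differences. -/
def diffPolyOf (P : BiPoly n) : DiffPoly n :=
  ∑ m ∈ (inDiffs n P).support, Finsupp.single (wordOf m)
    fun x => eval (diffs x) (coeff m (inDiffs n P)) / vdm x

lemma DiffPoly.symbol_sum {ι : Type*} (s : Finset ι) (D : ι → DiffPoly n) (x : Fin n → ℝ) :
    (∑ i ∈ s, D i).symbol x = ∑ i ∈ s, (D i).symbol x := by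
  have h : ∀ D : DiffPoly n, D.symbol x = D.sum fun w c => C (c x) * wordPoly w := fun D => rfl
  simp only [h]
  refine (Finsupp.sum_finsetSum_index (fun w => by simp) fun w c d => ?_).symm
  rw [Pi.add_apply, C_add, add_mul]

lemma DiffPoly.symbol_single (w : List (Fin n × Fin n)) (c : (Fin n → ℝ) → ℂ) (x : Fin n → ℝ) :
    DiffPoly.symbol (Finsupp.single w c) x = C (c x) * wordPoly w :=
  Finsupp.sum_single_index (h := fun w (c : (Fin n → ℝ) → ℂ) => C (c x) * wordPoly w)
    (by simp)

/-- The substitution of the differences of the coordinates of `x` and of `X` for the letters. -/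
def letterEval (x : Fin n → ℝ) :
    MvPolynomial (Fin n × Fin n) (MvPolynomial (Fin n × Fin n) ℂ) →+* MvPolynomial (Fin n) ℂ :=
  eval₂Hom (C.comp (eval (diffs x))) fun p => varDiff p.1 p.2

lemma letterEval_C (x : Fin n → ℝ) (q : MvPolynomial (Fin n × Fin n) ℂ) :
    letterEval x (C q) = C (eval (diffs x) q) := by
  rw [letterEval, coe_eval₂Hom, eval₂_C]; rfl

lemma letterEval_X (x : Fin n → ℝ) (p : Fin n × Fin n) :
    letterEval x (X p) = varDiff p.1 p.2 := by
  rw [letterEval, coe_eval₂Hom, eval₂_X]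

lemma evalLeft_C (x : Fin n → ℝ) (s : MvPolynomial (Fin n) ℂ) : evalLeft x (C s) = s := by
  rw [evalLeft, eval_C]

lemma evalLeft_X (x : Fin n → ℝ) (i : Fin n) : evalLeft x (X i) = C (x i : ℂ) := by
  rw [evalLeft, eval_X]

lemma centered_eq (S : Type*) [CommRing S] [Algebra ℂ S] (i : Fin n) :
    centered S i = C (algebraMap ℂ S (n : ℂ)⁻¹) * ∑ j, varDiff i j := rfl

/-- `∑_j (x_i - x_j)/n` is `x_i` minus the mean, so rewriting through differences and substituting
back amounts to centring. -/
lemma letterEval_inDiffs (x : Fin n → ℝ) (P : BiPoly n) :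
    letterEval x (inDiffs n P) = evalLeft x (centerVars n P) := by
  refine biPoly_hom_ext (f := (letterEval x).comp (inDiffs n))
    (g := (evalLeft x).comp (centerVars n)) (fun c => ?_) (fun i => ?_) (fun i => ?_) P
  · rw [RingHom.comp_apply, RingHom.comp_apply, centerVars_C_C, inDiffs_C_C, letterEval_C,
      evalLeft_C, eval_C]
  · rw [RingHom.comp_apply, RingHom.comp_apply, centerVars_C_X, inDiffs_C_X, evalLeft_C, map_mul,
      letterEval_C, eval_C, map_sum, centered_eq]
    simp only [letterEval_X]
    rfl
  · rw [RingHom.comp_apply, RingHom.comp_apply, centerVars_X, inDiffs_X, letterEval_C, map_mul,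
      eval_C, map_sum, centered_eq, map_mul (evalLeft x), evalLeft_C, C_mul, map_sum, map_sum]
    simp only [eval_X, varDiff, map_sub, evalLeft_X, diffs]
    rfl

lemma symbol_diffPolyOf (P : BiPoly n) (x : Fin n → ℝ) :
    (diffPolyOf P).symbol x = C (vdm x)⁻¹ * evalLeft x (centerVars n P) := by
  rw [← letterEval_inDiffs, diffPolyOf, DiffPoly.symbol_sum, letterEval, coe_eval₂Hom, eval₂_eq,
    Finset.mul_sum]
  refine Finset.sum_congr rfl fun m _ => ?_
  rw [DiffPoly.symbol_single, wordPoly_wordOf, div_eq_mul_inv, mul_comm (eval _ _), C_mul,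
    mul_assoc]
  rfl

lemma evalLeft_swapVars (x z : Fin n → ℝ) (P : BiPoly n) :
    eval (fun i => (z i : ℂ)) (evalLeft x (swapVars n P)) =
      eval (fun i => (x i : ℂ)) (evalLeft z P) :=
  biPoly_hom_ext (f := ((eval fun i => (z i : ℂ)).comp (evalLeft x)).comp (swapVars n))
    (g := (eval fun i => (x i : ℂ)).comp (evalLeft z))
    (fun c => by simp [swapVars_C_C, evalLeft]) (fun i => by simp [swapVars_C_X, evalLeft])
    (fun i => by simp [swapVars_X, evalLeft]) P

lemma swapVars_centered (i : Fin n) :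
    swapVars n (centered _ i) = C (centered ℂ i) := by
  simp [centered, swapVars_X, swapVars_C]

lemma swapVars_centerVars (P : BiPoly n) :
    swapVars n (centerVars n P) = centerVars n (swapVars n P) := by
  refine biPoly_hom_ext (f := (swapVars n).comp (centerVars n))
    (g := (centerVars n).comp (swapVars n)) (fun c => ?_) (fun i => ?_) (fun i => ?_) P
  · simp [swapVars_C_C, centerVars_C_C]
  · simp only [RingHom.comp_apply, centerVars_C_X, swapVars_C_X, centerVars_X]
    rw [← swapVars_centered, swapVars_swapVars]
  · simp only [RingHom.comp_apply, centerVars_X, swapVars_X, centerVars_C_X, swapVars_centered]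

lemma diagLine_centered (ξ : Fin n → ℝ) (i : Fin n) : diagLine ξ (centered _ i) =
    Polynomial.C (((n : ℝ)⁻¹ * ∑ j, (ξ i - ξ j) : ℝ) : ℂ) * Polynomial.X := by
  have h : (C (algebraMap ℂ (MvPolynomial (Fin n) ℂ) (n : ℂ)⁻¹) : BiPoly n) = C (C (n : ℂ)⁻¹) := rfl
  rw [centered, map_mul, h, diagLine_C_C, map_sum]
  simp only [map_sub, diagLine_X]
  simp only [← sub_mul, ← Polynomial.C_sub]
  rw [← Finset.sum_mul, ← map_sum, ← mul_assoc, ← Polynomial.C_mul]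
  simp

lemma diagLine_centerVars (ξ : Fin n → ℝ) (P : BiPoly n) :
    diagLine ξ (centerVars n P) = diagLine (fun i => (n : ℝ)⁻¹ * ∑ j, (ξ i - ξ j)) P := by
  refine biPoly_hom_ext (f := (diagLine ξ).comp (centerVars n))
    (g := diagLine (fun i => (n : ℝ)⁻¹ * ∑ j, (ξ i - ξ j))) (fun c => ?_) (fun i => ?_)
    (fun i => ?_) P
  · rw [RingHom.comp_apply, centerVars_C_C, diagLine_C_C, diagLine_C_C]
  · rw [RingHom.comp_apply, centerVars_C_X, ← swapVars_centered, diagLine_swapVars,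
      diagLine_centered, diagLine_C_X]
  · rw [RingHom.comp_apply, centerVars_X, diagLine_centered, diagLine_X]

lemma eval_diagLine (ξ : Fin n → ℝ) (t : ℝ) (P : BiPoly n) :
    (diagLine ξ P).eval (t : ℂ) =
      eval (fun i => ((ξ i * t : ℝ) : ℂ)) (evalLeft (fun i => ξ i * t) P) :=
  biPoly_hom_ext (f := (Polynomial.evalRingHom (t : ℂ)).comp (diagLine ξ))
    (g := (eval fun i => ((ξ i * t : ℝ) : ℂ)).comp (evalLeft (fun i => ξ i * t)))
    (fun c => by simp [diagLine_C_C, evalLeft]) (fun i => by simp [diagLine_C_X, evalLeft])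
    (fun i => by simp [diagLine_X, evalLeft]) P

lemma exists_real_eval_ne_zero {q : Polynomial ℂ} (h : q ≠ 0) : ∃ t : ℝ, t ≠ 0 ∧ q.eval (t : ℂ) ≠ 0 := by
  by_contra! hc
  have h0 : q * Polynomial.X ≠ 0 := mul_ne_zero h Polynomial.X_ne_zero
  refine h0 (Polynomial.eq_zero_of_infinite_isRoot _ ?_)
  refine (Set.infinite_range_of_injective Complex.ofReal_injective).mono ?_
  rintro _ ⟨t, rfl⟩
  by_cases ht : t = 0
  · simp [ht]
  · simp [hc t ht]

lemma mem_Reg_natCast (n : ℕ) : (fun i : Fin n => ((i : ℕ) : ℝ)) ∈ Reg n := by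
  intro i j hij
  have h : ((i : ℕ) : ℝ) = ((j : ℕ) : ℝ) := hij
  exact Fin.ext (by exact_mod_cast h)

/-- The operator is `V⁻¹ P'(x, ∂)` with `P'` the centred symmetric quasi-invariant. The intertwining
relation is the eigenvalue equation `QI.cmOp_eq` read as an identity of symbols, and the symmetry is
that of `P'`. -/
theorem exists_isChalykhVeselov (n : ℕ) : ∃ D : DiffPoly n, IsChalykhVeselov n D := by
  obtain ⟨P, hqi, hsymm, hdeg, hne⟩ := exists_symmetric_qi n
  set P' := centerVars n P with hP'
  have hqi' : QI X P' := hqi.centerVars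
  obtain ⟨Q, hQ⟩ := hqi'.exists_isQuot
  have heq := hqi'.cmOp_eq (centerVars_mem_degLT hdeg) hQ
  have happly : ∀ (f : smoothFun n) (x : Fin n → ℝ), (diffPolyOf P).apply f x =
      (vdm x)⁻¹ * opAt f x (evalLeft x P') := fun f x => by
    rw [DiffPoly.apply_eq, symbol_diffPolyOf, opAt_C_mul]
  have hword : ∀ m ∈ (inDiffs n P).support, (wordOf m).length ≤ n * (n - 1) / 2 := by
    intro m hm
    rw [length_wordOf, ← card_pairs]
    have h1 : (inDiffs n P).totalDegree ≤ (pairs n).card :=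
      -- The order of the operator is the degree in `z`, which equals the degree in `x` by symmetry.
      totalDegree_inDiffs_le (by rwa [hsymm])
    exact (le_totalDegree hm).trans h1
  refine ⟨diffPolyOf P, ?_, ?_, ?_, ?_, ?_⟩
  · have h1 : ∀ w, ∃ p : MvPolynomial (Fin n × Fin n) ℂ, ∀ x,
        diffPolyOf P w x = eval (diffs x) p / vdm x := by
      refine Finset.sum_induction _
        (fun D : DiffPoly n => ∀ w, ∃ p : MvPolynomial (Fin n × Fin n) ℂ, ∀ x,
          D w x = eval (diffs x) p / vdm x) ?_ ?_ ?_
      · intro D E hD hE w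
        obtain ⟨p, hp⟩ := hD w
        obtain ⟨q, hq⟩ := hE w
        exact ⟨p + q, fun x => by
          rw [Finsupp.add_apply, Pi.add_apply, hp, hq, map_add, add_div]⟩
      · exact fun w => ⟨0, fun x => by simp⟩
      · intro m _ w
        by_cases hw : wordOf m = w
        · exact ⟨coeff m (inDiffs n P), fun x => by rw [hw, Finsupp.single_eq_same]⟩
        · exact ⟨0, fun x => by rw [Finsupp.single_eq_of_ne (Ne.symm hw)]; simp⟩
    intro w
    obtain ⟨p, hp⟩ := h1 w
    have hv : ∀ x : Fin n → ℝ, eval (fun k => (x k.1 : ℂ) - (x k.2 : ℂ))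
        (∏ p ∈ pairs n, X p : MvPolynomial (Fin n × Fin n) ℂ) = vdm x := fun x => by
      simp [vdm]
    refine ⟨p, ∏ p ∈ pairs n, X p, fun x hx => ?_⟩
    rw [hv]
    exact ⟨vdm_ne_zero hx, hp x⟩
  · intro f hf x hx
    obtain ⟨f, rfl⟩ : ∃ g : smoothFun n, (g : (Fin n → ℝ) → ℂ) = f := ⟨⟨f, hf⟩, rfl⟩
    have h1 : (diffPolyOf P).apply f = fun y => (vdm y)⁻¹ * opAt f y (evalLeft y P') :=
      funext (happly f)
    rw [h1, lapTilde_inv_vdm_mul (contDiff_opAt_evalLeft f P') hx, lap_eq, happly, ← opAt_mul]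
    congr 1
    have h2 : lap (fun y => opAt f y (evalLeft y P')) x =
        opAt f x (evalLeft x (∑ i, nab X i (nab X i P'))) := by
      rw [lap, map_sum, map_sum]
      refine Finset.sum_congr rfl fun i _ => ?_
      rw [← pd_opAt_evalLeft]
      congr 1
      funext y
      exact pd_opAt_evalLeft i f P' y
    have h3 : ∀ i j, invDiff i j x * (pd i (fun y => opAt f y (evalLeft y P')) x -
        pd j (fun y => opAt f y (evalLeft y P')) x) = opAt f x (evalLeft x (Q i j)) := by
      intro i j
      by_cases hij : i = j
      · subst hij; simp [hQ.diag]
      rw [pd_opAt_evalLeft, pd_opAt_evalLeft, ← map_sub, ← map_sub, ← hQ.mul_eq,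
        map_mul (evalLeft x)]
      have : evalLeft x (varDiff i j) = C ((x i : ℂ) - (x j : ℂ)) := by
        simp [evalLeft, varDiff]
      rw [this, opAt_C_mul, invDiff, inv_mul_cancel_left₀ (sub_ne_zero_of_mem_Reg hx hij)]
    rw [h2]
    simp only [h3]
    simp only [← map_sum, ← map_sub]
    change _ = opAt f x (evalLeft x (cmOp X P' Q))
    rw [heq, map_mul (evalLeft x), mul_comm, evalLeft_C]
  · intro x _ z _
    have h1 : ∀ x z : Fin n → ℝ, (diffPolyOf P).apply (fun y => planeWave y z) x =
        (vdm x)⁻¹ * eval (fun i => (z i : ℂ)) (evalLeft x P') * planeWave x z := by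
      intro x z
      rw [DiffPoly.apply_planeWave, symbol_diffPolyOf, map_mul, eval_C]
    have h2 : swapVars n P' = P' := by rw [hP', swapVars_centerVars, hsymm]
    have h3 : planeWave x z = planeWave z x := by simp only [planeWave, mul_comm]
    simp only [h1]
    rw [← h2, evalLeft_swapVars, h2, h3]
    ring
  · have h1 : ∀ w ∈ (diffPolyOf P).support, w.length ≤ n * (n - 1) / 2 := by
      refine Finset.sum_induction _
        (fun D : DiffPoly n => ∀ w ∈ D.support, w.length ≤ n * (n - 1) / 2) ?_ ?_ ?_
      · intro D E hD hE w hw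
        rcases Finset.mem_union.1 (Finsupp.support_add hw) with h | h
        · exact hD w h
        · exact hE w h
      · simp
      · intro m hm w hw
        have := Finset.mem_singleton.1 (Finsupp.support_single_subset hw)
        rw [this]
        exact hword m hm
    exact h1
  -- Non-vanishing is tested on a plane wave with `z = x` on a line through the origin, where `P'`
  -- restricts to a non-zero polynomial.
  · set ξ : Fin n → ℝ := fun i => ((i : ℕ) : ℝ) with hξ
    have hreg : (fun i => (n : ℝ)⁻¹ * ∑ j, (ξ i - ξ j)) ∈ Reg n := by
      intro i j hij
      have hn0 : (n : ℝ) ≠ 0 := by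
        intro h
        rw [Nat.cast_eq_zero] at h
        subst h
        exact i.elim0
      have h2 := mul_left_cancel₀ (inv_ne_zero hn0) hij
      simp only [Finset.sum_sub_distrib, Finset.sum_const, Finset.card_univ, Fintype.card_fin,
        nsmul_eq_mul, sub_left_inj] at h2
      exact mem_Reg_natCast n (mul_left_cancel₀ hn0 h2)
    have h0 := hne _ hreg
    rw [← diagLine_centerVars] at h0
    obtain ⟨t, ht, hval⟩ := exists_real_eval_ne_zero h0
    rw [eval_diagLine] at hval
    have hx : (fun i => ξ i * t) ∈ Reg n := fun i j hij =>
      mem_Reg_natCast n (mul_right_cancel₀ ht hij)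
    refine ⟨waveFun (fun i => ξ i * t), (waveFun _).2, fun i => ξ i * t, hx, ?_⟩
    rw [happly, opAt_waveFun]
    exact mul_ne_zero (inv_ne_zero (vdm_ne_zero hx)) (mul_ne_zero hval (planeWave_ne_zero _ _))

end Existence

end

/-! ### The Airy function: integral representation and differential equation -/

section AiryFunction

open MeasureTheory Filter Topology

/-- The integrand of the `m`-th derivative of `2 π Ai`. -/
def airyKer (m : ℕ) (w s : ℝ) : ℂ :=
  (-(1 + Complex.I * (s : ℂ))) ^ m *
    Complex.exp ((1 + Complex.I * (s : ℂ)) ^ 3 / 3 - (w : ℂ) * (1 + Complex.I * (s : ℂ)))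

/-- The `m`-th derivative of `2 π Ai` on the real line. -/
def airyInt (m : ℕ) (w : ℝ) : ℂ := ∫ s : ℝ, airyKer m w s

/-- The exponent has real part `1/3 - s² - w`. The polynomial factor costs half of the Gaussian, by
`|1 + is| ≤ exp |s|` and `m|s| ≤ m²/2 + s²/2`. -/
lemma norm_airyKer_le (m : ℕ) (w s : ℝ) :
    ‖airyKer m w s‖ ≤ Real.exp ((m : ℝ) ^ 2 / 2 + 1 / 3 - w) * Real.exp (-(1 / 2) * s ^ 2) := by
  have h1 : ((1 + Complex.I * (s : ℂ)) ^ 3 / 3 - (w : ℂ) * (1 + Complex.I * (s : ℂ))) =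
      ((1 / 3 - s ^ 2 - w : ℝ) : ℂ) + ((s - s ^ 3 / 3 - w * s : ℝ) : ℂ) * Complex.I := by
    push_cast
    linear_combination (s ^ 2 + Complex.I * s ^ 3 / 3 : ℂ) * Complex.I_sq
  have h2 : ‖Complex.exp ((1 + Complex.I * (s : ℂ)) ^ 3 / 3 - (w : ℂ) * (1 + Complex.I * (s : ℂ)))‖ =
      Real.exp (1 / 3 - s ^ 2 - w) := by
    rw [h1, Complex.norm_exp]
    rw [Complex.add_re, Complex.ofReal_re, Complex.re_ofReal_mul, Complex.I_re, mul_zero, add_zero]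
  have h3 : ‖-(1 + Complex.I * (s : ℂ))‖ ≤ Real.exp |s| := by
    rw [norm_neg]
    refine (norm_add_le _ _).trans ?_
    have := Real.add_one_le_exp |s|
    simp only [norm_one, norm_mul, Complex.norm_I, Complex.norm_real, Real.norm_eq_abs]
    linarith
  have h4 : ‖-(1 + Complex.I * (s : ℂ))‖ ^ m ≤ Real.exp ((m : ℝ) ^ 2 / 2 + s ^ 2 / 2) := by
    refine (pow_le_pow_left₀ (norm_nonneg _) h3 m).trans ?_
    rw [← Real.exp_nat_mul]
    refine Real.exp_le_exp.2 ?_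
    nlinarith [sq_nonneg ((m : ℝ) - |s|), sq_abs s]
  rw [airyKer, norm_mul, norm_pow, h2]
  refine (mul_le_mul_of_nonneg_right h4 (Real.exp_pos _).le).trans ?_
  rw [← Real.exp_add, ← Real.exp_add]
  exact Real.exp_le_exp.2 (by linarith)

lemma continuous_airyKer (m : ℕ) (w : ℝ) : Continuous (airyKer m w) := by
  unfold airyKer
  fun_prop

lemma integrable_gaussian_half : Integrable fun s : ℝ => Real.exp (-(1 / 2) * s ^ 2) :=
  integrable_exp_neg_mul_sq (by norm_num)

lemma integrable_airyKer (m : ℕ) (w : ℝ) : Integrable (airyKer m w) :=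
  (integrable_gaussian_half.const_mul _).mono' (continuous_airyKer m w).aestronglyMeasurable
    (Eventually.of_forall fun s => norm_airyKer_le m w s)

lemma hasDerivAt_airyInt (m : ℕ) (w : ℝ) : HasDerivAt (airyInt m) (airyInt (m + 1) w) w := by
  -- On the unit ball around `w` the factor `exp(-u)` is at most `exp(-(w - 1))`.
  refine (hasDerivAt_integral_of_dominated_loc_of_deriv_le (μ := volume) (F := airyKer m)
    (F' := airyKer (m + 1)) (bound := fun s => Real.exp (((m + 1 : ℕ) : ℝ) ^ 2 / 2 + 1 / 3 - (w - 1)) *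
      Real.exp (-(1 / 2) * s ^ 2)) (Metric.ball_mem_nhds w one_pos)
    (Eventually.of_forall fun u => (continuous_airyKer m u).aestronglyMeasurable)
    (integrable_airyKer m w) (continuous_airyKer (m + 1) w).aestronglyMeasurable
    (Eventually.of_forall fun s u hu => ?_) (integrable_gaussian_half.const_mul _)
    (Eventually.of_forall fun s u _ => ?_)).2
  · refine (norm_airyKer_le (m + 1) u s).trans (mul_le_mul_of_nonneg_right ?_ (Real.exp_pos _).le)
    refine Real.exp_le_exp.2 ?_
    have := (abs_lt.1 (Metric.mem_ball.1 hu)).1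
    linarith
  · have h1 : HasDerivAt (fun u : ℝ => (1 + Complex.I * (s : ℂ)) ^ 3 / 3 -
        (u : ℂ) * (1 + Complex.I * (s : ℂ))) (-(1 * (1 + Complex.I * (s : ℂ)))) u :=
      ((Complex.ofRealCLM.hasDerivAt (x := u)).mul_const _).const_sub _
    have h2 := h1.cexp.const_mul ((-(1 + Complex.I * (s : ℂ))) ^ m)
    convert! h2 using 1
    rw [airyKer, pow_succ]
    ring

/-- The integral over the line of the total derivative of the integrand vanishes. -/
lemma airyInt_two (w : ℝ) : airyInt 2 w = w * airyInt 0 w := by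
  have hd : ∀ s : ℝ, HasDerivAt (airyKer 0 w)
      (Complex.I * (airyKer 2 w s - w * airyKer 0 w s)) s := by
    intro s
    have h1 : HasDerivAt (fun s : ℝ => 1 + Complex.I * (s : ℂ)) (Complex.I * 1) s :=
      ((Complex.ofRealCLM.hasDerivAt (x := s)).const_mul Complex.I).const_add 1
    have h2 := (((h1.pow 3).div_const 3).sub (h1.const_mul (w : ℂ))).cexp
    have h3 : airyKer 0 w = fun s : ℝ => Complex.exp ((1 + Complex.I * (s : ℂ)) ^ 3 / 3 -
        (w : ℂ) * (1 + Complex.I * (s : ℂ))) := by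
      funext s; simp [airyKer]
    rw [h3]
    convert! h2 using 1
    simp only [airyKer]
    norm_num
    ring
  have hi : Integrable fun s => Complex.I * (airyKer 2 w s - w * airyKer 0 w s) :=
    ((integrable_airyKer 2 w).sub ((integrable_airyKer 0 w).const_mul _)).const_mul _
  have h := integral_eq_zero_of_hasDerivAt_of_integrable hd hi (integrable_airyKer 0 w)
  rw [integral_const_mul, integral_sub (integrable_airyKer 2 w)
    ((integrable_airyKer 0 w).const_mul _), integral_const_mul] at h
  exact sub_eq_zero.1 ((mul_eq_zero.1 h).resolve_left Complex.I_ne_zero)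

lemma airyInt_add_three (m : ℕ) (w : ℝ) :
    airyInt (m + 3) w = w * airyInt (m + 1) w + (m + 1) * airyInt m w := by
  have hof : ∀ w : ℝ, HasDerivAt (fun u : ℝ => (u : ℂ)) 1 w := fun w =>
    Complex.ofRealCLM.hasDerivAt
  induction m generalizing w with
  | zero =>
    have h1 := hasDerivAt_airyInt 2 w
    have h2 := (hof w).mul (hasDerivAt_airyInt 0 w)
    rw [show airyInt 2 = (fun u : ℝ => (u : ℂ)) * airyInt 0 from funext airyInt_two] at h1
    rw [h1.unique h2]
    push_cast
    ring
  | succ m ih =>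
    have h1 := hasDerivAt_airyInt (m + 3) w
    have h2 := ((hof w).mul (hasDerivAt_airyInt (m + 1) w)).add
      ((hasDerivAt_airyInt m w).const_mul ((m : ℂ) + 1))
    rw [show airyInt (m + 3) = _ from funext ih] at h1
    rw [show m + 1 + 3 = m + 3 + 1 by ring, HasDerivAt.unique h1 h2]
    push_cast
    ring

/-- Complex conjugation of the kernel is the reflection `s ↦ -s` of the contour. -/
lemma conj_airyInt (m : ℕ) (w : ℝ) : (starRingEnd ℂ) (airyInt m w) = airyInt m w := by
  rw [airyInt, ← integral_conj, ← integral_neg_eq_self]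
  congr 1
  funext s
  simp only [airyKer, map_mul, map_pow, map_neg, map_add, map_one, ← Complex.exp_conj, map_sub,
    map_div₀, Complex.conj_I, Complex.conj_ofReal, Complex.ofReal_neg, map_ofNat]
  ring_nf

/-- The real-valued `m`-th derivative of `2 π Ai`. -/
def airyReal (m : ℕ) (w : ℝ) : ℝ := (airyInt m w).re

lemma ofReal_airyReal (m : ℕ) (w : ℝ) : (airyReal m w : ℂ) = airyInt m w :=
  Complex.conj_eq_iff_re.1 (conj_airyInt m w)

lemma hasDerivAt_airyReal (m : ℕ) (w : ℝ) : HasDerivAt (airyReal m) (airyReal (m + 1) w) w :=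
  Complex.reCLM.hasFDerivAt.comp_hasDerivAt w (hasDerivAt_airyInt m w)

lemma airyReal_two (w : ℝ) : airyReal 2 w = w * airyReal 0 w := by
  have := airyInt_two w
  rw [← ofReal_airyReal, ← ofReal_airyReal] at this
  exact_mod_cast this

lemma airyReal_add_three (m : ℕ) (w : ℝ) :
    airyReal (m + 3) w = w * airyReal (m + 1) w + (m + 1) * airyReal m w := by
  have := airyInt_add_three m w
  rw [← ofReal_airyReal, ← ofReal_airyReal, ← ofReal_airyReal] at this
  exact_mod_cast this

lemma exists_abs_airyReal_le (m : ℕ) : ∃ K, ∀ w, |airyReal m w| ≤ K * Real.exp (-w) := by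
  refine ⟨Real.exp ((m : ℝ) ^ 2 / 2 + 1 / 3) * ∫ s : ℝ, Real.exp (-(1 / 2) * s ^ 2), fun w => ?_⟩
  refine (Complex.abs_re_le_norm _).trans ?_
  refine (norm_integral_le_of_norm_le (integrable_gaussian_half.const_mul
    (Real.exp ((m : ℝ) ^ 2 / 2 + 1 / 3 - w))) (Eventually.of_forall fun s =>
      norm_airyKer_le m w s)).trans ?_
  rw [integral_const_mul, sub_eq_add_neg, Real.exp_add _ (-w)]
  apply le_of_eq
  ring

/-- Up to an exponential factor the Airy function is the Fourier transform of a continuous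
integrable function without zeros, so Fourier inversion excludes that it vanishes identically. -/
lemma exists_airyReal_ne_zero : ∃ w, airyReal 0 w ≠ 0 := by
  by_contra! h
  set g : ℝ → ℂ := fun s => Complex.exp ((1 + Complex.I * (s : ℂ)) ^ 3 / 3) with hg
  have hg0 : g = airyKer 0 0 := by
    funext s; simp [hg, airyKer]
  have hF : FourierTransform.fourier g = 0 := by
    funext v
    have h1 : airyInt 0 (2 * Real.pi * v) = 0 := by
      rw [← ofReal_airyReal, h, Complex.ofReal_zero]
    have h2 : airyInt 0 (2 * Real.pi * v) =
        Complex.exp (-(2 * Real.pi * v)) * FourierTransform.fourier g v := by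
      rw [Real.fourier_eq', ← integral_const_mul, airyInt]
      congr 1
      funext s
      simp only [airyKer, pow_zero, one_mul, hg, smul_eq_mul, ← Complex.exp_add]
      congr 1
      simp only [RCLike.inner_apply, conj_trivial]
      push_cast
      ring
    rw [h1] at h2
    exact (mul_eq_zero.1 h2.symm).resolve_left (Complex.exp_ne_zero _)
  have hc : Continuous g := hg0 ▸ continuous_airyKer 0 0
  have hi : Integrable g := hg0 ▸ integrable_airyKer 0 0
  have h3 := hc.fourierInv_fourier_eq hi (by rw [hF]; exact integrable_zero _ _ _)
  rw [hF] at h3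
  have h4 := congrFun h3 0
  simp only [Real.fourierInv_eq', Pi.zero_apply, smul_zero, integral_zero] at h4
  exact Complex.exp_ne_zero _ h4.symm

end AiryFunction

/-! ### Asymptotics of the Airy function and its derivatives -/

section AiryAsymptotics

open Filter Topology

lemma antitoneOn_of_hasDerivAt {h h' : ℝ → ℝ} {D : Set ℝ} (hD : Convex ℝ D)
    (hd : ∀ w ∈ D, HasDerivAt h (h' w) w) (h0 : ∀ w ∈ D, h' w ≤ 0) : AntitoneOn h D :=
  antitoneOn_of_hasDerivWithinAt_nonpos hD (fun w hw => (hd w hw).continuousAt.continuousWithinAt)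
    (fun w hw => (hd w (interior_subset hw)).hasDerivWithinAt) fun w hw => h0 w (interior_subset hw)

lemma nonneg_of_hasDerivAt_nonpos {h h' : ℝ → ℝ} {a : ℝ}
    (hd : ∀ w, a ≤ w → HasDerivAt h (h' w) w) (h0 : ∀ w, a ≤ w → h' w ≤ 0)
    (hl : Tendsto h atTop (𝓝 0)) {w : ℝ} (hw : a ≤ w) : 0 ≤ h w := by
  have hm : AntitoneOn h (Set.Ici a) := antitoneOn_of_hasDerivAt (convex_Ici a) hd h0
  refine le_of_tendsto hl ?_
  filter_upwards [eventually_ge_atTop w] with u hu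
  exact hm hw (hw.trans hu) hu

lemma tendsto_airyReal (m : ℕ) : Tendsto (airyReal m) atTop (𝓝 0) := by
  obtain ⟨K, hK⟩ := exists_abs_airyReal_le m
  refine squeeze_zero_norm hK ?_
  simpa using (Real.tendsto_exp_neg_atTop_nhds_zero).const_mul K

/-- The derivative of `Ai Ai'` is `Ai'² + w Ai² ≥ 0`, and `Ai Ai'` tends to zero at infinity. -/
lemma airyReal_mul_one_nonpos {w : ℝ} (hw : 0 ≤ w) : airyReal 0 w * airyReal 1 w ≤ 0 := by
  have h := nonneg_of_hasDerivAt_nonpos (h := fun w => -(airyReal 0 w * airyReal 1 w))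
    (h' := fun w => -(airyReal 1 w * airyReal 1 w + airyReal 0 w * airyReal 2 w))
    (fun w _ => ((hasDerivAt_airyReal 0 w).mul (hasDerivAt_airyReal 1 w)).neg)
    (fun w hw => ?_) (by simpa using ((tendsto_airyReal 0).mul (tendsto_airyReal 1)).neg) hw
  · linarith
  · rw [airyReal_two]
    nlinarith [mul_self_nonneg (airyReal 1 w), mul_nonneg hw (mul_self_nonneg (airyReal 0 w))]

/-- `Ai²` is nonincreasing on the half-line, so a zero would force `Ai` to vanish from there on;
uniqueness for the differential equation, run backwards, would make it vanish everywhere. -/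
lemma airyReal_ne_zero {w : ℝ} (hw : 0 ≤ w) : airyReal 0 w ≠ 0 := by
  intro h0
  have hanti : AntitoneOn (fun w => airyReal 0 w * airyReal 0 w) (Set.Ici 0) :=
    antitoneOn_of_hasDerivAt (convex_Ici 0)
      (fun w _ => (hasDerivAt_airyReal 0 w).mul (hasDerivAt_airyReal 0 w)) fun w hw => by
        have := airyReal_mul_one_nonpos hw
        simp only [zero_add]
        linarith
  have hge : ∀ u, w ≤ u → airyReal 0 u = 0 := fun u hu => by
    have h1 := hanti hw (hw.trans hu) hu
    simp only [h0, mul_zero] at h1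
    exact mul_self_eq_zero.1 (le_antisymm h1 (mul_self_nonneg _))
  have h1 : airyReal 1 (w + 1) = 0 := by
    refine (hasDerivAt_airyReal 0 (w + 1)).unique ?_
    refine (hasDerivAt_const (w + 1) (0 : ℝ)).congr_of_eventuallyEq ?_
    filter_upwards [eventually_ge_nhds (lt_add_one w)] with u hu using hge u hu
  have h2 := hge (w + 1) (by linarith)
  obtain ⟨u, hu⟩ := exists_airyReal_ne_zero
  apply hu
  rcases le_total w u with h | h
  · exact hge u h
  -- `C` bounds `|1 + v|` between `u` and `w + 1`. As `f' = 2(1 + v) Ai Ai'` is at least `-C f`, the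
  -- function `exp(Cv) f` is nondecreasing, and it vanishes at `w + 1`.
  set C : ℝ := 1 + |u| + |w + 1|
  set f : ℝ → ℝ := fun v => airyReal 0 v * airyReal 0 v + airyReal 1 v * airyReal 1 v
  have hm : AntitoneOn (fun v => -(Real.exp (C * v) * f v)) (Set.Icc u (w + 1)) := by
    refine antitoneOn_of_hasDerivAt (convex_Icc _ _) (fun v _ =>
      ((((hasDerivAt_id v).const_mul C).exp).mul
        (((hasDerivAt_airyReal 0 v).mul (hasDerivAt_airyReal 0 v)).add
          ((hasDerivAt_airyReal 1 v).mul (hasDerivAt_airyReal 1 v)))).neg) fun v hv => ?_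
    have hC : |1 + v| ≤ C := by
      rw [abs_le]
      have := neg_abs_le u
      have := le_abs_self (w + 1)
      have := abs_nonneg u
      have := abs_nonneg (w + 1)
      constructor <;> linarith [hv.1, hv.2]
    have hb : 0 ≤ C * f v + 2 * (1 + v) * (airyReal 0 v * airyReal 1 v) := by
      have h3 : |2 * (airyReal 0 v * airyReal 1 v)| ≤ f v := by
        simp only [f]
        rw [abs_le]
        constructor <;> nlinarith [sq_nonneg (airyReal 0 v + airyReal 1 v),
          sq_nonneg (airyReal 0 v - airyReal 1 v)]
      have h4 : |(1 + v) * (2 * (airyReal 0 v * airyReal 1 v))| ≤ C * f v := by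
        rw [abs_mul]
        exact mul_le_mul hC h3 (abs_nonneg _) ((abs_nonneg _).trans hC)
      have h5 := (abs_le.1 h4).1
      linarith
    have h6 := mul_nonneg (Real.exp_pos (C * v)).le hb
    simp only [zero_add, id, Nat.reduceAdd, airyReal_two, f, Pi.add_apply, Pi.mul_apply] at h6 ⊢
    linarith
  have h3 := hm (Set.left_mem_Icc.2 (by linarith)) (Set.right_mem_Icc.2 (by linarith))
    (by linarith)
  have h4 : f (w + 1) = 0 := by simp [f, h1, h2]
  simp only [h4, mul_zero, neg_zero, Left.nonneg_neg_iff] at h3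
  have h5 : f u ≤ 0 := by
    by_contra! h
    have := mul_pos (Real.exp_pos (C * u)) h
    linarith
  simp only [f] at h5
  nlinarith [mul_self_nonneg (airyReal 0 u), mul_self_nonneg (airyReal 1 u)]

/-- `Ai'² - w Ai²` has derivative `-Ai²` and tends to zero. -/
lemma mul_sq_airyReal_le {w : ℝ} (hw : 0 ≤ w) :
    w * airyReal 0 w ^ 2 ≤ airyReal 1 w ^ 2 := by
  have h := nonneg_of_hasDerivAt_nonpos (a := 0)
    (h := fun w => airyReal 1 w * airyReal 1 w - airyReal 2 w * airyReal 0 w)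
    (fun w _ => ((hasDerivAt_airyReal 1 w).mul (hasDerivAt_airyReal 1 w)).sub
      ((hasDerivAt_airyReal 2 w).mul (hasDerivAt_airyReal 0 w)))
    (fun w hw => ?_) (by simpa using (((tendsto_airyReal 1).mul (tendsto_airyReal 1)).sub
      ((tendsto_airyReal 2).mul (tendsto_airyReal 0)))) hw
  · simp only [airyReal_two] at h
    linarith
  · rw [show (2 + 1 : ℕ) = 0 + 3 from rfl, airyReal_add_three]
    norm_num [airyReal_two]
    nlinarith [mul_self_nonneg (airyReal 0 w)]

/-- `w Ai² - Ai'² + Ai²/2` tends to zero and has derivative `Ai² + Ai Ai'`, which is nonpositive for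
`w ≥ 1` because there `Ai² ≤ Ai'²` and `Ai Ai' ≤ 0`. -/
lemma sq_airyReal_one_le {w : ℝ} (hw : 1 ≤ w) :
    airyReal 1 w ^ 2 ≤ (w + 1 / 2) * airyReal 0 w ^ 2 := by
  have h := nonneg_of_hasDerivAt_nonpos (a := 1)
    (h := fun w => airyReal 2 w * airyReal 0 w - airyReal 1 w * airyReal 1 w +
      airyReal 0 w * airyReal 0 w / 2)
    (fun w _ => (((hasDerivAt_airyReal 2 w).mul (hasDerivAt_airyReal 0 w)).sub
      ((hasDerivAt_airyReal 1 w).mul (hasDerivAt_airyReal 1 w))).add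
        (((hasDerivAt_airyReal 0 w).mul (hasDerivAt_airyReal 0 w)).div_const 2))
    (fun w hw => ?_) (by simpa using ((((tendsto_airyReal 2).mul (tendsto_airyReal 0)).sub
      ((tendsto_airyReal 1).mul (tendsto_airyReal 1))).add
        (((tendsto_airyReal 0).mul (tendsto_airyReal 0)).div_const 2))) hw
  · simp only [airyReal_two] at h
    linarith
  · rw [show (2 + 1 : ℕ) = 0 + 3 from rfl, airyReal_add_three]
    norm_num [airyReal_two]
    have h1 := airyReal_mul_one_nonpos (zero_le_one.trans hw)
    have h2 := mul_sq_airyReal_le (zero_le_one.trans hw)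
    have h3 : airyReal 0 w ^ 2 ≤ airyReal 1 w ^ 2 := by nlinarith [sq_nonneg (airyReal 0 w)]
    have h4 : airyReal 0 w ^ 2 * airyReal 0 w ^ 2 ≤ (-(airyReal 0 w * airyReal 1 w)) ^ 2 := by
      nlinarith [sq_nonneg (airyReal 0 w)]
    have h5 : airyReal 0 w ^ 2 ≤ -(airyReal 0 w * airyReal 1 w) :=
      abs_le_of_sq_le_sq' (by nlinarith) (by linarith) |>.2
    nlinarith

/-- For `m = 1` the two bounds on `Ai'²` give the square and `Ai Ai' ≤ 0` the sign. In the
recurrence for `m + 3` the term `(m + 1) Ai⁽ᵐ⁾` is smaller by a factor of order `w^(-3/2)`. -/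
lemma tendsto_airyReal_div (m : ℕ) :
    Tendsto (fun w => airyReal m w / (airyReal 0 w * (-√w) ^ m)) atTop (𝓝 1) := by
  induction m using Nat.strong_induction_on with
  | _ m ih =>
  match m, ih with
  | 0, _ =>
    refine tendsto_const_nhds.congr' ?_
    filter_upwards [eventually_ge_atTop 0] with w hw
    rw [pow_zero, mul_one, div_self (airyReal_ne_zero hw)]
  | 1, _ =>
    have h1 : Tendsto (fun w => airyReal 1 w ^ 2 / (airyReal 0 w ^ 2 * w)) atTop (𝓝 1) := by
      have h2 : Tendsto (fun w : ℝ => 1 + (1 / 2) * w⁻¹) atTop (𝓝 1) := by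
        simpa using (tendsto_inv_atTop_zero.const_mul (1 / 2 : ℝ)).const_add 1
      refine tendsto_of_tendsto_of_tendsto_of_le_of_le' tendsto_const_nhds h2 ?_ ?_
      · filter_upwards [eventually_ge_atTop 1] with w hw
        have h3 := airyReal_ne_zero (zero_le_one.trans hw)
        rw [le_div_iff₀ (by positivity)]
        linarith [mul_sq_airyReal_le (zero_le_one.trans hw)]
      · filter_upwards [eventually_ge_atTop 1] with w hw
        have h3 := airyReal_ne_zero (zero_le_one.trans hw)
        rw [div_le_iff₀ (by positivity)]
        refine (sq_airyReal_one_le hw).trans (le_of_eq ?_)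
        field_simp
    have h4 := h1.sqrt
    rw [Real.sqrt_one] at h4
    refine h4.congr' ?_
    filter_upwards [eventually_ge_atTop 1] with w hw
    have h5 := airyReal_mul_one_nonpos (zero_le_one.trans hw)
    have h3 := airyReal_ne_zero (zero_le_one.trans hw)
    have h6 : 0 < √w := Real.sqrt_pos.2 (by linarith)
    rw [Real.sqrt_eq_iff_mul_self_eq (by positivity)]
    · have h7 : √w ^ 2 = w := Real.sq_sqrt (by linarith)
      field_simp
      linear_combination airyReal 1 w ^ 2 * h7
    · have : airyReal 1 w / (airyReal 0 w * (-√w) ^ 1) =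
          -(airyReal 0 w * airyReal 1 w) / (airyReal 0 w ^ 2 * √w) := by
        field_simp
      rw [this]
      exact div_nonneg (by linarith) (by positivity)
  | 2, _ =>
    refine tendsto_const_nhds.congr' ?_
    filter_upwards [eventually_ge_atTop 1] with w hw
    have h3 := airyReal_ne_zero (zero_le_one.trans hw)
    rw [neg_sq, Real.sq_sqrt (by linarith), airyReal_two, mul_comm, div_self]
    exact mul_ne_zero h3 (by positivity)
  | m + 3, ih =>
    have h1 := ih (m + 1) (by omega)
    have h2 := ih m (by omega)
    have h3 : Tendsto (fun w : ℝ => (√w)⁻¹) atTop (𝓝 0) :=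
      tendsto_inv_atTop_zero.comp Real.tendsto_sqrt_atTop
    have h4 := h1.add (h2.mul ((h3.pow 3).const_mul (-((m : ℝ) + 1))))
    have h5 : (1 : ℝ) + 1 * (-((m : ℝ) + 1) * 0 ^ 3) = 1 := by ring
    rw [h5] at h4
    refine h4.congr' ?_
    filter_upwards [eventually_ge_atTop 1] with w hw
    have h3 := airyReal_ne_zero (zero_le_one.trans hw)
    have h6 : √w ≠ 0 := (Real.sqrt_pos.2 (by linarith)).ne'
    have h7 : w = √w ^ 2 := (Real.sq_sqrt (by linarith)).symm
    have h8 : airyReal (m + 3) w = √w ^ 2 * airyReal (m + 1) w + (m + 1) * airyReal m w := by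
      rw [← h7, airyReal_add_three]
    rw [h8]
    generalize √w = r at *
    have h9 : -r ≠ 0 := neg_ne_zero.2 h6
    rw [pow_add (-r) m 3, pow_succ (-r) m]
    field_simp
    ring

/-- The asymptotics of the derivatives of the Airy function along `s ↦ s² ζ² + z`. -/
lemma tendsto_airyReal_along (m : ℕ) {ζ : ℝ} (hζ : ζ < 0) (z : ℝ) :
    Tendsto (fun s : ℝ => airyReal m (s ^ 2 * ζ ^ 2 + z) /
      (airyReal 0 (s ^ 2 * ζ ^ 2 + z) * s ^ m)) atTop (𝓝 (ζ ^ m)) := by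
  have h1 : Tendsto (fun s : ℝ => s ^ 2 * ζ ^ 2 + z) atTop atTop :=
    tendsto_atTop_add_const_right _ _
      ((tendsto_pow_atTop two_ne_zero).atTop_mul_const (sq_pos_of_neg hζ))
  -- The limit is `-|ζ|`, which is `ζ` because `ζ` is negative.
  have h2 : Tendsto (fun s : ℝ => -√(s ^ 2 * ζ ^ 2 + z) / s) atTop (𝓝 ζ) := by
    have h3 : Tendsto (fun s : ℝ => ζ ^ 2 + z * (s⁻¹) ^ 2) atTop (𝓝 (ζ ^ 2)) := by
      simpa using ((tendsto_inv_atTop_zero.pow 2).const_mul z).const_add (ζ ^ 2)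
    have h4 := h3.sqrt.neg
    rw [Real.sqrt_sq_eq_abs, abs_of_neg hζ, neg_neg] at h4
    refine h4.congr' ?_
    filter_upwards [eventually_gt_atTop 0] with s hs
    rw [show s ^ 2 * ζ ^ 2 + z = s ^ 2 * (ζ ^ 2 + z * (s⁻¹) ^ 2) by field_simp,
      Real.sqrt_mul (by positivity), Real.sqrt_sq hs.le]
    field_simp
  have h5 := ((tendsto_airyReal_div m).comp h1).mul (h2.pow m)
  rw [one_mul] at h5
  refine h5.congr' ?_
  filter_upwards [eventually_gt_atTop 0, h1.eventually_ge_atTop 1] with s hs hw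
  have h6 : √(s ^ 2 * ζ ^ 2 + z) ≠ 0 := (Real.sqrt_pos.2 (by linarith)).ne'
  have h7 := airyReal_ne_zero (zero_le_one.trans hw)
  simp only [Function.comp_apply, div_pow]
  have h8 : (-√(s ^ 2 * ζ ^ 2 + z)) ^ m ≠ 0 := pow_ne_zero _ (neg_ne_zero.2 h6)
  field_simp

end AiryAsymptotics

section

variable {n : ℕ}

/-! ### Products of Airy functions and their leading asymptotics -/

section AiryProduct

open Filter Topology

lemma contDiff_airyInt (m : ℕ) : ContDiff ℝ (⊤ : ℕ∞) (airyInt m) := by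
  refine contDiff_infty.2 fun k => ?_
  induction k generalizing m with
  | zero =>
    exact contDiff_zero.2 (continuous_iff_continuousAt.2 fun w =>
      (hasDerivAt_airyInt m w).continuousAt)
  | succ k ih =>
    push_cast
    refine contDiff_succ_iff_deriv.2 ⟨fun w => (hasDerivAt_airyInt m w).differentiableAt,
      by simp, ?_⟩
    rw [show deriv (airyInt m) = airyInt (m + 1) from funext fun w => (hasDerivAt_airyInt m w).deriv]
    exact ih (m + 1)

/-- The derivative of `σ(·, z)` with respect to the multi-index `β`. -/
def airyMono (β : Fin n →₀ ℕ) (z x : Fin n → ℝ) : ℂ :=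
  ((2 * (Real.pi : ℂ))⁻¹) ^ n * ∏ i, airyInt (β i) (x i + z i)

lemma airyAi_add (a b : ℝ) : airyAi ((a : ℂ) + (b : ℂ)) = (2 * (Real.pi : ℂ))⁻¹ * airyInt 0 (a + b) := by
  simp [airyAi, airyInt, airyKer]

lemma airyProd_eq (x z : Fin n → ℝ) : airyProd x z = airyMono 0 z x := by
  simp [airyProd, airyMono, airyAi_add, Finset.prod_mul_distrib]

lemma contDiff_airyMono (β : Fin n →₀ ℕ) (z : Fin n → ℝ) :
    ContDiff ℝ (⊤ : ℕ∞) (airyMono β z) := by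
  refine contDiff_const.mul (contDiff_prod fun i _ => (contDiff_airyInt (β i)).comp ?_)
  fun_prop

lemma pd_airyMono (j : Fin n) (β : Fin n →₀ ℕ) (z x : Fin n → ℝ) :
    pd j (airyMono β z) x = airyMono (β + Finsupp.single j 1) z x := by
  have h1 : ∀ i, HasFDerivAt (fun x : Fin n → ℝ => airyInt (β i) (x i + z i))
      ((ContinuousLinearMap.proj (R := ℝ) (φ := fun _ : Fin n => ℝ) i).smulRight
        (airyInt (β i + 1) (x i + z i))) x := fun i => by
    have h := (hasDerivAt_airyInt (β i) (x i + z i)).hasFDerivAt.comp x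
      ((hasFDerivAt_apply (𝕜 := ℝ) i x).add_const (z i))
    convert! h using 1
  have h2 := (HasFDerivAt.finsetProd (u := Finset.univ) fun i _ => h1 i).const_mul
    (((2 * (Real.pi : ℂ))⁻¹) ^ n)
  rw [pd, HasFDerivAt.fderiv (show HasFDerivAt (airyMono β z) _ x from h2), airyMono]
  simp only [smul_apply, sum_apply, smul_eq_mul,
    ContinuousLinearMap.smulRight_apply, ContinuousLinearMap.proj_apply]
  congr 1
  rw [Finset.sum_eq_single j (fun i _ hi => by simp [Pi.single_eq_of_ne hi]) (by simp),
    ← Finset.prod_erase_mul _ _ (Finset.mem_univ j)]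
  congr 1
  · refine Finset.prod_congr rfl fun i hi => ?_
    simp [Finsupp.single_eq_of_ne (Finset.ne_of_mem_erase hi)]
  · simp

/-- The function `σ(·, z)` as an element of `smoothFun`. -/
def airyFun (z : Fin n → ℝ) : smoothFun n :=
  ⟨fun x => airyProd x z, by
    rw [show (fun x => airyProd x z) = airyMono 0 z from funext fun x => airyProd_eq x z]
    exact contDiff_airyMono 0 z⟩

lemma coe_airyFun (z : Fin n → ℝ) : (airyFun z : (Fin n → ℝ) → ℂ) = fun x => airyProd x z := rfl

lemma opAt_airyFun_monomial (β : Fin n →₀ ℕ) (z x : Fin n → ℝ) :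
    opAt (airyFun z) x (monomial β 1) = airyMono β z x := by
  induction h : β.degree generalizing β x with
  | zero =>
    rw [(Finsupp.degree_eq_zero_iff β).1 h, monomial_zero', C_1, opAt_one, coe_airyFun]
    exact airyProd_eq x z
  | succ d ih =>
    have h0 : β ≠ 0 := by rintro rfl; simp at h
    obtain ⟨j, hj⟩ := Finsupp.ne_iff.1 h0
    have hβ : β = (β - Finsupp.single j 1) + Finsupp.single j 1 := by
      ext i
      simp only [Finsupp.coe_add, Finsupp.coe_tsub, Pi.add_apply, Pi.sub_apply]
      rcases eq_or_ne i j with rfl | hij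
      · simp only [Finsupp.single_eq_same, Finsupp.coe_zero, Pi.zero_apply] at hj ⊢
        omega
      · simp [Finsupp.single_eq_of_ne hij]
    have hd : (β - Finsupp.single j 1).degree = d := by
      have := congrArg Finsupp.degree hβ
      rw [map_add, Finsupp.degree_single, h] at this
      omega
    rw [hβ, ← pd_airyMono, ← mul_one (1 : ℂ), ← monomial_mul, mul_comm, ← X, ← pd_opAt]
    congr 1
    funext y
    exact ih _ y hd

lemma opAt_airyFun (q : MvPolynomial (Fin n) ℂ) (z x : Fin n → ℝ) (S : Finset (Fin n →₀ ℕ))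
    (hS : q.support ⊆ S) :
    opAt (airyFun z) x q = ∑ β ∈ S, coeff β q * airyMono β z x := by
  conv_lhs => rw [q.as_sum]
  rw [map_sum]
  refine (Finset.sum_congr rfl fun β _ => ?_).trans
    (Finset.sum_subset hS fun β _ h => by rw [notMem_support_iff.1 h, zero_mul])
  rw [← opAt_airyFun_monomial, ← opAt_C_mul, C_mul_monomial, mul_one]

/-- `σ` depends on `x + z` only, so derivatives in `x` and in `z` agree. -/
lemma opAt_airyFun_swap (q : MvPolynomial (Fin n) ℂ) (z x : Fin n → ℝ) :
    opAt (airyFun z) x q = opAt (airyFun x) z q := by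
  rw [opAt_airyFun q z x _ subset_rfl, opAt_airyFun q x z _ subset_rfl]
  simp only [airyMono, add_comm]

lemma lap_airyFun (z : Fin n → ℝ) :
    lap (airyFun z : (Fin n → ℝ) → ℂ) =
      fun x => (∑ i, ((x i : ℂ) + (z i : ℂ))) * airyProd x z := by
  funext x
  rw [lap_eq, ← opAt_apply, map_sum, Finset.sum_mul]
  refine Finset.sum_congr rfl fun i _ => ?_
  rw [X_pow_eq_monomial, opAt_airyFun_monomial, airyProd_eq, airyMono, airyMono,
    ← Finset.mul_prod_erase _ _ (Finset.mem_univ i), ← Finset.mul_prod_erase _ _ (Finset.mem_univ i),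
    Finsupp.single_eq_same, airyInt_two, Finset.prod_congr rfl fun j hj => by
      rw [Finsupp.single_eq_of_ne (Finset.ne_of_mem_erase hj)]]
  simp only [Finsupp.coe_zero, Pi.zero_apply]
  push_cast
  ring

/-- The curve `s ↦ s² ζ²`, along which the asymptotics of `σ` is governed by `ζ`. -/
def squareRay (ζ : Fin n → ℝ) (s : ℝ) : Fin n → ℝ := fun i => s ^ 2 * ζ i ^ 2

lemma airyMono_zero_ne_zero {ζ : Fin n → ℝ} (hζ : ∀ i, ζ i < 0) (z : Fin n → ℝ) :
    ∀ᶠ s in atTop, airyMono 0 z (squareRay ζ s) ≠ 0 := by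
  have h1 : ∀ i, ∀ᶠ s : ℝ in atTop, 0 ≤ s ^ 2 * ζ i ^ 2 + z i := fun i =>
    (tendsto_atTop_add_const_right _ _ ((tendsto_pow_atTop two_ne_zero).atTop_mul_const
      (sq_pos_of_neg (hζ i)))).eventually_ge_atTop 0
  filter_upwards [eventually_all.2 h1] with s hs
  refine mul_ne_zero (by simp [Real.pi_ne_zero]) (Finset.prod_ne_zero_iff.2 fun i _ => ?_)
  rw [← ofReal_airyReal]
  exact_mod_cast airyReal_ne_zero (hs i)

lemma tendsto_airyMono_div {ζ : Fin n → ℝ} (hζ : ∀ i, ζ i < 0) (z : Fin n → ℝ) (β : Fin n →₀ ℕ) :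
    Tendsto (fun s : ℝ => airyMono β z (squareRay ζ s) /
      (airyMono 0 z (squareRay ζ s) * (s : ℂ) ^ β.degree)) atTop (𝓝 (∏ i, (ζ i : ℂ) ^ β i)) := by
  have h := tendsto_finsetProd Finset.univ fun i (_ : i ∈ Finset.univ) =>
    (Complex.continuous_ofReal.tendsto _).comp (tendsto_airyReal_along (β i) (hζ i) (z i))
  simp only [Complex.ofReal_pow] at h
  refine h.congr fun s => ?_
  have hc : ((2 * (Real.pi : ℂ))⁻¹) ^ n ≠ 0 := by simp [Real.pi_ne_zero]
  rw [airyMono, airyMono, mul_assoc, mul_div_mul_left _ _ hc, Finsupp.degree_eq_sum,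
    ← Finset.prod_pow_eq_pow_sum, ← Finset.prod_mul_distrib, ← Finset.prod_div_distrib]
  refine Finset.prod_congr rfl fun i _ => ?_
  simp [squareRay, ofReal_airyReal]

lemma eval_homogeneousComponent (ζ : Fin n → ℂ) (j : ℕ) (q : MvPolynomial (Fin n) ℂ) :
    eval ζ (homogeneousComponent j q) =
      ∑ β ∈ Finset.univ.finsuppAntidiag j, coeff β q * ∏ i, ζ i ^ β i := by
  have hmem : ∀ β : Fin n →₀ ℕ, β ∈ Finset.univ.finsuppAntidiag j ↔ β.degree = j := fun β => by
    simp [Finset.mem_finsuppAntidiag, Finsupp.degree_eq_sum]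
  rw [eval_eq']
  rw [Finset.sum_subset (s₁ := (homogeneousComponent j q).support)
    (s₂ := Finset.univ.finsuppAntidiag j) (fun β hβ => ?_)
    (fun β _ h => by rw [notMem_support_iff.1 h, zero_mul])]
  · refine Finset.sum_congr rfl fun β hβ => ?_
    rw [coeff_homogeneousComponent, if_pos ((hmem β).1 hβ)]
  · rw [hmem]
    by_contra h
    rw [mem_support_iff, coeff_homogeneousComponent, if_neg h] at hβ
    exact hβ rfl

/-- The leading asymptotics of `q(∂) σ` along `s ↦ s² ζ²`, with `q` depending on `s`. -/
lemma tendsto_opAt_airyFun {ζ : Fin n → ℝ} (hζ : ∀ i, ζ i < 0) (z : Fin n → ℝ) {j : ℕ}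
    {q : ℝ → MvPolynomial (Fin n) ℂ} {q' : MvPolynomial (Fin n) ℂ}
    (hdeg : ∀ᶠ s in atTop, (q s).totalDegree ≤ j)
    (hlim : ∀ β, Tendsto (fun s => coeff β (q s)) atTop (𝓝 (coeff β q'))) :
    Tendsto (fun s : ℝ => opAt (airyFun z) (squareRay ζ s) (q s) /
      (airyProd (squareRay ζ s) z * (s : ℂ) ^ j)) atTop
      (𝓝 (eval (fun i => (ζ i : ℂ)) (homogeneousComponent j q'))) := by
  set S : Finset (Fin n →₀ ℕ) :=
    (Finset.range (j + 1)).biUnion fun d => Finset.univ.finsuppAntidiag d with hS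
  have hmem : ∀ β, β ∈ S ↔ β.degree ≤ j := fun β => by
    simp [hS, Finset.mem_finsuppAntidiag, Finsupp.degree_eq_sum]
  have hinv : Tendsto (fun s : ℝ => ((s : ℂ))⁻¹) atTop (𝓝 0) := by
    have := (Complex.continuous_ofReal.tendsto _).comp tendsto_inv_atTop_zero
    simpa [Function.comp_def] using this
  -- A monomial of degree below `j` is damped by a negative power of `s`; those of degree `j` give
  -- the value at `ζ`.
  have hterm : ∀ β ∈ S, Tendsto (fun s : ℝ => coeff β (q s) * (airyMono β z (squareRay ζ s) /
      (airyMono 0 z (squareRay ζ s) * (s : ℂ) ^ β.degree)) * ((s : ℂ)⁻¹) ^ (j - β.degree)) atTop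
      (𝓝 (if β.degree = j then coeff β q' * ∏ i, (ζ i : ℂ) ^ β i else 0)) := by
    intro β hβ
    have h := ((hlim β).mul (tendsto_airyMono_div hζ z β)).mul (hinv.pow (j - β.degree))
    convert h using 2
    split_ifs with h1
    · rw [h1, Nat.sub_self, pow_zero, mul_one]
    · rw [zero_pow (by have := (hmem β).1 hβ; omega), mul_zero]
  have hsum := tendsto_finsetSum S hterm
  have hval : ∑ β ∈ S, (if β.degree = j then coeff β q' * ∏ i, (ζ i : ℂ) ^ β i else 0) =
      eval (fun i => (ζ i : ℂ)) (homogeneousComponent j q') := by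
    rw [eval_homogeneousComponent, ← Finset.sum_filter]
    refine Finset.sum_congr ?_ fun _ _ => rfl
    ext β
    rw [Finset.mem_filter, hmem]
    simp only [Finset.mem_finsuppAntidiag, Finset.subset_univ, and_true, Finsupp.degree_eq_sum]
    exact ⟨fun h => h.2, fun h => ⟨h.le, h⟩⟩
  rw [hval] at hsum
  refine hsum.congr' ?_
  filter_upwards [hdeg, eventually_gt_atTop 0, airyMono_zero_ne_zero hζ z] with s hs hs0 hne
  rw [opAt_airyFun (q s) z _ S fun β hβ => (hmem β).2 ?_, Finset.sum_div, airyProd_eq]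
  · refine Finset.sum_congr rfl fun β hβ => ?_
    have hs' : (s : ℂ) ≠ 0 := by exact_mod_cast hs0.ne'
    obtain ⟨d, hd⟩ := Nat.exists_eq_add_of_le ((hmem β).1 hβ)
    rw [hd, Nat.add_sub_cancel_left, pow_add, inv_pow]
    field_simp
  · refine le_trans ?_ hs
    rw [Finsupp.degree_apply]
    exact le_totalDegree hβ

end AiryProduct

end

section

variable {n : ℕ}

/-! ### Evaluation at points off the walls -/

section Separation

/-- The product of `q` with the Vandermonde product is non-zero, so it cannot vanish on a grid with
infinite sides; a point where it is non-zero lies off the walls. -/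
lemma exists_mem_Reg_eval_ne_zero {q : MvPolynomial (Fin n) ℂ} (hq : q ≠ 0) {S : Set ℝ}
    (hS : S.Infinite) :
    ∃ ζ ∈ Reg n, (∀ i, ζ i ∈ S) ∧ eval (fun i => (ζ i : ℂ)) q ≠ 0 := by
  by_contra! h
  have h0 : q * vand n ℂ = 0 := by
    refine funext_set (fun _ => Complex.ofReal '' S)
      (fun _ => hS.image Complex.ofReal_injective.injOn) fun x hx => ?_
    choose ζ hζ hζx using fun i => hx i (Set.mem_univ i)
    obtain rfl : (fun i => (ζ i : ℂ)) = x := funext hζx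
    rw [map_mul, eval_vand, map_zero]
    by_cases hr : ζ ∈ Reg n
    · rw [h ζ hr hζ, zero_mul]
    · obtain ⟨i, j, hij, hne⟩ : ∃ i j, ζ i = ζ j ∧ i ≠ j := by
        simpa [Reg, Function.Injective] using hr
      have h1 : vdm ζ = 0 := by
        rcases lt_or_gt_of_ne hne with hlt | hlt
        · exact Finset.prod_eq_zero (mem_pairs.2 hlt : (i, j) ∈ pairs n) (by simp [hij])
        · exact Finset.prod_eq_zero (mem_pairs.2 hlt : (j, i) ∈ pairs n) (by simp [hij])
      rw [h1, mul_zero]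
  exact (mul_ne_zero hq vand_ne_zero) h0

lemma eq_of_eval_eq_on_Reg {p q : MvPolynomial (Fin n) ℂ}
    (h : ∀ x ∈ Reg n, eval (fun i => (x i : ℂ)) p = eval (fun i => (x i : ℂ)) q) : p = q := by
  by_contra hne
  obtain ⟨x, hx, -, h0⟩ := exists_mem_Reg_eval_ne_zero (sub_ne_zero.2 hne) (Set.infinite_univ (α := ℝ))
  exact h0 (by rw [map_sub, h x hx, sub_self])

/-- On polynomials of bounded degree every linear functional is a combination of evaluations at
points off the walls. -/
lemma span_eval_Reg (n N : ℕ) :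
    Submodule.span ℂ (Set.range fun ζ : Reg n =>
      ((aeval fun i => ((ζ : Fin n → ℝ) i : ℂ)).toLinearMap.domRestrict
        (restrictTotalDegree (Fin n) ℂ N) : Module.Dual ℂ (restrictTotalDegree (Fin n) ℂ N))) = ⊤ := by
  set W := Submodule.span ℂ (Set.range fun ζ : Reg n =>
      ((aeval fun i => ((ζ : Fin n → ℝ) i : ℂ)).toLinearMap.domRestrict
        (restrictTotalDegree (Fin n) ℂ N) : Module.Dual ℂ (restrictTotalDegree (Fin n) ℂ N)))
  rw [← Subspace.dualCoannihilator_dualAnnihilator_eq (W := W)]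
  have h : W.dualCoannihilator = ⊥ := by
    refine (Submodule.eq_bot_iff _).2 fun q hq => ?_
    rw [Submodule.mem_dualCoannihilator] at hq
    refine Subtype.ext (eq_of_eval_eq_on_Reg fun x hx => ?_)
    have := hq _ (Submodule.subset_span ⟨⟨x, hx⟩, rfl⟩)
    simpa [aeval_eq_eval] using this
  rw [h, Submodule.dualAnnihilator_bot]

end Separation

/-! ### Restriction to lines and the Wronskian argument -/

section Lines

/-- The restriction of a polynomial to the line `s ↦ x + s ζ`. -/
def lineHom (x ζ : Fin n → ℂ) : MvPolynomial (Fin n) ℂ →ₐ[ℂ] Polynomial ℂ :=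
  aeval fun i => Polynomial.C (x i) + Polynomial.C (ζ i) * Polynomial.X

lemma coeff_zero_lineHom (x ζ : Fin n → ℂ) (q : MvPolynomial (Fin n) ℂ) :
    (lineHom x ζ q).coeff 0 = eval x q := by
  rw [Polynomial.coeff_zero_eq_eval_zero, ← Polynomial.coe_evalRingHom]
  have h : (Polynomial.evalRingHom 0).comp (lineHom x ζ).toRingHom = eval x := by
    ext i
    · simp [lineHom]
    · simp [lineHom]
  exact congrFun (congrArg DFunLike.coe h) q

lemma derivative_lineHom (x ζ : Fin n → ℂ) (q : MvPolynomial (Fin n) ℂ) :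
    Polynomial.derivative (lineHom x ζ q) = lineHom x ζ (∑ i, C (ζ i) * pderiv i q) := by
  induction q using MvPolynomial.induction_on with
  | C c => simp [lineHom]
  | add p q hp hq =>
    simp only [map_add, hp, hq, mul_add, Finset.sum_add_distrib]
  | mul_X p j hp =>
    rw [map_mul, Polynomial.derivative_mul, hp]
    simp only [pderiv_mul, mul_add, Finset.sum_add_distrib, map_add]
    congr 1
    · rw [← map_mul, Finset.sum_mul]
      simp only [mul_assoc]
    · rw [Finset.sum_eq_single j (fun i _ hi => by
        rw [pderiv_X_of_ne hi.symm, mul_zero, mul_zero]) (by simp), pderiv_X_self, mul_one, map_mul,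
        mul_comm]
      simp [lineHom]

lemma lineHom_monomial (x ζ : Fin n → ℂ) (β : Fin n →₀ ℕ) :
    (lineHom x ζ (monomial β 1)).natDegree ≤ β.degree ∧
      (lineHom x ζ (monomial β 1)).coeff β.degree = ∏ i, ζ i ^ β i := by
  have h : lineHom x ζ (monomial β 1) =
      ∏ i, (Polynomial.C (x i) + Polynomial.C (ζ i) * Polynomial.X) ^ β i := by
    rw [lineHom, aeval_monomial, map_one, one_mul, Finsupp.prod_fintype _ _ (by simp)]
  have h1 : ∀ i, (Polynomial.C (x i) + Polynomial.C (ζ i) * Polynomial.X).natDegree ≤ 1 := fun i => by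
    compute_degree
  have h2 : ∀ S : Finset (Fin n),
      (∏ i ∈ S, (Polynomial.C (x i) + Polynomial.C (ζ i) * Polynomial.X) ^ β i).natDegree ≤
        ∑ i ∈ S, β i ∧
      (∏ i ∈ S, (Polynomial.C (x i) + Polynomial.C (ζ i) * Polynomial.X) ^ β i).coeff
        (∑ i ∈ S, β i) = ∏ i ∈ S, ζ i ^ β i := by
    intro S
    induction S using Finset.induction_on with
    | empty => simp
    | insert j S hj ih =>
      have h3 : ((Polynomial.C (x j) + Polynomial.C (ζ j) * Polynomial.X) ^ β j).natDegree ≤ β j := by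
        simpa using Polynomial.natDegree_pow_le_of_le (β j) (h1 j)
      rw [Finset.prod_insert hj, Finset.sum_insert hj, Finset.prod_insert hj]
      refine ⟨Polynomial.natDegree_mul_le_of_le h3 ih.1, ?_⟩
      rw [Polynomial.coeff_mul_add_eq_of_natDegree_le h3 ih.1, ih.2]
      have h4 := Polynomial.coeff_pow_of_natDegree_le (m := β j) (h1 j)
      rw [mul_one] at h4
      rw [h4]
      simp
  rw [h, Finsupp.degree_eq_sum]
  exact h2 Finset.univ

lemma coeff_lineHom (x ζ : Fin n → ℂ) {N : ℕ} {q : MvPolynomial (Fin n) ℂ} (hq : q.totalDegree ≤ N) :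
    (lineHom x ζ q).natDegree ≤ N ∧
      (lineHom x ζ q).coeff N = eval ζ (homogeneousComponent N q) := by
  have hd : ∀ β ∈ q.support, β.degree ≤ N := fun β hβ => by
    rw [Finsupp.degree_apply]
    exact (le_totalDegree hβ).trans hq
  have h : lineHom x ζ q = ∑ β ∈ q.support,
      Polynomial.C (coeff β q) * lineHom x ζ (monomial β 1) := by
    conv_lhs => rw [q.as_sum]
    rw [map_sum]
    refine Finset.sum_congr rfl fun β _ => ?_
    rw [← Polynomial.smul_eq_C_mul, ← map_smul, smul_monomial, smul_eq_mul, mul_one]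
  rw [h]
  constructor
  · refine Polynomial.natDegree_sum_le_of_forall_le _ _ fun β hβ => ?_
    exact (Polynomial.natDegree_C_mul_le _ _).trans ((lineHom_monomial x ζ β).1.trans (hd β hβ))
  · rw [homogeneousComponent_apply, map_sum, Finset.sum_filter, Polynomial.finsetSum_coeff]
    refine Finset.sum_congr rfl fun β hβ => ?_
    rw [Polynomial.coeff_C_mul]
    split_ifs with h1
    · subst h1
      rw [(lineHom_monomial x ζ β).2, eval_monomial, Finsupp.prod_fintype _ _ (by simp)]
    · rw [Polynomial.coeff_eq_zero_of_natDegree_lt, mul_zero]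
      exact (lineHom_monomial x ζ β).1.trans_lt (lt_of_le_of_ne (hd β hβ) h1)

/-- A vanishing Wronskian means proportionality. The combination `u` has no coefficient in degree
`N` and satisfies the same equation; comparing the coefficients in degree `N + deg u` shows `deg u =
N` unless `u = 0`. -/
lemma mul_coeff_eq_of_wronskian {g v : Polynomial ℂ} {N : ℕ} (hg : g.natDegree ≤ N)
    (hv : v.natDegree ≤ N) (h0 : v.coeff N ≠ 0)
    (h : v * Polynomial.derivative g = g * Polynomial.derivative v) (j : ℕ) :
    g.coeff j * v.coeff N = g.coeff N * v.coeff j := by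
  set u := Polynomial.C (v.coeff N) * g - Polynomial.C (g.coeff N) * v with hu
  -- `X d/dX` scales the coefficient of index `m` by `m`, which avoids shifted indices.
  have hX : ∀ (p : Polynomial ℂ) (m : ℕ),
      (Polynomial.X * Polynomial.derivative p).coeff m = m * p.coeff m := by
    intro p m
    cases m with
    | zero => simp
    | succ m => rw [Polynomial.coeff_X_mul, Polynomial.coeff_derivative, mul_comm]; push_cast; rfl
  have hXd : ∀ p : Polynomial ℂ, (Polynomial.X * Polynomial.derivative p).natDegree ≤ p.natDegree := by
    intro p
    refine Polynomial.natDegree_le_iff_coeff_eq_zero.2 fun m hm => ?_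
    rw [hX, Polynomial.coeff_eq_zero_of_natDegree_lt hm, mul_zero]
  have hudeg : u.natDegree ≤ N := by
    refine (Polynomial.natDegree_sub_le _ _).trans (max_le ?_ ?_)
    · exact (Polynomial.natDegree_C_mul_le _ _).trans hg
    · exact (Polynomial.natDegree_C_mul_le _ _).trans hv
  have huN : u.coeff N = 0 := by
    rw [hu, Polynomial.coeff_sub, Polynomial.coeff_C_mul, Polynomial.coeff_C_mul]
    ring
  have hw : v * (Polynomial.X * Polynomial.derivative u) =
      u * (Polynomial.X * Polynomial.derivative v) := by
    rw [hu, Polynomial.derivative_sub, Polynomial.derivative_C_mul, Polynomial.derivative_C_mul]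
    linear_combination (Polynomial.X * Polynomial.C (v.coeff N)) * h
  have hu0 : u = 0 := by
    by_contra hne
    have h1 := congrArg (fun p => p.coeff (N + u.natDegree)) hw
    rw [Polynomial.coeff_mul_add_eq_of_natDegree_le hv (hXd u), hX, add_comm N,
      Polynomial.coeff_mul_add_eq_of_natDegree_le le_rfl ((hXd v).trans hv), hX,
      Polynomial.coeff_natDegree] at h1
    have h2 : (v.coeff N * u.leadingCoeff) * ((u.natDegree : ℂ) - N) = 0 := by linear_combination h1
    rcases mul_eq_zero.1 h2 with h3 | h3
    · exact (mul_ne_zero h0 (Polynomial.leadingCoeff_ne_zero.2 hne)) h3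
    · have h4 : u.natDegree = N := by exact_mod_cast sub_eq_zero.1 h3
      rw [← h4, Polynomial.coeff_natDegree] at huN
      exact hne (Polynomial.leadingCoeff_eq_zero.1 huN)
  have h1 := congrArg (fun p => p.coeff j) hu0
  simp only [hu, Polynomial.coeff_sub, Polynomial.coeff_C_mul, Polynomial.coeff_zero] at h1
  linear_combination h1

/-- If `B / ∏_{i<j} (x_i - x_j)` is constant along `ζ`, and the degree of `B` is at most that of the
denominator, then it is constant. -/
lemma eval_mul_vdm_eq {ζ : Fin n → ℝ} (hζ : ζ ∈ Reg n) {B : MvPolynomial (Fin n) ℂ}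
    (hB : B.totalDegree ≤ (pairs n).card)
    (h : vand n ℂ * ∑ i, C (ζ i : ℂ) * pderiv i B = B * ∑ i, C (ζ i : ℂ) * pderiv i (vand n ℂ))
    (x : Fin n → ℝ) :
    eval (fun i => (x i : ℂ)) B * vdm ζ =
      eval (fun i => (ζ i : ℂ)) (homogeneousComponent (pairs n).card B) * vdm x := by
  set x' : Fin n → ℂ := fun i => (x i : ℂ)
  set ζ' : Fin n → ℂ := fun i => (ζ i : ℂ)
  obtain ⟨hB1, hB2⟩ := coeff_lineHom x' ζ' hB
  obtain ⟨hv1, hv2⟩ := coeff_lineHom x' ζ' (isHomogeneous_vand (n := n) (S := ℂ)).totalDegree_le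
  have hv3 : homogeneousComponent (pairs n).card (vand n ℂ) = vand n ℂ := by
    rw [homogeneousComponent_of_mem (isHomogeneous_vand), if_pos rfl]
  rw [hv3, eval_vand] at hv2
  have hw : lineHom x' ζ' (vand n ℂ) * Polynomial.derivative (lineHom x' ζ' B) =
      lineHom x' ζ' B * Polynomial.derivative (lineHom x' ζ' (vand n ℂ)) := by
    rw [derivative_lineHom, derivative_lineHom, ← map_mul, ← map_mul, h]
  have := mul_coeff_eq_of_wronskian hB1 hv1 (by rw [hv2]; exact vdm_ne_zero hζ) hw 0
  rwa [hv2, hB2, coeff_zero_lineHom, coeff_zero_lineHom, eval_vand] at this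

end Lines

end

section

variable {n : ℕ}

/-! ### The equations satisfied by the symbol -/

section SymbolEquations

lemma totalDegree_wordPoly_le (w : List (Fin n × Fin n)) : (wordPoly w).totalDegree ≤ w.length := by
  induction w with
  | nil => simp [wordPoly]
  | cons p w ih =>
    have h : wordPoly (p :: w) = varDiff p.1 p.2 * wordPoly w := by simp [wordPoly]
    have h1 : (varDiff p.1 p.2 : MvPolynomial (Fin n) ℂ).totalDegree ≤ 1 :=
      (totalDegree_sub _ _).trans (by simp [totalDegree_X])
    rw [h, List.length_cons, add_comm]
    exact (totalDegree_mul _ _).trans (add_le_add h1 ih)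

variable {D : DiffPoly n}

lemma IsChalykhVeselov.totalDegree_symbol_le (h : IsChalykhVeselov n D) (x : Fin n → ℝ) :
    (D.symbol x).totalDegree ≤ (pairs n).card := by
  refine totalDegree_finsetSum_le fun w hw => ?_
  refine (totalDegree_mul _ _).trans ?_
  rw [totalDegree_C, zero_add, card_pairs]
  exact (totalDegree_wordPoly_le w).trans (h.order_le w hw)

/-- The plane wave is symmetric in `x` and `z` and cancels from the symmetry condition. -/
lemma IsChalykhVeselov.eval_symbol_mul_vdm (h : IsChalykhVeselov n D) {x z : Fin n → ℝ}
    (hx : x ∈ Reg n) (hz : z ∈ Reg n) :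
    eval (fun i => (z i : ℂ)) (D.symbol x) * vdm x =
      eval (fun i => (x i : ℂ)) (D.symbol z) * vdm z := by
  have h1 := h.symm x hx z hz
  simp only [DiffPoly.apply_planeWave] at h1
  have h3 : planeWave x z = planeWave z x := by simp only [planeWave, mul_comm]
  have hx0 := vdm_ne_zero hx
  have hz0 := vdm_ne_zero hz
  have hp := planeWave_ne_zero z x
  rw [h3] at h1
  field_simp at h1
  linear_combination h1

/-- Linear functionals of the symbol are polynomials in `x` divided by `∏_{i<j} (x_i - x_j)`. -/
lemma IsChalykhVeselov.exists_functional_eq (h : IsChalykhVeselov n D)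
    (φ : MvPolynomial (Fin n) ℂ →ₗ[ℂ] ℂ) :
    ∃ b : MvPolynomial (Fin n) ℂ, b.totalDegree ≤ (pairs n).card ∧
      ∀ x ∈ Reg n, φ (D.symbol x) * vdm x = eval (fun i => (x i : ℂ)) b := by
  have hmem : ∀ x, D.symbol x ∈ restrictTotalDegree (Fin n) ℂ (pairs n).card := fun x =>
    (mem_restrictTotalDegree _ _ _).2 (h.totalDegree_symbol_le x)
  have key : ∀ ψ : Module.Dual ℂ (restrictTotalDegree (Fin n) ℂ (pairs n).card),
      ∃ b ∈ restrictTotalDegree (Fin n) ℂ (pairs n).card,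
        ∀ x ∈ Reg n, ψ ⟨D.symbol x, hmem x⟩ * vdm x = eval (fun i => (x i : ℂ)) b := by
    intro ψ
    have hψ : ψ ∈ (⊤ : Submodule ℂ (Module.Dual ℂ (restrictTotalDegree (Fin n) ℂ (pairs n).card))) :=
      Submodule.mem_top
    rw [← span_eval_Reg] at hψ
    induction hψ using Submodule.span_induction with
    | mem ψ hψ =>
      obtain ⟨⟨ζ, hζ⟩, rfl⟩ := hψ
      -- For the evaluation at `ζ`, symmetry turns the dependence on `x` into evaluation at `x` of
      -- the symbol at `ζ`.
      refine ⟨vdm ζ • D.symbol ζ, Submodule.smul_mem _ _ (hmem ζ), fun x hx => ?_⟩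
      rw [smul_eval, mul_comm (vdm ζ), ← h.eval_symbol_mul_vdm hx hζ]
      rfl
    | zero => exact ⟨0, Submodule.zero_mem _, fun x _ => by simp⟩
    | add ψ₁ ψ₂ _ _ h1 h2 =>
      obtain ⟨b, hb, hb'⟩ := h1
      obtain ⟨c, hc, hc'⟩ := h2
      refine ⟨b + c, Submodule.add_mem _ hb hc, fun x hx => ?_⟩
      rw [map_add, ← hb' x hx, ← hc' x hx, LinearMap.add_apply, add_mul]
    | smul a ψ _ h1 =>
      obtain ⟨b, hb, hb'⟩ := h1
      refine ⟨a • b, Submodule.smul_mem _ _ hb, fun x hx => ?_⟩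
      rw [smul_eval, ← hb' x hx, LinearMap.smul_apply, smul_eq_mul, mul_assoc]
  obtain ⟨b, hb, hb'⟩ := key (φ.domRestrict _)
  exact ⟨b, (mem_restrictTotalDegree _ _ _).1 hb, hb'⟩

/-- The function `B / ∏_{i<j} (x_i - x_j)`. -/
def overVdm (B : MvPolynomial (Fin n) ℂ) (x : Fin n → ℝ) : ℂ :=
  (vdm x)⁻¹ * eval (fun i => (x i : ℂ)) B

lemma differentiableAt_eval (B : MvPolynomial (Fin n) ℂ) (x : Fin n → ℝ) :
    DifferentiableAt ℝ (fun x : Fin n → ℝ => eval (fun i => (x i : ℂ)) B) x :=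
  differentiable_of_contDiff (contDiff_eval B) x

lemma differentiableAt_overVdm (B : MvPolynomial (Fin n) ℂ) {x : Fin n → ℝ} (hx : x ∈ Reg n) :
    DifferentiableAt ℝ (overVdm B) x :=
  (differentiableAt_inv_vdm hx).fun_mul (differentiableAt_eval B x)

lemma pd_overVdm (i : Fin n) (B : MvPolynomial (Fin n) ℂ) {x : Fin n → ℝ} (hx : x ∈ Reg n) :
    pd i (overVdm B) x = (vdm x)⁻¹ * (eval (fun i => (x i : ℂ)) (pderiv i B) -
      (∑ j, invDiff i j x) * eval (fun i => (x i : ℂ)) B) := by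
  have h := pd_mul (differentiableAt_inv_vdm hx) (differentiableAt_eval B x) i
  rw [pd_inv_vdm i hx, pd_eval] at h
  refine Eq.trans h ?_
  ring

lemma differentiableAt_pd_overVdm (i : Fin n) (B : MvPolynomial (Fin n) ℂ) {x : Fin n → ℝ}
    (hx : x ∈ Reg n) : DifferentiableAt ℝ (pd i (overVdm B)) x := by
  have h : DifferentiableAt ℝ (fun x => (vdm x)⁻¹ * (eval (fun i => (x i : ℂ)) (pderiv i B) -
      (∑ j, invDiff i j x) * eval (fun i => (x i : ℂ)) B)) x := by
    refine (differentiableAt_inv_vdm hx).fun_mul ((differentiableAt_eval _ x).fun_sub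
      (DifferentiableAt.fun_mul (DifferentiableAt.fun_sum fun j _ => differentiableAt_invDiff i j hx)
        (differentiableAt_eval B x)))
  refine h.congr_of_eventuallyEq ?_
  filter_upwards [(isOpen_Reg n).mem_nhds hx] with y hy using pd_overVdm i B hy

/-- Evaluation at a real point, as a linear functional. -/
def evalAt (x : Fin n → ℝ) : MvPolynomial (Fin n) ℂ →ₗ[ℂ] ℂ := (aeval fun i => (x i : ℂ)).toLinearMap

lemma evalAt_apply (x : Fin n → ℝ) (B : MvPolynomial (Fin n) ℂ) :
    evalAt x B = eval (fun i => (x i : ℂ)) B := by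
  rw [evalAt, AlgHom.toLinearMap_apply, aeval_eq_eval]

/-- The value of `lapTilde` at a point off the walls, as a linear functional of the numerator. -/
def lapTildeAt (x : Fin n → ℝ) : MvPolynomial (Fin n) ℂ →ₗ[ℂ] ℂ :=
  (vdm x)⁻¹ • (∑ i, evalAt x ∘ₗ (pderiv i).toLinearMap ∘ₗ (pderiv i).toLinearMap -
    ∑ i, ∑ j, invDiff i j x • (evalAt x ∘ₗ (pderiv i).toLinearMap -
      evalAt x ∘ₗ (pderiv j).toLinearMap))

/-- The value of a partial derivative at a point off the walls, as a linear functional of the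
numerator. -/
def pdAt (i : Fin n) (x : Fin n → ℝ) : MvPolynomial (Fin n) ℂ →ₗ[ℂ] ℂ :=
  (vdm x)⁻¹ • (evalAt x ∘ₗ (pderiv i).toLinearMap - (∑ j, invDiff i j x) • evalAt x)

lemma lapTilde_overVdm (B : MvPolynomial (Fin n) ℂ) {x : Fin n → ℝ} (hx : x ∈ Reg n) :
    lapTilde (overVdm B) x = lapTildeAt x B := by
  have h1 : ∀ i, pd i (fun y : Fin n → ℝ => eval (fun i => (y i : ℂ)) B) =
      fun y => eval (fun i => (y i : ℂ)) (pderiv i B) := fun i => funext fun y => pd_eval i B y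
  refine (lapTilde_inv_vdm_mul (contDiff_eval B) hx).trans ?_
  simp [lap, h1, pd_eval, lapTildeAt, evalAt_apply]

lemma pd_overVdm_eq (i : Fin n) (B : MvPolynomial (Fin n) ℂ) {x : Fin n → ℝ} (hx : x ∈ Reg n) :
    pd i (overVdm B) x = pdAt i x B := by
  rw [pd_overVdm i B hx]
  simp [pdAt, evalAt_apply]

lemma lap_mul_planeWave {u : (Fin n → ℝ) → ℂ} {x : Fin n → ℝ} (hx : x ∈ Reg n)
    (hu : ∀ y ∈ Reg n, DifferentiableAt ℝ u y)
    (hu' : ∀ i, ∀ y ∈ Reg n, DifferentiableAt ℝ (pd i u) y) (ζ : Fin n → ℝ) :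
    lap (fun y => u y * planeWave y ζ) x =
      (lap u x + 2 * ∑ i, ζ i * pd i u x + (∑ i, (ζ i : ℂ) ^ 2) * u x) * planeWave x ζ := by
  have hp : ∀ y, DifferentiableAt ℝ (fun y => planeWave y ζ) y := fun y =>
    differentiable_of_contDiff (contDiff_planeWave ζ) y
  have h1 : ∀ i, ∀ y ∈ Reg n, pd i (fun y => u y * planeWave y ζ) y =
      (pd i u y + u y * ζ i) * planeWave y ζ := by
    intro i y hy
    rw [pd_mul (hu y hy) (hp y), pd_planeWave]
    ring
  have h2 : ∀ i, pd i (pd i fun y => u y * planeWave y ζ) x =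
      (pd i (pd i u) x + 2 * (ζ i * pd i u x) + (ζ i : ℂ) ^ 2 * u x) * planeWave x ζ := by
    intro i
    have hc : DifferentiableAt ℝ (fun _ : Fin n → ℝ => (ζ i : ℂ)) x := differentiableAt_const _
    rw [pd_congr hx (h1 i), pd_mul ((hu' i x hx).fun_add ((hu x hx).fun_mul hc)) (hp x),
      pd_add (hu' i x hx) ((hu x hx).fun_mul hc), pd_mul (hu x hx) hc, pd_const, pd_planeWave]
    ring
  rw [lap, Finset.sum_congr rfl fun i _ => h2 i, ← Finset.sum_mul, Finset.sum_add_distrib,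
    Finset.sum_add_distrib, ← Finset.mul_sum, ← Finset.sum_mul, lap]

lemma lap_congr {f g : (Fin n → ℝ) → ℂ} {x : Fin n → ℝ} (hx : x ∈ Reg n)
    (h : ∀ y ∈ Reg n, f y = g y) : lap f x = lap g x :=
  Finset.sum_congr rfl fun i _ => pd_congr hx (fun _ hy => pd_congr hy h i) i

lemma lapTilde_congr {f g : (Fin n → ℝ) → ℂ} {x : Fin n → ℝ} (hx : x ∈ Reg n)
    (h : ∀ y ∈ Reg n, f y = g y) : lapTilde f x = lapTilde g x := by
  rw [lapTilde, lapTilde, lap_congr hx h, h x hx]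

lemma lap_planeWave (ζ : Fin n → ℝ) :
    lap (fun y => planeWave y ζ) = ((∑ i, (ζ i : ℂ) ^ 2) • waveFun ζ : smoothFun n) := by
  funext x
  have h := lap_eq (waveFun ζ)
  refine (congrFun h x).trans ?_
  rw [← opAt_apply, opAt_waveFun]
  simp [waveFun]

/-- The equation for the symbol that the intertwining relation expresses on plane waves. -/
lemma IsChalykhVeselov.symbol_equation (h : IsChalykhVeselov n D) {ζ : Fin n → ℝ}
    {B : MvPolynomial (Fin n) ℂ}
    (hB : ∀ x ∈ Reg n, eval (fun i => (ζ i : ℂ)) (D.symbol x) * vdm x = eval (fun i => (x i : ℂ)) B)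
    {x : Fin n → ℝ} (hx : x ∈ Reg n) :
    lapTildeAt x B + 2 * ∑ i, ζ i * pdAt i x B = 0 := by
  have h1 := h.intertwines _ (contDiff_planeWave ζ) x hx
  have h2 : ∀ y ∈ Reg n, D.apply (fun y => planeWave y ζ) y = overVdm B y * planeWave y ζ := by
    intro y hy
    rw [DiffPoly.apply_planeWave, overVdm, ← hB y hy, mul_comm _ (vdm y),
      inv_mul_cancel_left₀ (vdm_ne_zero hy)]
  have h3 : D.apply (lap fun y => planeWave y ζ) x =
      (∑ i, (ζ i : ℂ) ^ 2) * D.apply (fun y => planeWave y ζ) x := by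
    rw [lap_planeWave, DiffPoly.apply_eq]
    change _ = _ * D.apply (waveFun ζ : (Fin n → ℝ) → ℂ) x
    rw [DiffPoly.apply_eq, opAt_apply, map_smul, opAt_apply]
    rfl
  rw [h3, lapTilde_congr hx h2, h2 x hx, lapTilde, lap_mul_planeWave hx
    (fun y hy => differentiableAt_overVdm B hy) (fun i y hy => differentiableAt_pd_overVdm i B hy)] at h1
  have h4 := lapTilde_overVdm B hx
  rw [lapTilde] at h4
  simp only [← pd_overVdm_eq _ B hx]
  rw [← h4]
  refine (mul_eq_zero.1 ?_).resolve_right (planeWave_ne_zero x ζ)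
  linear_combination -h1

/-- The homogeneous parts of `IsChalykhVeselov.symbol_equation`. -/
lemma IsChalykhVeselov.graded_symbol_equation (h : IsChalykhVeselov n D) {ζ : Fin n → ℝ}
    {B : ℕ → MvPolynomial (Fin n) ℂ}
    (hB : ∀ j, ∀ x ∈ Reg n, eval (fun i => (ζ i : ℂ)) (homogeneousComponent j (D.symbol x)) * vdm x =
      eval (fun i => (x i : ℂ)) (B j))
    {x : Fin n → ℝ} (hx : x ∈ Reg n) :
    lapTildeAt x (B 0) = 0 ∧
      ∀ j, lapTildeAt x (B (j + 1)) + 2 * ∑ i, ζ i * pdAt i x (B j) = 0 := by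
  -- The symbol equation at `sζ` is a polynomial identity in `s`; since it holds for all real `s`,
  -- it can be read coefficientwise.
  have key : ∀ M, (pairs n).card < M → ∑ j ∈ Finset.range M,
      (Polynomial.C (lapTildeAt x (B j)) * Polynomial.X ^ j +
        Polynomial.C (2 * ∑ i, ζ i * pdAt i x (B j)) * Polynomial.X ^ (j + 1)) = 0 := by
    intro M hM
    by_contra hne
    obtain ⟨s, -, hs⟩ := exists_real_eval_ne_zero hne
    have h1 : ∀ y ∈ Reg n, eval (fun i => ((s * ζ i : ℝ) : ℂ)) (D.symbol y) * vdm y =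
        eval (fun i => (y i : ℂ)) (∑ j ∈ Finset.range M, (s : ℂ) ^ j • B j) := by
      intro y hy
      have h2 : D.symbol y = ∑ j ∈ Finset.range M, homogeneousComponent j (D.symbol y) := by
        conv_lhs => rw [← sum_homogeneousComponent (D.symbol y)]
        refine Finset.sum_subset (fun j hj => ?_) fun j _ hj => ?_
        · have := h.totalDegree_symbol_le y
          rw [Finset.mem_range] at hj ⊢
          omega
        · rw [Finset.mem_range] at hj
          exact homogeneousComponent_eq_zero _ _ (by omega)
      conv_lhs => rw [h2]
      rw [map_sum, map_sum, Finset.sum_mul]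
      refine Finset.sum_congr rfl fun j _ => ?_
      rw [smul_eval, ← hB j y hy, eval_homogeneousComponent, eval_homogeneousComponent, Finset.sum_mul,
        Finset.sum_mul, Finset.mul_sum]
      refine Finset.sum_congr rfl fun β hβ => ?_
      have hβ' : ∑ i, β i = j := (Finset.mem_finsuppAntidiag.1 hβ).1
      have h3 : ∏ i, ((s * ζ i : ℝ) : ℂ) ^ β i = (s : ℂ) ^ j * ∏ i, (ζ i : ℂ) ^ β i := by
        rw [← hβ', ← Finset.prod_pow_eq_pow_sum, ← Finset.prod_mul_distrib]
        refine Finset.prod_congr rfl fun i _ => ?_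
        push_cast
        rw [mul_pow]
      rw [h3]
      ring
    have h5 := h.symbol_equation h1 hx
    apply hs
    rw [Polynomial.eval_finsetSum]
    simp only [Polynomial.eval_add, Polynomial.eval_mul, Polynomial.eval_C, Polynomial.eval_pow,
      Polynomial.eval_X]
    simp only [map_sum, map_smul, smul_eq_mul] at h5
    rw [← h5, Finset.sum_add_distrib]
    congr 1
    · exact Finset.sum_congr rfl fun j _ => mul_comm _ _
    · simp only [Finset.mul_sum, Finset.sum_mul]
      rw [Finset.sum_comm]
      refine Finset.sum_congr rfl fun i _ => Finset.sum_congr rfl fun j _ => ?_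
      push_cast
      ring
  have hc : ∀ M m, (∑ j ∈ Finset.range M,
      (Polynomial.C (lapTildeAt x (B j)) * Polynomial.X ^ j +
        Polynomial.C (2 * ∑ i, ζ i * pdAt i x (B j)) * Polynomial.X ^ (j + 1))).coeff m =
      ∑ j ∈ Finset.range M, ((if m = j then lapTildeAt x (B j) else 0) +
        if m = j + 1 then 2 * ∑ i, ζ i * pdAt i x (B j) else 0) := by
    intro M m
    rw [Polynomial.finsetSum_coeff]
    simp only [Polynomial.coeff_add, Polynomial.coeff_C_mul_X_pow]
  constructor
  · have h1 := congrArg (fun p => Polynomial.coeff p 0) (key ((pairs n).card + 1) (by omega))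
    rw [hc] at h1
    simpa using h1
  · intro j
    have h1 := congrArg (fun p => Polynomial.coeff p (j + 1)) (key ((pairs n).card + j + 2) (by omega))
    rw [hc] at h1
    simp only [Finset.sum_add_distrib, Finset.sum_ite_eq, Nat.add_right_cancel_iff,
      Finset.mem_range] at h1
    rwa [if_pos (by omega), if_pos (by omega)] at h1

/-- The leading homogeneous part of the symbol does not depend on the point. -/
lemma IsChalykhVeselov.homogeneousComponent_symbol_eq (h : IsChalykhVeselov n D) {k : ℕ}
    (hk : ∀ x ∈ Reg n, homogeneousComponent (k + 1) (D.symbol x) = 0) {x y : Fin n → ℝ}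
    (hx : x ∈ Reg n) (hy : y ∈ Reg n) :
    homogeneousComponent k (D.symbol x) = homogeneousComponent k (D.symbol y) := by
  refine eq_of_eval_eq_on_Reg fun ζ hζ => ?_
  choose B hBdeg hB using fun j => h.exists_functional_eq (evalAt ζ ∘ₗ homogeneousComponent j)
  simp only [LinearMap.comp_apply, evalAt_apply] at hB
  have hB0 : B (k + 1) = 0 := by
    refine eq_of_eval_eq_on_Reg fun z hz => ?_
    rw [← hB _ z hz, hk z hz]
    simp
  -- There is no part of degree `k + 1`, so the graded equation says that the degree `k` part at `ζ`
  -- has zero derivative along `ζ`.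
  have h1 : vand n ℂ * ∑ i, C (ζ i : ℂ) * pderiv i (B k) =
      B k * ∑ i, C (ζ i : ℂ) * pderiv i (vand n ℂ) := by
    refine eq_of_eval_eq_on_Reg fun z hz => ?_
    have h2 := (h.graded_symbol_equation hB hz).2 k
    rw [hB0, map_zero, zero_add] at h2
    have h3 : ∀ i, pdAt i z (B k) = (vdm z)⁻¹ * (eval (fun i => (z i : ℂ)) (pderiv i (B k)) -
        (∑ j, invDiff i j z) * eval (fun i => (z i : ℂ)) (B k)) := fun i => by
      rw [← pd_overVdm_eq i _ hz, pd_overVdm i _ hz]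
    have h4 : ∀ i, eval (fun i => (z i : ℂ)) (pderiv i (vand n ℂ)) = (∑ j, invDiff i j z) * vdm z := by
      intro i
      rw [← pd_vdm i hz, ← pd_eval]
      simp only [eval_vand]
    simp only [map_mul, map_sum, eval_C, eval_vand, h4]
    have h5 : ∑ i, ζ i * pdAt i z (B k) = 0 := (mul_eq_zero.1 h2).resolve_left two_ne_zero
    have hz0 := vdm_ne_zero hz
    have h6 : ∑ i, ((ζ i : ℂ) * pdAt i z (B k)) * vdm z = 0 := by rw [← Finset.sum_mul, h5, zero_mul]
    rw [← sub_eq_zero, Finset.mul_sum, Finset.mul_sum, ← Finset.sum_sub_distrib]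
    rw [← mul_zero (vdm z), ← h6, Finset.mul_sum]
    refine Finset.sum_congr rfl fun i _ => ?_
    rw [h3]
    field_simp
  have h2 := eval_mul_vdm_eq hζ (hBdeg k) h1
  have hζ0 := vdm_ne_zero hζ
  have h3 : ∀ z ∈ Reg n, eval (fun i => (ζ i : ℂ)) (homogeneousComponent k (D.symbol z)) * vdm ζ =
      eval (fun i => (ζ i : ℂ)) (homogeneousComponent (pairs n).card (B k)) := by
    intro z hz
    have hz0 := vdm_ne_zero hz
    have h4 := h2 z
    rw [← hB k z hz] at h4
    refine mul_right_cancel₀ hz0 ?_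
    linear_combination h4
  exact mul_right_cancel₀ hζ0 ((h3 x hx).trans (h3 y hy).symm)

/-- The leading part of the symbol. -/
lemma IsChalykhVeselov.exists_leading (h : IsChalykhVeselov n D) :
    ∃ (k : ℕ) (e : MvPolynomial (Fin n) ℂ), e ≠ 0 ∧
      (∀ x ∈ Reg n, (D.symbol x).totalDegree ≤ k) ∧
      ∀ x ∈ Reg n, homogeneousComponent k (D.symbol x) = e := by
  classical
  -- `k` is the least index above which all components vanish at all points off the walls. If the
  -- component of index `k` vanished too, minimality would fail, or for `k = 0` the operator would
  -- be zero.
  have hex : ∃ k, ∀ j, k < j → ∀ x ∈ Reg n, homogeneousComponent j (D.symbol x) = 0 :=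
    ⟨(pairs n).card, fun j hj x _ => homogeneousComponent_eq_zero _ _
      ((h.totalDegree_symbol_le x).trans_lt hj)⟩
  set k := Nat.find hex with hk
  have hk1 := Nat.find_spec hex
  have h0 := mem_Reg_natCast n
  have hsum : ∀ x ∈ Reg n, ∀ S : Finset ℕ, Finset.range (k + 1) ⊆ S →
      ∑ j ∈ S, homogeneousComponent j (D.symbol x) =
        ∑ j ∈ Finset.range (k + 1), homogeneousComponent j (D.symbol x) := by
    intro x hx S hS
    refine (Finset.sum_subset hS fun j _ hj => hk1 j ?_ x hx).symm
    rw [Finset.mem_range] at hj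
    omega
  have hsym : ∀ x ∈ Reg n, D.symbol x =
      ∑ j ∈ Finset.range (k + 1), homogeneousComponent j (D.symbol x) := by
    intro x hx
    rw [← hsum x hx (Finset.range (max ((D.symbol x).totalDegree + 1) (k + 1)))
      (Finset.range_mono (le_max_right _ _))]
    conv_lhs => rw [← sum_homogeneousComponent (D.symbol x)]
    refine Finset.sum_subset (Finset.range_mono (le_max_left _ _)) fun j _ hj => ?_
    rw [Finset.mem_range] at hj
    exact homogeneousComponent_eq_zero _ _ (by omega)
  refine ⟨k, homogeneousComponent k (D.symbol fun i => ((i : ℕ) : ℝ)), fun hzero => ?_, fun x hx => ?_,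
    fun x hx => h.homogeneousComponent_symbol_eq (hk1 (k + 1) (Nat.lt_succ_self k)) hx h0⟩
  · have hall : ∀ x ∈ Reg n, homogeneousComponent k (D.symbol x) = 0 := fun x hx => by
      rw [h.homogeneousComponent_symbol_eq (hk1 (k + 1) (Nat.lt_succ_self k)) hx h0, hzero]
    rcases Nat.eq_zero_or_pos k with hk0 | hkpos
    · obtain ⟨f, hf, x, hx, hne⟩ := h.ne_zero
      apply hne
      change D.apply ((⟨f, hf⟩ : smoothFun n) : (Fin n → ℝ) → ℂ) x = 0
      rw [DiffPoly.apply_eq, hsym x hx, hk0, Finset.sum_range_one, ← hk0, hall x hx, map_zero]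
    · refine Nat.find_min hex (Nat.sub_lt hkpos one_pos) fun j hj x hx => ?_
      rcases eq_or_ne j k with rfl | hjk
      · exact hall x hx
      · exact hk1 j (by omega) x hx
  · rw [hsym x hx]
    refine totalDegree_finsetSum_le fun j hj => ?_
    refine (homogeneousComponent_isHomogeneous j _).totalDegree_le.trans ?_
    rw [Finset.mem_range] at hj
    omega

end SymbolEquations

end

section

variable {n : ℕ}

/-! ### Limits of the symbol and the leading asymptotics of `σ̃` -/

section SymbolLimits

open Filter Topology

lemma squareRay_mem_Reg {ζ : Fin n → ℝ} (hζ : ∀ i, ζ i < 0) (hreg : ζ ∈ Reg n) {s : ℝ} (hs : 0 < s) :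
    squareRay ζ s ∈ Reg n := by
  intro i j hij
  have h1 : ζ i ^ 2 = ζ j ^ 2 := mul_left_cancel₀ (pow_ne_zero 2 hs.ne') hij
  refine hreg ?_
  nlinarith [hζ i, hζ j, sq_nonneg (ζ i - ζ j)]

lemma tendsto_eval_div_pow {p : Polynomial ℂ} {N : ℕ} (hp : p.natDegree ≤ N) :
    Tendsto (fun t : ℝ => p.eval (t : ℂ) / (t : ℂ) ^ N) atTop (𝓝 (p.coeff N)) := by
  have hinv : Tendsto (fun t : ℝ => ((t : ℂ))⁻¹) atTop (𝓝 0) := by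
    have := (Complex.continuous_ofReal.tendsto _).comp tendsto_inv_atTop_zero
    simpa [Function.comp_def] using this
  have h1 := tendsto_finsetSum (Finset.range (N + 1)) fun j (_ : j ∈ Finset.range (N + 1)) =>
    (hinv.pow (N - j)).const_mul (p.coeff j)
  have h2 : ∑ j ∈ Finset.range (N + 1), p.coeff j * (0 : ℂ) ^ (N - j) = p.coeff N := by
    rw [Finset.sum_eq_single N (fun j hj hne => ?_) (by simp)]
    · simp
    · rw [Finset.mem_range] at hj
      rw [zero_pow (by omega), mul_zero]
  rw [h2] at h1
  refine h1.congr' ?_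
  filter_upwards [eventually_gt_atTop 0] with t ht
  have ht' : (t : ℂ) ≠ 0 := by exact_mod_cast ht.ne'
  rw [Polynomial.eval_eq_sum_range' (Nat.lt_succ_of_le hp), Finset.sum_div]
  refine Finset.sum_congr rfl fun j hj => ?_
  rw [Finset.mem_range] at hj
  obtain ⟨d, rfl⟩ := Nat.exists_eq_add_of_le (Nat.le_of_lt_succ hj)
  rw [Nat.add_sub_cancel_left, pow_add, inv_pow]
  field_simp

lemma eval_lineHom_zero (ξ : Fin n → ℂ) (t : ℂ) (q : MvPolynomial (Fin n) ℂ) :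
    (lineHom 0 ξ q).eval t = eval (fun i => t * ξ i) q := by
  have h : (Polynomial.evalRingHom t).comp (lineHom 0 ξ).toRingHom = eval fun i => t * ξ i := by
    ext i
    · simp [lineHom]
    · simp [lineHom]
      exact mul_comm _ _
  exact congrFun (congrArg DFunLike.coe h) q

lemma tendsto_eval_squareRay (ζ : Fin n → ℝ) {b : MvPolynomial (Fin n) ℂ} {N : ℕ}
    (hb : b.totalDegree ≤ N) :
    ∃ l, Tendsto (fun s : ℝ => eval (fun i => (squareRay ζ s i : ℂ)) b / ((s : ℂ) ^ 2) ^ N) atTop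
      (𝓝 l) := by
  have h := (tendsto_eval_div_pow (coeff_lineHom 0 (fun i => (ζ i : ℂ) ^ 2) hb).1).comp
    (tendsto_pow_atTop (α := ℝ) two_ne_zero)
  refine ⟨_, h.congr fun s => ?_⟩
  rw [Function.comp_apply, eval_lineHom_zero]
  simp [squareRay]

lemma vdm_squareRay (ζ : Fin n → ℝ) (s : ℝ) :
    vdm (squareRay ζ s) = ((s : ℂ) ^ 2) ^ (pairs n).card * vdm fun i => ζ i ^ 2 := by
  rw [vdm, vdm, Finset.pow_card_mul_prod]
  refine Finset.prod_congr rfl fun p _ => ?_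
  simp only [squareRay]
  push_cast
  ring

variable {D : DiffPoly n}

/-- Each coefficient is a polynomial of degree at most `N` divided by the Vandermonde product. Along
the curve the latter is `s^(2N)` times its value at `ζ²`, and the squares of distinct negative
numbers are distinct. -/
lemma IsChalykhVeselov.exists_tendsto_symbol (h : IsChalykhVeselov n D) {ζ : Fin n → ℝ}
    (hζ : ∀ i, ζ i < 0) (hreg : ζ ∈ Reg n) :
    ∃ q : MvPolynomial (Fin n) ℂ, ∀ β,
      Tendsto (fun s => coeff β (D.symbol (squareRay ζ s))) atTop (𝓝 (coeff β q)) := by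
  have h1 : ∀ β, ∃ l, Tendsto (fun s => coeff β (D.symbol (squareRay ζ s))) atTop (𝓝 l) := by
    intro β
    obtain ⟨b, hb, hb'⟩ := h.exists_functional_eq (lcoeff ℂ β)
    obtain ⟨l, hl⟩ := tendsto_eval_squareRay ζ hb
    refine ⟨_, (hl.div_const (vdm fun i => ζ i ^ 2)).congr' ?_⟩
    filter_upwards [eventually_gt_atTop 0] with s hs
    have hr := squareRay_mem_Reg hζ hreg hs
    have h2 := hb' _ hr
    rw [lcoeff_apply] at h2
    have h3 := vdm_ne_zero hr
    rw [← h2, div_div, ← vdm_squareRay, mul_div_cancel_right₀ _ h3]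
  choose l hl using h1
  set S : Finset (Fin n →₀ ℕ) :=
    (Finset.range ((pairs n).card + 1)).biUnion fun d => Finset.univ.finsuppAntidiag d with hS
  have hmem : ∀ β, β ∈ S ↔ β.degree ≤ (pairs n).card := fun β => by
    simp [hS, Finset.mem_finsuppAntidiag, Finsupp.degree_eq_sum]
  refine ⟨∑ β ∈ S, monomial β (l β), fun β => ?_⟩
  have h2 : coeff β (∑ β ∈ S, monomial β (l β)) = l β := by
    classical
    rw [coeff_sum]
    simp only [coeff_monomial, Finset.sum_ite_eq']
    split_ifs with hβ
    · rfl
    · refine tendsto_nhds_unique tendsto_const_nhds ((hl β).congr fun s => ?_)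
      refine coeff_eq_zero_of_totalDegree_lt ?_
      rw [hmem, not_le] at hβ
      rw [← Finsupp.degree_apply]
      exact (h.totalDegree_symbol_le _).trans_lt hβ
  rw [h2]
  exact hl β

lemma homogeneousComponent_eq_of_tendsto {ι : Type*} {l : Filter ι} [l.NeBot]
    {q : ι → MvPolynomial (Fin n) ℂ} {q' e : MvPolynomial (Fin n) ℂ} {k : ℕ}
    (hq : ∀ β, Tendsto (fun s => coeff β (q s)) l (𝓝 (coeff β q')))
    (he : ∀ᶠ s in l, homogeneousComponent k (q s) = e) : homogeneousComponent k q' = e := by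
  ext β
  have h1 : Tendsto (fun s => coeff β (homogeneousComponent k (q s))) l
      (𝓝 (coeff β (homogeneousComponent k q'))) := by
    simp only [coeff_homogeneousComponent]
    split_ifs
    · exact hq β
    · exact tendsto_const_nhds
  refine tendsto_nhds_unique h1 (tendsto_const_nhds.congr' ?_)
  filter_upwards [he] with s hs
  rw [hs]

/-- The leading asymptotics of `σ̃(·, z)` along `s ↦ s² ζ²`. -/
lemma IsChalykhVeselov.tendsto_sigmaTilde (h : IsChalykhVeselov n D) {ζ : Fin n → ℝ}
    (hζ : ∀ i, ζ i < 0) (hreg : ζ ∈ Reg n) {k : ℕ} {e : MvPolynomial (Fin n) ℂ}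
    (hk : ∀ x ∈ Reg n, (D.symbol x).totalDegree ≤ k)
    (he : ∀ x ∈ Reg n, homogeneousComponent k (D.symbol x) = e) (z : Fin n → ℝ) :
    Tendsto (fun s : ℝ => sigmaTilde D (squareRay ζ s) z /
      (airyProd (squareRay ζ s) z * (s : ℂ) ^ k)) atTop (𝓝 (eval (fun i => (ζ i : ℂ)) e)) := by
  obtain ⟨q, hq⟩ := h.exists_tendsto_symbol hζ hreg
  have hev : ∀ᶠ s : ℝ in atTop, squareRay ζ s ∈ Reg n :=
    (eventually_gt_atTop 0).mono fun s hs => squareRay_mem_Reg hζ hreg hs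
  have h1 := tendsto_opAt_airyFun hζ z (hev.mono fun s hs => hk _ hs) hq
  rw [homogeneousComponent_eq_of_tendsto hq (hev.mono fun s hs => he _ hs)] at h1
  refine h1.congr fun s => ?_
  rw [← DiffPoly.apply_eq]
  rfl

/-- The leading asymptotics of `σ̃(z, ·)` along `s ↦ s² ζ²`. -/
lemma tendsto_sigmaTilde_right {ζ : Fin n → ℝ} (hζ : ∀ i, ζ i < 0) {k : ℕ} {z : Fin n → ℝ}
    (hk : (D.symbol z).totalDegree ≤ k) :
    Tendsto (fun s : ℝ => sigmaTilde D z (squareRay ζ s) /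
      (airyProd (squareRay ζ s) z * (s : ℂ) ^ k)) atTop
      (𝓝 (eval (fun i => (ζ i : ℂ)) (homogeneousComponent k (D.symbol z)))) := by
  have h1 := tendsto_opAt_airyFun hζ z (q := fun _ => D.symbol z) (Eventually.of_forall fun _ => hk)
    fun _ => tendsto_const_nhds
  refine h1.congr fun s => ?_
  rw [opAt_airyFun_swap, ← DiffPoly.apply_eq]
  rfl

end SymbolLimits

/-! ### Smoothness and the eigenvalue equation -/

section Eigenfunction

variable {D : DiffPoly n}

lemma contDiffOn_of_isRationalInDiffs {c : (Fin n → ℝ) → ℂ} (h : IsRationalInDiffs c) :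
    ContDiffOn ℝ (⊤ : ℕ∞) c (Reg n) := by
  obtain ⟨p, q, hpq⟩ := h
  have hc : ∀ p : MvPolynomial (Fin n × Fin n) ℂ, ContDiff ℝ (⊤ : ℕ∞) fun x : Fin n → ℝ =>
      eval (fun k => (x k.1 : ℂ) - (x k.2 : ℂ)) p := by
    intro p
    induction p using MvPolynomial.induction_on with
    | C c => simpa using contDiff_const
    | add p q hp hq => simpa using hp.add hq
    | mul_X p k hp => simpa using hp.mul ((contDiff_coord k.1).sub (contDiff_coord k.2))
  exact ((hc p).contDiffOn.mul ((hc q).contDiffOn.inv fun x hx => (hpq x hx).1)).congr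
    fun x hx => (hpq x hx).2.trans (div_eq_mul_inv _ _)

lemma IsChalykhVeselov.contDiffOn_apply (h : IsChalykhVeselov n D) (f : smoothFun n) :
    ContDiffOn ℝ (⊤ : ℕ∞) (D.apply (f : (Fin n → ℝ) → ℂ)) (Reg n) := by
  refine ContDiffOn.sum fun w _ => (contDiffOn_of_isRationalInDiffs (h.rational w)).mul ?_
  rw [show w.foldr pdDiff (f : (Fin n → ℝ) → ℂ) = fun x => opAt f x (wordPoly w) from
    funext fun x => foldr_pdDiff w f x]
  exact (contDiff_opAt f _).contDiffOn

/-- All partial derivatives of `g` coincide, so `∂_i - ∂_j` treats `g` as a constant. -/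
lemma foldr_pdDiff_mul (w : List (Fin n × Fin n)) (f : smoothFun n) {g : (Fin n → ℝ) → ℂ}
    (hg : Differentiable ℝ g) (hg' : ∀ i j x, pd i g x = pd j g x) (x : Fin n → ℝ) :
    w.foldr pdDiff (fun y => g y * (f : (Fin n → ℝ) → ℂ) y) x =
      g x * w.foldr pdDiff (f : (Fin n → ℝ) → ℂ) x := by
  induction w generalizing x with
  | nil => rfl
  | cons p w ih =>
    have h1 : w.foldr pdDiff (f : (Fin n → ℝ) → ℂ) = fun x => opAt f x (wordPoly w) :=
      funext fun x => foldr_pdDiff w f x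
    have h2 := differentiable_of_contDiff (contDiff_opAt f (wordPoly w)) x
    rw [List.foldr_cons, List.foldr_cons, funext ih, pdDiff, pdDiff, h1, pd_mul (hg x) h2,
      pd_mul (hg x) h2, hg' p.1 p.2]
    ring

lemma DiffPoly.apply_mul (D : DiffPoly n) (f : smoothFun n) {g : (Fin n → ℝ) → ℂ}
    (hg : Differentiable ℝ g) (hg' : ∀ i j x, pd i g x = pd j g x) (x : Fin n → ℝ) :
    D.apply (fun y => g y * (f : (Fin n → ℝ) → ℂ) y) x = g x * D.apply (f : (Fin n → ℝ) → ℂ) x := by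
  rw [DiffPoly.apply, DiffPoly.apply, Finsupp.sum, Finsupp.sum, Finset.mul_sum]
  refine Finset.sum_congr rfl fun w _ => ?_
  rw [foldr_pdDiff_mul w f hg hg']
  ring

/-- The intertwining relation is applied to `Δσ = ∑ (x_i + z_i) σ`, and the linear factor passes
through `D`; moving `∑ x_i` to the other side completes the Hamiltonian. -/
lemma IsChalykhVeselov.hamTilde_sigmaTilde (h : IsChalykhVeselov n D) (z : Fin n → ℝ)
    {x : Fin n → ℝ} (hx : x ∈ Reg n) :
    hamTilde (fun y => sigmaTilde D y z) x = (∑ i, (z i : ℂ)) * sigmaTilde D x z := by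
  have h1 := h.intertwines _ (airyFun z).2 x hx
  rw [lap_airyFun] at h1
  have hg : ContDiff ℝ (⊤ : ℕ∞) fun y : Fin n → ℝ => ∑ i, ((y i : ℂ) + (z i : ℂ)) :=
    ContDiff.sum fun i _ => (contDiff_coord i).add contDiff_const
  have hg' : ∀ i, ∀ y : Fin n → ℝ, pd i (fun y : Fin n → ℝ => ∑ i, ((y i : ℂ) + (z i : ℂ))) y = 1 := by
    intro i y
    have h2 := pd_eval i (∑ j, (X j + C (z j : ℂ))) y
    simpa [pderiv_X, Pi.single_apply] using h2
  have h2 := D.apply_mul (airyFun z) (differentiable_of_contDiff hg)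
    (fun i j y => by rw [hg', hg']) x
  rw [coe_airyFun] at h2
  rw [h2] at h1
  have h3 : lapTilde (D.apply fun y => airyProd y z) x =
      (∑ i, pd i (pd i (D.apply fun y => airyProd y z)) x) -
        cmPotential x * D.apply (fun y => airyProd y z) x := rfl
  rw [coe_airyFun, h3] at h1
  change (∑ i, (pd i (pd i (D.apply fun y => airyProd y z)) x - (x i : ℂ) *
    D.apply (fun y => airyProd y z) x)) - cmPotential x * D.apply (fun y => airyProd y z) x =
    (∑ i, (z i : ℂ)) * D.apply (fun y => airyProd y z) x
  rw [Finset.sum_sub_distrib, ← Finset.sum_mul]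
  rw [Finset.sum_add_distrib] at h1
  linear_combination -h1

end Eigenfunction

end

section

variable {n : ℕ}

/-! ### Non-vanishing and the failure of symmetry -/

section Asymmetry

open Filter Topology

variable {D : DiffPoly n}

lemma cmPotential_ne_zero (hn : 2 ≤ n) {x : Fin n → ℝ} (hx : x ∈ Reg n) : cmPotential x ≠ 0 := by
  have h1 : cmPotential x = ((∑ p ∈ pairs n, 4 / (x p.1 - x p.2) ^ 2 : ℝ) : ℂ) := by
    rw [cmPotential]
    push_cast
    rfl
  rw [h1]
  have hp : ((⟨0, by omega⟩, ⟨1, by omega⟩) : Fin n × Fin n) ∈ pairs n :=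
    mem_pairs.2 (Fin.mk_lt_mk.2 one_pos)
  have h2 : 0 < ∑ p ∈ pairs n, 4 / (x p.1 - x p.2) ^ 2 := by
    refine Finset.sum_pos (fun p hp => ?_) ⟨_, hp⟩
    have h3 : x p.1 - x p.2 ≠ 0 := sub_ne_zero.2 (hx.ne (mem_pairs.1 hp).ne)
    positivity
  exact_mod_cast h2.ne'

lemma exists_neg_eval_ne_zero {e : MvPolynomial (Fin n) ℂ} (he : e ≠ 0) :
    ∃ ζ ∈ Reg n, (∀ i, ζ i < 0) ∧ eval (fun i => (ζ i : ℂ)) e ≠ 0 :=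
  exists_mem_Reg_eval_ne_zero he (Set.Iio_infinite (0 : ℝ))

/-- The leading coefficient `e(ζ)` of the asymptotics is non-zero for a suitable negative `ζ`. -/
lemma IsChalykhVeselov.exists_sigmaTilde_ne_zero (h : IsChalykhVeselov n D) (z : Fin n → ℝ) :
    ∃ x ∈ Reg n, sigmaTilde D x z ≠ 0 := by
  obtain ⟨k, e, he0, hk, he⟩ := h.exists_leading
  obtain ⟨ζ, hreg, hζ, hne⟩ := exists_neg_eval_ne_zero he0
  have h1 := (h.tendsto_sigmaTilde hζ hreg hk he z).eventually_ne hne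
  obtain ⟨s, hs, hpos⟩ := (h1.and (eventually_gt_atTop 0)).exists
  exact ⟨_, squareRay_mem_Reg hζ hreg hpos, fun h0 => hs (by rw [h0, zero_div])⟩

/-- A multiple of `σ̃` can only be symmetric if `σ̃` is. -/
lemma IsChalykhVeselov.isSymm_of_mul (h : IsChalykhVeselov n D) {c : (Fin n → ℝ) → ℂ}
    (hc : ∃ z ∈ Reg n, c z ≠ 0) (hs : IsSymm fun x z => c z * sigmaTilde D x z) :
    IsSymm fun x z => sigmaTilde D x z := by
  obtain ⟨k, e, he0, hk, he⟩ := h.exists_leading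
  obtain ⟨ζ, hreg, hζ, hne⟩ := exists_neg_eval_ne_zero he0
  -- `σ̃(x(s), z)` and `σ̃(z, x(s))` have the same non-zero leading asymptotics, so symmetry makes
  -- `c(x(s))` tend to `c(z)`; the left side does not involve `z`.
  have hlim : ∀ z ∈ Reg n, Tendsto (fun s => c (squareRay ζ s)) atTop (𝓝 (c z)) := by
    intro z hz
    have h1 := h.tendsto_sigmaTilde hζ hreg hk he z
    have h2 := tendsto_sigmaTilde_right hζ (hk z hz)
    rw [he z hz] at h2
    have h3 := (h1.div h2 hne).const_mul (c z)
    rw [div_self hne, mul_one] at h3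
    refine h3.congr' ?_
    filter_upwards [h2.eventually_ne hne, eventually_gt_atTop 0] with s hs0 hpos
    have h4 := hs _ (squareRay_mem_Reg hζ hreg hpos) z hz
    simp only at h4
    rw [Pi.div_apply, ← mul_div_assoc, div_eq_iff hs0, ← mul_div_assoc, ← mul_div_assoc, h4]
  obtain ⟨z₀, hz₀, hc₀⟩ := hc
  have hconst : ∀ z ∈ Reg n, c z = c z₀ := fun z hz => tendsto_nhds_unique (hlim z hz) (hlim z₀ hz₀)
  intro x hx z hz
  have h4 := hs x hx z hz
  simp only [hconst x hx, hconst z hz] at h4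
  exact mul_left_cancel₀ hc₀ h4

/-- The leading asymptotics of both sides agree, so the contradiction comes from the next order.
Symmetry would make the subleading part of the symbol at `ζ` constant off the walls, whereas the
potential acting on the leading part has to be balanced by its derivative along `ζ`. -/
lemma IsChalykhVeselov.not_isSymm (hn : 2 ≤ n) (h : IsChalykhVeselov n D) :
    ¬ IsSymm fun x z => sigmaTilde D x z := by
  intro hs
  obtain ⟨k, e, he0, hk, he⟩ := h.exists_leading
  obtain ⟨ζ, hreg, hζ, hne⟩ := exists_neg_eval_ne_zero he0
  choose B _ hB using fun j => h.exists_functional_eq (evalAt ζ ∘ₗ homogeneousComponent j)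
  simp only [LinearMap.comp_apply, evalAt_apply] at hB
  have hu : ∀ j, ∀ x ∈ Reg n, overVdm (B j) x =
      eval (fun i => (ζ i : ℂ)) (homogeneousComponent j (D.symbol x)) := by
    intro j x hx
    rw [overVdm, ← hB j x hx, mul_comm _ (vdm x), inv_mul_cancel_left₀ (vdm_ne_zero hx)]
  have h0 := mem_Reg_natCast n
  set x₀ : Fin n → ℝ := fun i => ((i : ℕ) : ℝ)
  obtain ⟨g0, gsucc⟩ := h.graded_symbol_equation hB h0
  have hpd : ∀ j, (∀ x ∈ Reg n, overVdm (B j) x = overVdm (B j) x₀) → ∀ i, ∀ x ∈ Reg n,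
      pd i (overVdm (B j)) x = 0 := fun j hj i x hx => by
    rw [pd_congr hx hj, pd_const]
  -- The leading part at `ζ` is a non-zero constant, on which the Calogero-Moser operator acts by
  -- minus the potential.
  have hlead : lapTildeAt x₀ (B k) ≠ 0 := by
    have hj : ∀ x ∈ Reg n, overVdm (B k) x = overVdm (B k) x₀ := fun x hx => by
      rw [hu k x hx, hu k x₀ h0, he x hx, he x₀ h0]
    have hlap : lap (overVdm (B k)) x₀ = 0 := by
      refine Finset.sum_eq_zero fun i _ => ?_
      rw [pd_congr h0 (hpd k hj i), pd_const]
    rw [← lapTilde_overVdm _ h0, lapTilde, hlap, zero_sub, hu k x₀ h0, he x₀ h0]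
    exact neg_ne_zero.2 (mul_ne_zero (cmPotential_ne_zero hn h0) hne)
  obtain ⟨q, hq⟩ := h.exists_tendsto_symbol hζ hreg
  have hev : ∀ᶠ s : ℝ in atTop, squareRay ζ s ∈ Reg n :=
    (eventually_gt_atTop 0).mono fun s hs => squareRay_mem_Reg hζ hreg hs
  cases k with
  -- An operator of order zero has no subleading part that could balance the potential.
  | zero => exact hlead g0
  | succ k =>
    have hconst : ∀ z ∈ Reg n, eval (fun i => (ζ i : ℂ)) (homogeneousComponent k (D.symbol z)) =
        eval (fun i => (ζ i : ℂ)) (homogeneousComponent k q) := by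
      intro z hz
      -- The leading parts at the two points cancel, so the difference has degree at most `k`. By
      -- the assumed symmetry it annihilates `σ`, so the limit of its top part at `ζ` is zero for
      -- every `z`.
      have h1 := tendsto_opAt_airyFun hζ z (j := k)
        (q := fun s => D.symbol (squareRay ζ s) - D.symbol z) (q' := q - D.symbol z)
        (hev.mono fun s hs => ?_) fun β => by
          simpa only [coeff_sub] using (hq β).sub_const _
      · have h2 : Tendsto (fun s : ℝ => opAt (airyFun z) (squareRay ζ s)
            (D.symbol (squareRay ζ s) - D.symbol z) /
            (airyProd (squareRay ζ s) z * (s : ℂ) ^ k)) atTop (𝓝 0) := by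
          refine tendsto_const_nhds.congr' ?_
          filter_upwards [hev] with s hsr
          have h3 : opAt (airyFun z) (squareRay ζ s) (D.symbol (squareRay ζ s)) =
              opAt (airyFun z) (squareRay ζ s) (D.symbol z) := by
            rw [opAt_airyFun_swap (D.symbol z), ← DiffPoly.apply_eq, ← DiffPoly.apply_eq]
            exact hs _ hsr z hz
          rw [map_sub, h3, sub_self, zero_div]
        have h3 := tendsto_nhds_unique h1 h2
        rw [map_sub, map_sub, sub_eq_zero] at h3
        exact h3.symm
      · have h2 : (D.symbol (squareRay ζ s) - D.symbol z).totalDegree ≤ k + 1 :=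
          (totalDegree_sub _ _).trans (max_le (hk _ hs) (hk _ hz))
        have h3 : homogeneousComponent (k + 1) (D.symbol (squareRay ζ s) - D.symbol z) = 0 := by
          rw [map_sub, he _ hs, he _ hz, sub_self]
        rw [← sum_homogeneousComponent (D.symbol (squareRay ζ s) - D.symbol z)]
        refine totalDegree_finsetSum_le fun j hj => ?_
        rcases eq_or_ne j (k + 1) with rfl | hjk
        · rw [h3, totalDegree_zero]
          exact Nat.zero_le _
        · refine (homogeneousComponent_isHomogeneous j _).totalDegree_le.trans ?_
          rw [Finset.mem_range] at hj
          omega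
    have hj : ∀ x ∈ Reg n, overVdm (B k) x = overVdm (B k) x₀ := fun x hx => by
      rw [hu k x hx, hu k x₀ h0, hconst x hx, hconst x₀ h0]
    refine hlead ?_
    have h1 := gsucc k
    rwa [Finset.sum_eq_zero (fun i _ => by
      rw [← pd_overVdm_eq i _ h0, hpd k hj i x₀ h0, mul_zero]), mul_zero, add_zero] at h1

end Asymmetry

end

end AiryCM

end

theorem theorem3 (n : ℕ) (hn : 2 ≤ n) :
    (∃ D : AiryCM.DiffPoly n, AiryCM.IsChalykhVeselov n D) ∧
    ∀ D : AiryCM.DiffPoly n, AiryCM.IsChalykhVeselov n D →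
      (∀ z : Fin n → ℝ,
        ContDiffOn ℝ (⊤ : ℕ∞) (fun x => AiryCM.sigmaTilde D x z) (AiryCM.Reg n) ∧
        (∃ x ∈ AiryCM.Reg n, AiryCM.sigmaTilde D x z ≠ 0) ∧
        ∀ x ∈ AiryCM.Reg n,
          AiryCM.hamTilde (fun y => AiryCM.sigmaTilde D y z) x =
            (∑ i, (z i : ℂ)) * AiryCM.sigmaTilde D x z) ∧
      (¬ AiryCM.IsSymm fun x z => AiryCM.sigmaTilde D x z) ∧
      ∀ c : (Fin n → ℝ) → ℂ, (∃ z ∈ AiryCM.Reg n, c z ≠ 0) →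
        ¬ AiryCM.IsSymm fun x z => c z * AiryCM.sigmaTilde D x z := by
  refine ⟨AiryCM.exists_isChalykhVeselov n, fun D h => ⟨fun z => ⟨?_, ?_, ?_⟩, ?_, ?_⟩⟩
  · exact h.contDiffOn_apply (AiryCM.airyFun z)
  · exact h.exists_sigmaTilde_ne_zero z
  · exact fun x hx => h.hamTilde_sigmaTilde z hx
  · exact h.not_isSymm hn
  · exact fun c hc hs => h.not_isSymm hn (h.isSymm_of_mul hc hs)
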